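/- **Setting.** Let $k$ be a finite field of characteristic $p$, let $R$ be an algebraically closed field of characteristic different from $p$, and let $\psi : k \to R^\times$ be a non-trivial additive character. For $r \ge 1$ put $G_r = \mathrm{GL}_r(k)$ and let $N_r$ be the subgroup of upper triangular unipotent matrices, with the character $\psi(u) = \psi(u_{1,2} + \dots + u_{r-1,r})$. Let $w_r$ be the antidiagonal permutation matrix and $g^* = {}^t g^{-1}$. Let $(H_r)_r$ be one of the following two families of subgroups $H_r \subseteq G_r$: - (Galois case) $k$ is a quadratic extension of a subfield $k_0$, $\psi$ is trivial on $k_0$, and $H_r = \mathrm{GL}_r(k_0)$ for all $r$; - (Levi case) $p \ne 2$ and $H_r$ is the centralizer of $\mathrm{diag}(-1, 1, -1, \dots, (-1)^r)$ in $G_r$ for all $r$. Representations are on $R$-vector spaces. A representation of $G_r$ is *$H_r$-distinguished* if it carries a non-zero $H_r$-invariant linear form. It is *cuspidal* if it is irreducible and is not isomorphic to a subrepresentation of a representation parabolically induced from a proper standard Levi subgroup $G_{r_1} \times \dots \times G_{r_t}$ ($t \ge 2$) and a representation $\sigma_1 \otimes \dots \otimes \sigma_t$ of it. It is *of Whittaker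 type* if $\dim_R \mathrm{Hom}_{N_r}(\pi, \psi) = 1$; it then has a unique generic (that is, irreducible and of Whittaker type) subquotient. For $\pi$ of Whittaker type, the Whittaker model $\mathcal{W}(\pi, \psi)$ is the space of functions $g \mapsto \xi(\pi(g)v)$ on $G_r$, where $v$ runs over $\pi$ and $\xi$ is a fixed non-zero element of $\mathrm{Hom}_{N_r}(\pi, \psi)$ (any choice gives the same space). The same applies to $\psi^{-1}$ in place of $\psi$. Cuspidal representations are of Whittaker type. For a function $W$ on $G_r$ put $\widetilde W(g) = W(w_r g^*)$, and for a character $\theta \in \{\psi, \psi^{-1}\}$ and $f : G_r \to R$ put $I_\theta(f)(g) = |N_r|^{-1} \sum_{u \in N_r} \theta(u)^{-1} f(ug)$. Let $\mathrm{Ind}_{H_r}^{G_r}(1)$ be the space of functions $G_r \to R$ that are invariant under left translations by $H_r$. Let $n \ge 2$. For a function $W \in \mathcal{W}(\pi, \psi)$, where $\pi$ is a cuspidal representation of $G_n$, put $$\Lambda(W) = \sum_{h} W\begin{pmatrix} h & 0 \\ 0 & 1 \end{pmatrix}, \qquad \Lambda^*(W) = \sum_{h} \widetilde W\begin{pmatrix}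 h & 0 \\ 0 & 1 \end{pmatrix},$$ where $h$ runs over $(N_{n-1} \cap H_{n-1}) \backslash H_{n-1}$. For a representation $\pi'$ of Whittaker type of $G_{n-1}$, let $\omega_{\pi'}$ be the central character of its generic subquotient. The factor $\gamma(\pi, \pi', \psi) \in R$ is the unique scalar such that $$\sum_{g} \widetilde W\begin{pmatrix} g & 0 \\ 0 & 1 \end{pmatrix} \widetilde{W'}(g) = \omega_{\pi'}(-1)^{n-1} \cdot \gamma(\pi, \pi', \psi) \cdot \sum_{g} W\begin{pmatrix} g & 0 \\ 0 & 1 \end{pmatrix} W'(g)$$ for all $W \in \mathcal{W}(\pi, \psi)$ and $W' \in \mathcal{W}(\pi', \psi^{-1})$, where $g$ runs over $N_{n-1} \backslash G_{n-1}$. **Proposition.** Let $n \ge 2$ and let $\pi$ be an $H_n$-distinguished cuspidal representation of $G_n$. There is a unique scalar $c(\pi, \psi) \in R$ such that $\Lambda^* = c(\pi, \psi) \cdot \Lambda$ on $\mathcal{W}(\pi, \psi)$, and it is non-zero. Moreover, for every representation $\pi'$ of Whittaker type of $G_{n-1}$ such that $$\mathcal{W}(\pi', \psi^{-1}) \cap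 I_{\psi^{-1}}\bigl(\mathrm{Ind}_{H_{n-1}}^{G_{n-1}}(1)\bigr) \ne \{0\},$$ there is a unique scalar $\gamma(\pi, \pi', \psi)$ satisfying the functional equation above, and $$\gamma(\pi, \pi', \psi) = c(\pi, \psi).$$ In particular $\gamma(\pi, \pi', \psi)$ does not depend on $\pi'$. -/

import Mathlib

open Matrix
open scoped TensorProduct MatrixGroups

noncomputable section

namespace FiniteGL

universe uk uR v w

/-! ### Generalities on groups and representations -/

section General

variable {G : Type*} [Group G] {R : Type*} [Field R]

/-- The sum of `F` over the space `S \ G` of right cosets `S g`, computed on representatives.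
It is only used for functions `F` that are invariant under left translation by `S`. -/
def cosetSum [Finite G] (S : Subgroup G) (F : G → R) : R :=
  ∑ᶠ x : Quotient (QuotientGroup.rightRel S), F x.out

/-- `π` is `H`-distinguished: it carries a non-zero `H`-invariant linear form. -/
def IsDistinguished {V : Type*} [AddCommGroup V] [Module R V]
    (H : Subgroup G) (π : Representation R G V) : Prop :=
  ∃ ξ : Module.Dual R V, ξ ≠ 0 ∧ ∀ h ∈ H, ∀ x : V, ξ (π h x) = ξ x

/-- `τ` is a subquotient of `π`: a quotient of a subrepresentation of `π`. -/
def IsSubquotient {V W : Type*} [AddCommGroup V] [Module R V] [AddCommGroup W] [Module R W]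
    (τ : Representation R G W) (π : Representation R G V) : Prop :=
  ∃ (T : Subrepresentation π) (f : T.toRepresentation.IntertwiningMap τ), Function.Surjective f

end General

/-! ### Elements and subgroups of `GL n` -/

section Groups

variable {k : Type uk} [Field k]

/-- The block matrix `(A B; 0 D)` in `GL n`, where `n = a + b`. -/
def blockUpper {a b n : ℕ} (h : a + b = n) (A : GL (Fin a) k) (B : Matrix (Fin a) (Fin b) k)
    (D : GL (Fin b) k) : GL (Fin n) k :=
  Units.map (Matrix.reindexAlgEquiv k k (finSumFinEquiv.trans (finCongr h))).toMonoidHom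
    { val := Matrix.fromBlocks A.val B 0 D.val
      inv := Matrix.fromBlocks A⁻¹.val (-(A⁻¹.val * B * D⁻¹.val)) 0 D⁻¹.val
      val_inv := by
        have hA : A.val * A⁻¹.val = 1 := A.mul_inv
        have hD : D.val * D⁻¹.val = 1 := D.mul_inv
        rw [Matrix.fromBlocks_multiply, hA, hD, ← Matrix.fromBlocks_one]
        congr 1 <;> simp only [Matrix.mul_neg, ← Matrix.mul_assoc, hA, Matrix.one_mul,
          Matrix.mul_zero, Matrix.zero_mul, add_zero, neg_zero, zero_add, neg_add_cancel]
      inv_val := by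
        have hA : A⁻¹.val * A.val = 1 := A.inv_mul
        have hD : D⁻¹.val * D.val = 1 := D.inv_mul
        rw [Matrix.fromBlocks_multiply, hA, hD, ← Matrix.fromBlocks_one]
        congr 1 <;> simp only [Matrix.neg_mul, Matrix.mul_assoc, hD, Matrix.mul_one,
          Matrix.mul_zero, Matrix.zero_mul, add_zero, zero_add, add_neg_cancel] }

/-- The embedding `g ↦ diag(g, 1)` of `GL m` into `GL (m + 1)`. -/
def diagOne {m : ℕ} (g : GL (Fin m) k) : GL (Fin (m + 1)) k :=
  blockUpper rfl g 0 1

/-- `g^*`, the transpose of the inverse of `g`. -/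
def starGL {n : ℕ} (g : GL (Fin n) k) : GL (Fin n) k where
  val := (g⁻¹.val)ᵀ
  inv := (g.val)ᵀ
  val_inv := by
    have h : g.val * g⁻¹.val = 1 := g.mul_inv
    rw [← Matrix.transpose_mul, h, Matrix.transpose_one]
  inv_val := by
    have h : g⁻¹.val * g.val = 1 := g.inv_mul
    rw [← Matrix.transpose_mul, h, Matrix.transpose_one]

/-- The antidiagonal permutation matrix `w_n`. -/
def antidiagGL (k : Type uk) [Field k] (n : ℕ) : GL (Fin n) k :=
  have h : (Matrix.of fun i j : Fin n => if j = i.rev then (1 : k) else 0) *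
      (Matrix.of fun i j : Fin n => if j = i.rev then (1 : k) else 0) = 1 := by
    ext i j
    rw [Matrix.mul_apply, Finset.sum_eq_single i.rev]
    · simp [Matrix.one_apply, eq_comm]
    · intro x _ hx
      simp [hx]
    · simp
  { val := Matrix.of fun i j : Fin n => if j = i.rev then (1 : k) else 0
    inv := Matrix.of fun i j : Fin n => if j = i.rev then (1 : k) else 0
    val_inv := h
    inv_val := h }

lemma upper_mul_diag {n : ℕ} {A B : Matrix (Fin n) (Fin n) k}
    (hA : A.BlockTriangular id) (hB : B.BlockTriangular id) (i : Fin n) :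
    (A * B) i i = A i i * B i i := by
  rw [Matrix.mul_apply]
  refine Finset.sum_eq_single i (fun j _ hj => ?_) (by simp)
  rcases lt_or_gt_of_ne hj with h | h
  · rw [hA (show id j < id i from h), zero_mul]
  · rw [hB (show id i < id j from h), mul_zero]

/-- The subgroup `N_n` of upper triangular unipotent matrices. -/
def unipotent (k : Type uk) [Field k] (n : ℕ) : Subgroup (GL (Fin n) k) where
  carrier := {g | g.val.BlockTriangular id ∧ ∀ i, g.val i i = 1}
  one_mem' := ⟨by simpa using Matrix.blockTriangular_one, fun i => by simp⟩
  mul_mem' {a b} ha hb := by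
    refine ⟨by simpa using ha.1.mul hb.1, fun i => ?_⟩
    rw [Units.val_mul, upper_mul_diag ha.1 hb.1, ha.2, hb.2, one_mul]
  inv_mem' {a} ha := by
    let _ : Invertible a.val := a.invertible
    have h1 : (a⁻¹.val).BlockTriangular id := by
      rw [Matrix.coe_units_inv]
      exact Matrix.blockTriangular_inv_of_blockTriangular ha.1
    refine ⟨h1, fun i => ?_⟩
    have h2 := upper_mul_diag ha.1 h1 i
    have h3 : a.val * a⁻¹.val = 1 := a.mul_inv
    rw [h3, ha.2, one_mul, Matrix.one_apply_eq] at h2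
    exact h2.symm

/-- `diag(-1, 1, -1, …, (-1)^n)` in `GL n`. -/
def signGL (k : Type uk) [Field k] (n : ℕ) : GL (Fin n) k :=
  have h : Matrix.diagonal (fun i : Fin n => (-1 : k) ^ (i.val + 1)) *
      Matrix.diagonal (fun i : Fin n => (-1 : k) ^ (i.val + 1)) = 1 := by
    rw [Matrix.diagonal_mul_diagonal, ← Matrix.diagonal_one]
    congr 1
    funext i
    rw [← mul_pow]
    simp
  { val := Matrix.diagonal fun i : Fin n => (-1 : k) ^ (i.val + 1)
    inv := Matrix.diagonal fun i : Fin n => (-1 : k) ^ (i.val + 1)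
    val_inv := h
    inv_val := h }

/-- The Galois case: `k` is a quadratic extension of a subfield `k₀`, one has
`H_r = GL_r(k₀)` for all `r`, and the character `ψ` is trivial on `k₀`. -/
def IsGaloisCase {R : Type uR} [Field R] (ψ : AddChar k R)
    (H : (r : ℕ) → Subgroup (GL (Fin r) k)) : Prop :=
  ∃ k₀ : Subfield k, Module.finrank k₀ k = 2 ∧ (∀ x ∈ k₀, ψ x = 1) ∧
    ∀ r, H r = (Matrix.GeneralLinearGroup.map (n := Fin r) k₀.subtype).range

/-- The Levi case: `k` has odd characteristic and `H_r` is the centralizer of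
`diag(-1, 1, …, (-1)^r)` in `GL_r(k)` for all `r`. -/
def IsLeviCase (H : (r : ℕ) → Subgroup (GL (Fin r) k)) : Prop :=
  ringChar k ≠ 2 ∧ ∀ r, H r = Subgroup.centralizer {signGL k r}

end Groups

/-! ### Cuspidal representations -/

section Cuspidal

variable {k : Type uk} [Field k] {R : Type uR} [Field R]

/-- The space of the representation `σ₁ × σ₂` of `GL n`, `n = a + b`, parabolically induced from
`σ₁ ⊗ σ₂`: functions `f` on `GL n` with values in `V₁ ⊗ V₂` such that
`f ((A B; 0 D) g) = (σ₁(A) ⊗ σ₂(D)) (f g)`. -/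
def parabolicSpace {a b n : ℕ} (h : a + b = n) {V₁ V₂ : Type*}
    [AddCommGroup V₁] [Module R V₁] [AddCommGroup V₂] [Module R V₂]
    (σ₁ : Representation R (GL (Fin a) k) V₁) (σ₂ : Representation R (GL (Fin b) k) V₂) :
    Submodule R (GL (Fin n) k → V₁ ⊗[R] V₂) where
  carrier := {f | ∀ A B D g,
    f (blockUpper h A B D * g) = TensorProduct.map (σ₁ A) (σ₂ D) (f g)}
  zero_mem' := fun A B D g => by simp
  add_mem' {f f'} hf hf' := fun A B D g => by
    simp only [Pi.add_apply, map_add, hf A B D g, hf' A B D g]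
  smul_mem' c f hf := fun A B D g => by
    simp only [Pi.smul_apply, map_smul, hf A B D g]

/-- The representation `σ₁ × σ₂`: right translations on `parabolicSpace`. -/
def parabolicInduction {a b n : ℕ} (h : a + b = n) {V₁ V₂ : Type*}
    [AddCommGroup V₁] [Module R V₁] [AddCommGroup V₂] [Module R V₂]
    (σ₁ : Representation R (GL (Fin a) k) V₁) (σ₂ : Representation R (GL (Fin b) k) V₂) :
    Representation R (GL (Fin n) k) (parabolicSpace h σ₁ σ₂) where
  toFun x :=
    { toFun := fun f => ⟨fun g => f.1 (g * x), fun A B D g => by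
        have h₁ := f.2 A B D (g * x)
        rwa [← mul_assoc] at h₁⟩
      map_add' := fun _ _ => rfl
      map_smul' := fun _ _ => rfl }
  map_one' := by
    ext f : 1
    apply Subtype.ext
    funext g
    simp
  map_mul' x y := by
    ext f : 1
    apply Subtype.ext
    funext g
    simp [mul_assoc]

/-- `π` is an irreducible cuspidal representation of `GL n`: it is irreducible and is not
isomorphic to a subrepresentation of a properly parabolically induced representation.
Two blocks suffice since `σ₁ × ⋯ × σ_r = σ₁ × (σ₂ × ⋯ × σ_r)`. -/
def IsCuspidal {n : ℕ} {V : Type v} [AddCommGroup V] [Module R V]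
    (π : Representation R (GL (Fin n) k) V) : Prop :=
  π.IsIrreducible ∧
    ∀ (a b : ℕ) (h : a + b = n), 0 < a → 0 < b →
      ∀ (V₁ V₂ : Type uR) [AddCommGroup V₁] [Module R V₁] [AddCommGroup V₂] [Module R V₂]
        (σ₁ : Representation R (GL (Fin a) k) V₁) (σ₂ : Representation R (GL (Fin b) k) V₂)
        (f : π.IntertwiningMap (parabolicInduction h σ₁ σ₂)), ¬ Function.Injective f

end Cuspidal

/-! ### Whittaker models -/

section Whittaker

variable {k : Type uk} [Field k] {R : Type uR} [Field R]

/-- The character `u ↦ ψ(u_{1,2} + ⋯ + u_{n-1,n})` of `N_n`. -/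
def unipChar {n : ℕ} (ψ : AddChar k R) (u : GL (Fin n) k) : R :=
  ψ (∑ i : Fin n, if h : i.val + 1 < n then u.val i ⟨i.val + 1, h⟩ else 0)

/-- The space `Hom_N(π, ψ)`. -/
def whittakerFunctionals {n : ℕ} (ψ : AddChar k R) {V : Type*} [AddCommGroup V] [Module R V]
    (π : Representation R (GL (Fin n) k) V) : Submodule R (Module.Dual R V) where
  carrier := {ξ | ∀ u ∈ unipotent k n, ∀ x : V, ξ (π u x) = unipChar ψ u * ξ x}
  zero_mem' := fun u _ x => by simp
  add_mem' {ξ ξ'} hξ hξ' := fun u hu x => by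
    simp only [LinearMap.add_apply, hξ u hu x, hξ' u hu x, mul_add]
  smul_mem' c ξ hξ := fun u hu x => by
    simp only [LinearMap.smul_apply, hξ u hu x, smul_eq_mul, mul_left_comm]

/-- `π` is of Whittaker type: `dim Hom_N(π, ψ) = 1`. -/
def IsWhittakerType {n : ℕ} (ψ : AddChar k R) {V : Type*} [AddCommGroup V] [Module R V]
    (π : Representation R (GL (Fin n) k) V) : Prop :=
  Module.finrank R (whittakerFunctionals ψ π) = 1

/-- `π` is generic: irreducible and of Whittaker type. -/
def IsGeneric {n : ℕ} (ψ : AddChar k R) {V : Type*} [AddCommGroup V] [Module R V]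
    (π : Representation R (GL (Fin n) k) V) : Prop :=
  π.IsIrreducible ∧ IsWhittakerType ψ π

/-- The Whittaker model `W(π, ψ)`: the functions `g ↦ ξ(π(g) x)` on `GL n`, for `x` in `π` and
`ξ` in `Hom_N(π, ψ)`. When `Hom_N(π, ψ)` has dimension `1`, this is the image of
`x ↦ (g ↦ ξ(π(g) x))` for any fixed non-zero `ξ`. -/
def whittakerModel {n : ℕ} (ψ : AddChar k R) {V : Type*} [AddCommGroup V] [Module R V]
    (π : Representation R (GL (Fin n) k) V) : Set (GL (Fin n) k → R) :=
  {W | ∃ ξ ∈ whittakerFunctionals ψ π, ∃ x : V, W = fun g => ξ (π g x)}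

/-- The function `g ↦ W(w_n g^*)`. -/
def tilde {n : ℕ} (W : GL (Fin n) k → R) : GL (Fin n) k → R :=
  fun g => W (antidiagGL k n * starGL g)

/-- The idempotent `I_ψ` of the space of functions on `GL n`:
`I_ψ(f)(g) = |N|⁻¹ ∑_{u ∈ N} ψ⁻¹(u) f(u g)`. -/
def whittakerProj {n : ℕ} (ψ : AddChar k R) (f : GL (Fin n) k → R) : GL (Fin n) k → R :=
  fun g => (Nat.card (unipotent k n) : R)⁻¹ *
    ∑ᶠ u : unipotent k n, unipChar ψ⁻¹ (u : GL (Fin n) k) * f (u * g)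

/-- The space of `Ind_H^G(1)`: functions on `G` invariant under left translation by `H`. -/
def inducedTrivial {n : ℕ} (R : Type uR) (H : Subgroup (GL (Fin n) k)) :
    Set (GL (Fin n) k → R) :=
  {f | ∀ h ∈ H, ∀ g, f (h * g) = f g}

/-- `W(π, ψ)` meets `I_ψ(Ind_H^G(1))` non-trivially. -/
def MeetsInduced {n : ℕ} (ψ : AddChar k R) (H : Subgroup (GL (Fin n) k))
    {V : Type*} [AddCommGroup V] [Module R V] (π : Representation R (GL (Fin n) k) V) : Prop :=
  ∃ W ∈ whittakerModel ψ π ∩ whittakerProj ψ '' inducedTrivial R H, W ≠ 0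

/-- `s` is the value at `-1` of the central character of a generic subquotient of `π`. -/
def IsGenericSignValue {n : ℕ} (ψ : AddChar k R) {V : Type v} [AddCommGroup V] [Module R V]
    (π : Representation R (GL (Fin n) k) V) (s : R) : Prop :=
  ∃ (T : Type v) (_ : AddCommGroup T) (_ : Module R T) (τ : Representation R (GL (Fin n) k) T),
    IsGeneric ψ τ ∧ IsSubquotient τ π ∧ ∀ t : T, τ (-1) t = s • t

end Whittaker

/-! ### The invariant linear forms and the gamma factor -/

section Gamma

variable {k : Type uk} [Field k] [Finite k] {R : Type uR} [Field R]

/-- `Λ(W)`, the sum of `W(diag(h, 1))` over `h ∈ (N_{n-1} ∩ H_{n-1}) \ H_{n-1}`, where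
`n = m + 1` and `H = H_{n-1}`. -/
def formΛ {m : ℕ} (H : Subgroup (GL (Fin m) k)) (W : GL (Fin (m + 1)) k → R) : R :=
  cosetSum ((unipotent k m).subgroupOf H) fun h => W (diagOne (h : GL (Fin m) k))

/-- `Λ^*(W)`, the sum of `W(w_n diag(h, 1)^*)` over `h ∈ (N_{n-1} ∩ H_{n-1}) \ H_{n-1}`. -/
def formΛStar {m : ℕ} (H : Subgroup (GL (Fin m) k)) (W : GL (Fin (m + 1)) k → R) : R :=
  formΛ H (tilde W)

/-- `Λ^* = a · Λ` on the Whittaker model `W(π, ψ)`. -/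
def IsFormRatio {m : ℕ} (ψ : AddChar k R) (H : Subgroup (GL (Fin m) k))
    {V : Type*} [AddCommGroup V] [Module R V] (π : Representation R (GL (Fin (m + 1)) k) V)
    (a : R) : Prop :=
  ∀ W ∈ whittakerModel ψ π, formΛStar H W = a * formΛ H W

/-- The Rankin–Selberg sum `I_0(W, W') = ∑ W(diag(g, 1)) W'(g)` over `g ∈ N_{n-1} \ G_{n-1}`,
for `n = m + 1`. -/
def rankinSelbergSum {m : ℕ} (W : GL (Fin (m + 1)) k → R) (W' : GL (Fin m) k → R) : R :=
  cosetSum (unipotent k m) fun g => W (diagOne g) * W' g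

/-- The functional equation defining the gamma factor `a = γ(π, π', ψ)` of a pair of
representations of `GL n` and `GL (n - 1)`, `n = m + 1`:
`I_0(W~, W'~) = ω_{π'}(-1)^{n-1} · a · I_0(W, W')`
for all Whittaker functions `W ∈ W(π, ψ)` and `W' ∈ W(π', ψ⁻¹)`, where `ω_{π'}` is the central
character of the generic subquotient of `π'`. For the pair `(n, n - 1)` there is a single
functional equation, in which no power of the cardinality of `k` occurs. -/
def IsGammaFactor {m : ℕ} (ψ : AddChar k R)
    {V : Type*} [AddCommGroup V] [Module R V] (π : Representation R (GL (Fin (m + 1)) k) V)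
    {V' : Type*} [AddCommGroup V'] [Module R V'] (π' : Representation R (GL (Fin m) k) V')
    (a : R) : Prop :=
  ∃ s : R, IsGenericSignValue ψ π' s ∧
    ∀ W ∈ whittakerModel ψ π, ∀ W' ∈ whittakerModel ψ⁻¹ π',
      rankinSelbergSum (tilde W) (tilde W') = s ^ m * a * rankinSelbergSum W W'

end Gamma

end FiniteGL

end

/-! Everything is moved from Whittaker functions to linear forms on the space of π. Cuspidality is
used only through Frobenius reciprocity: no non-zero linear form on π is invariant under the
unipotent radical of a proper standard parabolic (`IsCuspidal.hasNoUnipotentForms`). Fourier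
analysis along the columns of N then shows that the dual of π is spanned by the GL_{n-1}-translates
of Whittaker functionals (`HasNoUnipotentForms.dual_mem`), and Gelfand's trick with the
antitransposition shows that the Whittaker functional ξ is unique
(`exists_smul_eq_of_mem_whittakerVectors`). This yields the Kirillov model: x is determined by g ↦
ξ(π(diag(g, 1))x), and a Bessel vector x₀ has the Kirillov function that is ψ on N_{n-1} and zero
elsewhere (`exists_isKirillovPair`).

Let μ be a form invariant under the mirabolic part of H_n. The function g ↦ μ(π(g⁻¹)x₀) is
equivariant under N on the left and invariant under that part of H_n on the right. On GL_{n-1} such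
functions live on N H, so μ is determined by μ(x₀) (`IsKirillovPair.eq_zero_of_invariant`). The form
Λ is of this kind and has Λ(x₀) = 1. Hence any H_n-invariant form is a multiple of Λ, and
distinction makes Λ itself H_n-invariant. The form Λ^* is the analogue of Λ for the twist of π by g
↦ g^*, so it is H_n-invariant too, and is a non-zero multiple c of Λ
(`IsAdmissibleFamily.exists_ratio`). In the Levi case the same support argument, for another
ordering of the signs, rules out odd n; therefore w_{n-1} lies in H_{n-1} in both cases.

By expansion in delta functions, GL_{n-1}-invariant bilinear forms on π × π' are unique up to a
scalar, which provides γ. To compute it, take W' = I(f) with f left H_{n-1}-invariant. The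
Rankin–Selberg sum unfolds into a combination of values of Λ, and the dual sum, after g ↦ w g^*,
into the same combination of values of Λ^*. Hence γ = c. The sign in the functional equation is 1
because -1 lies in H_{n-1} (`isGammaFactor_iff`). -/

noncomputable section

namespace FiniteGL

universe uk uR v w

/-! ### Block matrices, unipotent matrices and the involutions of GL_n -/

section Groups

variable {k : Type uk} [Field k] {R : Type uR} [Field R]

lemma blockUpper_val {a b n : ℕ} (h : a + b = n) (A : GL (Fin a) k) (B : Matrix (Fin a) (Fin b) k)
    (D : GL (Fin b) k) : (blockUpper h A B D).val =
      Matrix.reindex (finSumFinEquiv.trans (finCongr h)) (finSumFinEquiv.trans (finCongr h))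
        (Matrix.fromBlocks A.val B 0 D.val) := rfl

lemma blockUpper_mul {a b n : ℕ} (h : a + b = n) (A A' : GL (Fin a) k)
    (B B' : Matrix (Fin a) (Fin b) k) (D D' : GL (Fin b) k) :
    blockUpper h A B D * blockUpper h A' B' D' =
      blockUpper h (A * A') (A.val * B' + B * D'.val) (D * D') := by
  apply Units.ext
  rw [Units.val_mul, blockUpper_val, blockUpper_val, blockUpper_val]
  simp only [Matrix.reindex_apply, Matrix.submatrix_mul_equiv, Matrix.fromBlocks_multiply]
  simp

lemma blockUpper_one {a b n : ℕ} (h : a + b = n) :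
    blockUpper h (1 : GL (Fin a) k) 0 (1 : GL (Fin b) k) = 1 := by
  apply Units.ext
  rw [blockUpper_val, Units.val_one, Units.val_one, Matrix.fromBlocks_one, Matrix.reindex_apply,
    Matrix.submatrix_one_equiv, Units.val_one]

/-- The unipotent matrix `(1 y; 0 1)` of `GL (m + 1)` attached to a column vector `y`. -/
def colGL {m : ℕ} (y : Fin m → k) : GL (Fin (m + 1)) k :=
  blockUpper rfl 1 (Matrix.of fun i _ => y i) 1

section Entries

variable {m : ℕ}

@[simp] lemma diagOne_castSucc_castSucc (g : GL (Fin m) k) (i j : Fin m) :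
    (diagOne g).val i.castSucc j.castSucc = g.val i j := by
  have : ∀ i : Fin m, i.castSucc = (finSumFinEquiv.trans (finCongr rfl)) (Sum.inl i) := fun i => rfl
  rw [this, this, diagOne, blockUpper_val, Matrix.reindex_apply, Matrix.submatrix_apply,
    Equiv.symm_apply_apply, Equiv.symm_apply_apply]
  rfl

lemma last_eq_equiv : Fin.last m = (finSumFinEquiv.trans (finCongr rfl)) (Sum.inr (0 : Fin 1)) := rfl

@[simp] lemma diagOne_castSucc_last (g : GL (Fin m) k) (i : Fin m) :
    (diagOne g).val i.castSucc (Fin.last m) = 0 := by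
  have : ∀ i : Fin m, i.castSucc = (finSumFinEquiv.trans (finCongr rfl)) (Sum.inl i) := fun i => rfl
  rw [this, last_eq_equiv, diagOne, blockUpper_val, Matrix.reindex_apply, Matrix.submatrix_apply,
    Equiv.symm_apply_apply, Equiv.symm_apply_apply]
  rfl

@[simp] lemma diagOne_last_castSucc (g : GL (Fin m) k) (i : Fin m) :
    (diagOne g).val (Fin.last m) i.castSucc = 0 := by
  have : ∀ i : Fin m, i.castSucc = (finSumFinEquiv.trans (finCongr rfl)) (Sum.inl i) := fun i => rfl
  rw [this, last_eq_equiv, diagOne, blockUpper_val, Matrix.reindex_apply, Matrix.submatrix_apply,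
    Equiv.symm_apply_apply, Equiv.symm_apply_apply]
  rfl

@[simp] lemma diagOne_last_last (g : GL (Fin m) k) :
    (diagOne g).val (Fin.last m) (Fin.last m) = 1 := by
  rw [last_eq_equiv, diagOne, blockUpper_val, Matrix.reindex_apply, Matrix.submatrix_apply,
    Equiv.symm_apply_apply]
  rfl

@[simp] lemma colGL_castSucc_castSucc (y : Fin m → k) (i j : Fin m) :
    (colGL y).val i.castSucc j.castSucc = (1 : Matrix (Fin m) (Fin m) k) i j := by
  have : ∀ i : Fin m, i.castSucc = (finSumFinEquiv.trans (finCongr rfl)) (Sum.inl i) := fun i => rfl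
  rw [this, this, colGL, blockUpper_val, Matrix.reindex_apply, Matrix.submatrix_apply,
    Equiv.symm_apply_apply, Equiv.symm_apply_apply]
  rfl

@[simp] lemma colGL_castSucc_last (y : Fin m → k) (i : Fin m) :
    (colGL y).val i.castSucc (Fin.last m) = y i := by
  have : ∀ i : Fin m, i.castSucc = (finSumFinEquiv.trans (finCongr rfl)) (Sum.inl i) := fun i => rfl
  rw [this, last_eq_equiv, colGL, blockUpper_val, Matrix.reindex_apply, Matrix.submatrix_apply,
    Equiv.symm_apply_apply, Equiv.symm_apply_apply]
  rfl

@[simp] lemma colGL_last_castSucc (y : Fin m → k) (i : Fin m) :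
    (colGL y).val (Fin.last m) i.castSucc = 0 := by
  have : ∀ i : Fin m, i.castSucc = (finSumFinEquiv.trans (finCongr rfl)) (Sum.inl i) := fun i => rfl
  rw [this, last_eq_equiv, colGL, blockUpper_val, Matrix.reindex_apply, Matrix.submatrix_apply,
    Equiv.symm_apply_apply, Equiv.symm_apply_apply]
  rfl

@[simp] lemma colGL_last_last (y : Fin m → k) :
    (colGL y).val (Fin.last m) (Fin.last m) = 1 := by
  rw [last_eq_equiv, colGL, blockUpper_val, Matrix.reindex_apply, Matrix.submatrix_apply,
    Equiv.symm_apply_apply]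
  rfl

lemma GL_ext_succ {g h : GL (Fin (m + 1)) k}
    (h1 : ∀ i j : Fin m, g.val i.castSucc j.castSucc = h.val i.castSucc j.castSucc)
    (h2 : ∀ i : Fin m, g.val i.castSucc (Fin.last m) = h.val i.castSucc (Fin.last m))
    (h3 : ∀ i : Fin m, g.val (Fin.last m) i.castSucc = h.val (Fin.last m) i.castSucc)
    (h4 : g.val (Fin.last m) (Fin.last m) = h.val (Fin.last m) (Fin.last m)) : g = h := by
  apply Units.ext
  ext i j
  induction i using Fin.lastCases with
  | last => induction j using Fin.lastCases with
    | last => exact h4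
    | cast j => exact h3 j
  | cast i => induction j using Fin.lastCases with
    | last => exact h2 i
    | cast j => exact h1 i j

lemma diagOne_mul (g h : GL (Fin m) k) : diagOne (g * h) = diagOne g * diagOne h := by
  rw [diagOne, diagOne, diagOne, blockUpper_mul]
  simp

@[simp] lemma diagOne_one : diagOne (1 : GL (Fin m) k) = 1 := blockUpper_one _

lemma diagOne_inv (g : GL (Fin m) k) : diagOne g⁻¹ = (diagOne g)⁻¹ := by
  rw [eq_inv_iff_mul_eq_one, ← diagOne_mul, inv_mul_cancel, diagOne_one]

lemma colGL_add (y z : Fin m → k) : colGL (y + z) = colGL y * colGL z := by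
  rw [colGL, colGL, colGL, blockUpper_mul]
  congr 1
  · simp
  · ext i j
    simp [add_comm]
  · simp

@[simp] lemma colGL_zero : colGL (0 : Fin m → k) = 1 := blockUpper_one _

lemma colGL_neg (y : Fin m → k) : colGL (-y) = (colGL y)⁻¹ := by
  rw [eq_inv_iff_mul_eq_one, ← colGL_add, neg_add_cancel, colGL_zero]

lemma diagOne_mul_colGL (g : GL (Fin m) k) (y : Fin m → k) :
    diagOne g * colGL y = colGL (g.val *ᵥ y) * diagOne g := by
  rw [diagOne, colGL, colGL, blockUpper_mul, blockUpper_mul]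
  congr 1
  · simp
  · ext i j
    simp [Matrix.mul_apply, Matrix.mulVec, dotProduct]

/-- A matrix with last row `(0, …, 0, 1)` is of the form `(g y; 0 1)`. -/
lemma exists_eq_colGL_mul_diagOne {g : GL (Fin (m + 1)) k}
    (h1 : ∀ i : Fin m, g.val (Fin.last m) i.castSucc = 0) (h2 : g.val (Fin.last m) (Fin.last m) = 1) :
    ∃ (y : Fin m → k) (g' : GL (Fin m) k), g = colGL y * diagOne g' := by
  let A : Matrix (Fin m) (Fin m) k := Matrix.of fun i j => g.val i.castSucc j.castSucc
  have hA : IsUnit A := by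
    rw [← Matrix.mulVec_injective_iff_isUnit]
    refine (injective_iff_map_eq_zero (Matrix.mulVecLin A)).2 ?_
    intro x hx
    have hg : IsUnit g.val := g.isUnit
    rw [← Matrix.mulVec_injective_iff_isUnit] at hg
    have h0 := (injective_iff_map_eq_zero (Matrix.mulVecLin g.val)).1 hg
    let e : Fin (m + 1) → k := Fin.snoc x 0
    have : e = 0 := by
      apply h0
      ext i
      rw [Matrix.mulVecLin_apply, Matrix.mulVec, dotProduct, Fin.sum_univ_castSucc]
      induction i using Fin.lastCases with
      | last => simp [h1, e]
      | cast i =>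
        have := congrFun hx i
        rw [Matrix.mulVecLin_apply, Matrix.mulVec, dotProduct] at this
        simpa [e, A] using this
    ext i
    simpa [e] using congrFun this i.castSucc
  obtain ⟨A', hA'⟩ := hA
  refine ⟨fun i => g.val i.castSucc (Fin.last m), A', ?_⟩
  apply GL_ext_succ
  · intro i j
    simp [Units.val_mul, Matrix.mul_apply, Fin.sum_univ_castSucc, hA', Matrix.one_apply, A]
  · intro i
    simp [Units.val_mul, Matrix.mul_apply, Fin.sum_univ_castSucc]
  · intro i
    simp [Units.val_mul, Matrix.mul_apply, Fin.sum_univ_castSucc, h1]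
  · simp [Units.val_mul, Matrix.mul_apply, Fin.sum_univ_castSucc, h2]

end Entries

section Unipotent

variable {m n : ℕ}

lemma mem_unipotent_iff {g : GL (Fin n) k} :
    g ∈ unipotent k n ↔ (∀ i j, j < i → g.val i j = 0) ∧ ∀ i, g.val i i = 1 := Iff.rfl

lemma diagOne_mem_unipotent {g : GL (Fin m) k} : diagOne g ∈ unipotent k (m + 1) ↔
    g ∈ unipotent k m := by
  simp only [mem_unipotent_iff]
  constructor
  · rintro ⟨h1, h2⟩
    exact ⟨fun i j hij => by simpa using h1 i.castSucc j.castSucc (by simpa using hij),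
      fun i => by simpa using h2 i.castSucc⟩
  · rintro ⟨h1, h2⟩
    refine ⟨fun i j hij => ?_, fun i => ?_⟩
    · induction i using Fin.lastCases with
      | last => induction j using Fin.lastCases with
        | last => simp at hij
        | cast j => simp
      | cast i => induction j using Fin.lastCases with
        | last => simp
        | cast j => simpa using h1 i j (by simpa using hij)
    · induction i using Fin.lastCases with
      | last => simp
      | cast i => simpa using h2 i

lemma colGL_mem_unipotent (y : Fin m → k) : colGL y ∈ unipotent k (m + 1) := by
  simp only [mem_unipotent_iff]
  refine ⟨fun i j hij => ?_, fun i => ?_⟩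
  · induction i using Fin.lastCases with
    | last => induction j using Fin.lastCases with
      | last => simp at hij
      | cast j => simp
    | cast i => induction j using Fin.lastCases with
      | last => exact absurd hij (by simp [Fin.le_last])
      | cast j => simpa using Matrix.one_apply_ne (by
          rintro rfl
          simp at hij)
  · induction i using Fin.lastCases with
    | last => simp
    | cast i => simp

lemma unipChar_succ (ψ : AddChar k R) (u : GL (Fin (m + 1)) k) :
    unipChar ψ u = ψ (∑ i : Fin m, u.val i.castSucc i.succ) := by
  rw [unipChar, Fin.sum_univ_castSucc]
  congr 1
  simp
  rfl

lemma unipotent_superdiag_mul {u v : GL (Fin (m + 1)) k} (hu : u ∈ unipotent k (m + 1))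
    (hv : v ∈ unipotent k (m + 1)) (i : Fin m) : (u * v).val i.castSucc i.succ =
      u.val i.castSucc i.succ + v.val i.castSucc i.succ := by
  rw [mem_unipotent_iff] at hu hv
  rw [Units.val_mul, Matrix.mul_apply, Fintype.sum_eq_add i.succ i.castSucc]
  · rw [hv.2, hu.2, one_mul, mul_one]
  · simp [Fin.ext_iff]
  · intro j ⟨hj1, hj2⟩
    rcases lt_or_gt_of_ne hj2 with h | h
    · rw [hu.1 _ _ h, zero_mul]
    · rw [hv.1 _ _, mul_zero]
      rw [Fin.lt_def] at *
      simp only [ne_eq, Fin.ext_iff, Fin.val_succ, Fin.val_castSucc] at *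
      omega

lemma unipChar_mul (ψ : AddChar k R) {u v : GL (Fin n) k} (hu : u ∈ unipotent k n)
    (hv : v ∈ unipotent k n) : unipChar ψ (u * v) = unipChar ψ u * unipChar ψ v := by
  cases n with
  | zero => simp [unipChar]
  | succ m =>
    rw [unipChar_succ, unipChar_succ, unipChar_succ, ← AddChar.map_add_eq_mul,
      ← Finset.sum_add_distrib]
    congr 1
    exact Finset.sum_congr rfl fun i _ => unipotent_superdiag_mul hu hv i

@[simp] lemma unipChar_one (ψ : AddChar k R) : unipChar ψ (1 : GL (Fin n) k) = 1 := by
  rw [unipChar]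
  convert AddChar.map_zero_eq_one ψ
  apply Finset.sum_eq_zero
  intro i _
  split_ifs with h
  · rw [Units.val_one, Matrix.one_apply_ne]
    simp [Fin.ext_iff]
  · rfl

lemma addChar_ne_zero (ψ : AddChar k R) (x : k) : ψ x ≠ 0 := fun h => by
  have := AddChar.map_add_eq_mul ψ x (-x)
  simp [h] at this

lemma unipChar_ne_zero (ψ : AddChar k R) (u : GL (Fin n) k) : unipChar ψ u ≠ 0 := by
  exact addChar_ne_zero ψ _

lemma unipChar_inv_elt (ψ : AddChar k R) {u : GL (Fin n) k} (hu : u ∈ unipotent k n) :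
    unipChar ψ u⁻¹ = (unipChar ψ u)⁻¹ := by
  apply eq_inv_of_mul_eq_one_left
  rw [← unipChar_mul ψ (inv_mem hu) hu, inv_mul_cancel, unipChar_one]

lemma unipChar_inv_char (ψ : AddChar k R) (u : GL (Fin n) k) :
    unipChar ψ⁻¹ u = (unipChar ψ u)⁻¹ := by
  rw [unipChar, unipChar, AddChar.inv_apply, AddChar.map_neg_eq_inv]

lemma unipChar_diagOne (ψ : AddChar k R) (u : GL (Fin m) k) :
    unipChar ψ (diagOne u) = unipChar ψ u := by
  cases m with
  | zero => simp [unipChar]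
  | succ m =>
    rw [unipChar_succ, unipChar_succ, Fin.sum_univ_castSucc]
    congr 1
    rw [Fin.succ_last, diagOne_castSucc_last, add_zero]
    refine Finset.sum_congr rfl fun i _ => ?_
    rw [Fin.succ_castSucc, diagOne_castSucc_castSucc]

lemma unipChar_colGL (ψ : AddChar k R) (y : Fin (m + 1) → k) :
    unipChar ψ (colGL y) = ψ (y (Fin.last m)) := by
  rw [unipChar_succ, Fin.sum_univ_castSucc]
  congr 1
  rw [Fin.succ_last, colGL_castSucc_last]
  convert zero_add _
  apply Finset.sum_eq_zero
  intro i _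
  rw [Fin.succ_castSucc, colGL_castSucc_castSucc, Matrix.one_apply_ne]
  simp [Fin.ext_iff]

/-- The element of `GL n` given by a unipotent upper triangular matrix. -/
def mkUnipotent (A : Matrix (Fin n) (Fin n) k) (h1 : ∀ i j, j < i → A i j = 0)
    (h2 : ∀ i, A i i = 1) : GL (Fin n) k :=
  Matrix.GeneralLinearGroup.mkOfDetNeZero A (by
    rw [Matrix.det_of_isUpperTriangular (M := A) (fun i j h => h1 i j h)]
    simp [h2])

@[simp] lemma mkUnipotent_val (A : Matrix (Fin n) (Fin n) k) (h1 : ∀ i j, j < i → A i j = 0)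
    (h2 : ∀ i, A i i = 1) : (mkUnipotent A h1 h2).val = A := rfl

lemma mkUnipotent_mem (A : Matrix (Fin n) (Fin n) k) (h1 : ∀ i j, j < i → A i j = 0)
    (h2 : ∀ i, A i i = 1) : mkUnipotent A h1 h2 ∈ unipotent k n := ⟨h1, h2⟩

end Unipotent

section Star

variable {m n : ℕ}

lemma starGL_val (g : GL (Fin n) k) : (starGL g).val = (g⁻¹.val)ᵀ := rfl

lemma starGL_mul (g h : GL (Fin n) k) : starGL (g * h) = starGL g * starGL h := by
  apply Units.ext
  rw [Units.val_mul, starGL_val, starGL_val, starGL_val, _root_.mul_inv_rev, Units.val_mul,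
    Matrix.transpose_mul]

@[simp] lemma starGL_one : starGL (1 : GL (Fin n) k) = 1 := by
  apply Units.ext
  simp [starGL_val]

lemma starGL_inv (g : GL (Fin n) k) : starGL g⁻¹ = (starGL g)⁻¹ := by
  rw [eq_inv_iff_mul_eq_one, ← starGL_mul, inv_mul_cancel, starGL_one]

lemma starGL_inv_val (g : GL (Fin n) k) : (starGL g)⁻¹.val = g.valᵀ := rfl

@[simp] lemma starGL_starGL (g : GL (Fin n) k) : starGL (starGL g) = g := by
  apply Units.ext
  rw [starGL_val, starGL_inv_val, Matrix.transpose_transpose]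

lemma antidiagGL_apply (i j : Fin n) :
    (antidiagGL k n).val i j = if j = i.rev then 1 else 0 := rfl

@[simp] lemma antidiagGL_mul_self : antidiagGL k n * antidiagGL k n = 1 := by
  have : (antidiagGL k n)⁻¹ = antidiagGL k n := Units.ext rfl
  rw [mul_eq_one_iff_eq_inv, this]

@[simp] lemma antidiagGL_inv : (antidiagGL k n)⁻¹ = antidiagGL k n := Units.ext rfl

@[simp] lemma starGL_antidiagGL : starGL (antidiagGL k n) = antidiagGL k n := by
  apply Units.ext
  rw [starGL_val, antidiagGL_inv]
  ext i j
  simp [antidiagGL_apply, Fin.ext_iff, Fin.val_rev]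
  congr 1
  apply propext
  omega

lemma antidiagGL_mul_apply (g : GL (Fin n) k) (i j : Fin n) :
    (antidiagGL k n * g).val i j = g.val i.rev j := by
  rw [Units.val_mul, Matrix.mul_apply]
  simp [antidiagGL_apply]

lemma mul_antidiagGL_apply (g : GL (Fin n) k) (i j : Fin n) :
    (g * antidiagGL k n).val i j = g.val i j.rev := by
  rw [Units.val_mul, Matrix.mul_apply, Finset.sum_eq_single j.rev]
  · simp [antidiagGL_apply]
  · intro x _ hx
    rw [antidiagGL_apply, if_neg, mul_zero]
    rintro rfl
    simp at hx
  · simp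

lemma starGL_diagOne (g : GL (Fin m) k) : starGL (diagOne g) = diagOne (starGL g) := by
  apply Units.ext
  rw [starGL_val, ← diagOne_inv]
  ext i j
  rw [Matrix.transpose_apply]
  induction i using Fin.lastCases with
  | last => induction j using Fin.lastCases with
    | last => simp
    | cast j => simp
  | cast i => induction j using Fin.lastCases with
    | last => simp
    | cast j => simp [starGL_val]

/-- The transposition of matrices along the antidiagonal. -/
def antiTranspose (g : GL (Fin n) k) : GL (Fin n) k :=
  antidiagGL k n * (starGL g)⁻¹ * antidiagGL k n

lemma antiTranspose_apply (g : GL (Fin n) k) (i j : Fin n) :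
    (antiTranspose g).val i j = g.val j.rev i.rev := by
  rw [antiTranspose, mul_antidiagGL_apply, antidiagGL_mul_apply, starGL_inv_val,
    Matrix.transpose_apply]

lemma antiTranspose_mul (g h : GL (Fin n) k) :
    antiTranspose (g * h) = antiTranspose h * antiTranspose g := by
  rw [antiTranspose, antiTranspose, antiTranspose, starGL_mul, _root_.mul_inv_rev]
  have := antidiagGL_mul_self (k := k) (n := n)
  calc _ = antidiagGL k n * (starGL h)⁻¹ * 1 * (starGL g)⁻¹ * antidiagGL k n := by
        simp [mul_assoc]
    _ = _ := by
      rw [← this]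
      simp only [mul_assoc]

@[simp] lemma antiTranspose_antiTranspose (g : GL (Fin n) k) :
    antiTranspose (antiTranspose g) = g := by
  apply Units.ext
  ext i j
  simp [antiTranspose_apply]

lemma antiTranspose_mem {u : GL (Fin n) k} (hu : u ∈ unipotent k n) :
    antiTranspose u ∈ unipotent k n := by
  rw [mem_unipotent_iff] at *
  refine ⟨fun i j hij => ?_, fun i => ?_⟩
  · rw [antiTranspose_apply]
    exact hu.1 _ _ (by simpa using hij)
  · rw [antiTranspose_apply, hu.2]

/-- Reflection in the antidiagonal only reverses the order of the superdiagonal entries. An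
anti-involution preserving both N and ψ is what Gelfand's trick requires. -/
lemma unipChar_antiTranspose (ψ : AddChar k R) (u : GL (Fin n) k) :
    unipChar ψ (antiTranspose u) = unipChar ψ u := by
  cases n with
  | zero => simp [unipChar]
  | succ m =>
    rw [unipChar_succ, unipChar_succ]
    congr 1
    refine Fintype.sum_equiv Fin.revPerm _ _ fun i => ?_
    rw [antiTranspose_apply]
    simp [Fin.rev_succ, Fin.rev_castSucc]

lemma antidiag_conj_starGL (u : GL (Fin n) k) :
    antidiagGL k n * starGL u * antidiagGL k n = (antiTranspose u)⁻¹ := by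
  rw [antiTranspose]
  simp [mul_assoc]

lemma antidiag_conj_starGL_mem {u : GL (Fin n) k} (hu : u ∈ unipotent k n) :
    antidiagGL k n * starGL u * antidiagGL k n ∈ unipotent k n := by
  rw [antidiag_conj_starGL]
  exact inv_mem (antiTranspose_mem hu)

/-- The matrix w u^* w is the inverse of the antitranspose of u. This is the reason why W ↦ W~
exchanges ψ and ψ⁻¹. -/
lemma unipChar_antidiag_conj_starGL (ψ : AddChar k R) {u : GL (Fin n) k}
    (hu : u ∈ unipotent k n) :
    unipChar ψ (antidiagGL k n * starGL u * antidiagGL k n) = unipChar ψ⁻¹ u := by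
  rw [antidiag_conj_starGL, unipChar_inv_elt ψ (antiTranspose_mem hu), unipChar_antiTranspose,
    unipChar_inv_char]

end Star

end Groups

/-! ### Invertibility in R of the orders of unipotent groups -/

section Cardinality

variable {k : Type uk} [Field k] [Finite k] {R : Type uR} [Field R]

instance fintypeOfFinite : Fintype k := Fintype.ofFinite k

instance fintypeGL (n : ℕ) : Fintype (GL (Fin n) k) := Fintype.ofFinite _

instance fintypeSubgroupGL (n : ℕ) (S : Subgroup (GL (Fin n) k)) : Fintype S := Fintype.ofFinite _

lemma ringChar_prime (k : Type uk) [Field k] [Finite k] : (ringChar k).Prime :=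
  (CharP.char_is_prime_or_zero k (ringChar k)).resolve_right fun h =>
    CharP.char_ne_zero_of_finite k (ringChar k) h

lemma natCast_ringChar_ne_zero (hchar : ringChar R ≠ ringChar k) :
    ((ringChar k : ℕ) : R) ≠ 0 := by
  intro h
  have h1 := (ringChar.spec R _).1 h
  rcases (Nat.dvd_prime (ringChar_prime k)).1 h1 with h2 | h2
  · exact CharP.ringChar_ne_one h2
  · exact hchar h2

lemma card_field_ne_zero (hchar : ringChar R ≠ ringChar k) : (Fintype.card k : R) ≠ 0 := by
  obtain ⟨n, _, hn⟩ := FiniteField.card k (ringChar k)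
  rw [hn, Nat.cast_pow]
  exact pow_ne_zero _ (natCast_ringChar_ne_zero hchar)

/-- By Cayley–Hamilton (u - 1)^n = 0, and p^n ≥ n, so u^(p^n) - 1 = (u - 1)^(p^n) = 0 in
characteristic p. -/
lemma isPGroup_unipotent (n : ℕ) : IsPGroup (ringChar k) (unipotent k n) := by
  have : Fact (ringChar k).Prime := ⟨ringChar_prime k⟩
  rintro ⟨u, hu⟩
  refine ⟨n, ?_⟩
  apply Subtype.ext
  apply Units.ext
  have hT : (u.val - 1) ^ n = 0 := by
    have h1 : u.val.charpoly = (Polynomial.X - 1) ^ n := by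
      rw [Matrix.charpoly_of_isUpperTriangular _ hu.1]
      simp [hu.2]
    have h2 := Matrix.aeval_self_charpoly u.val
    rw [h1] at h2
    simpa using h2
  have hn : n ≤ ringChar k ^ n := (Nat.lt_pow_self (ringChar_prime k).one_lt).le
  cases n with
  | zero => exact Subsingleton.elim _ _
  | succ n =>
    have : CharP (Matrix (Fin (n + 1)) (Fin (n + 1)) k) (ringChar k) := inferInstance
    have h3 : (u.val - 1) ^ (ringChar k ^ (n + 1)) = 0 := pow_eq_zero_of_le hn hT
    rw [sub_pow_char_pow_of_commute (ringChar k) _ (Commute.one_right u.val), one_pow, sub_eq_zero] at h3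
    simpa using h3

lemma card_ne_zero_of_isPGroup {G : Type*} [Group G] [Finite G]
    (hchar : ringChar R ≠ ringChar k) (hG : IsPGroup (ringChar k) G) : (Nat.card G : R) ≠ 0 := by
  have : Fact (ringChar k).Prime := ⟨ringChar_prime k⟩
  obtain ⟨n, hn⟩ := IsPGroup.iff_card.1 hG
  rw [hn, Nat.cast_pow]
  exact pow_ne_zero _ (natCast_ringChar_ne_zero hchar)

lemma card_unipotent_ne_zero (hchar : ringChar R ≠ ringChar k) (n : ℕ) :
    (Nat.card (unipotent k n) : R) ≠ 0 :=
  card_ne_zero_of_isPGroup hchar (isPGroup_unipotent n)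

lemma card_unipotent_subgroupOf_ne_zero (hchar : ringChar R ≠ ringChar k) {n : ℕ}
    (H : Subgroup (GL (Fin n) k)) : (Nat.card ((unipotent k n).subgroupOf H) : R) ≠ 0 :=
  card_ne_zero_of_isPGroup hchar
    ((isPGroup_unipotent n).comap_of_injective H.subtype H.subtype_injective)

end Cardinality

/-! ### Monomial representatives of the double cosets of N -/

section Bruhat

variable {k : Type uk} [Field k] {n : ℕ}

/-- The last `r` rows of `g` are those of a monomial matrix. -/
def HasMonomialRows (g : GL (Fin n) k) (r : ℕ) : Prop :=
  ∀ i : Fin n, n ≤ i.val + r → ∃ c, g.val i c ≠ 0 ∧ (∀ c', c' ≠ c → g.val i c' = 0) ∧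
    ∀ i', i' ≠ i → g.val i' c = 0

lemma exists_first_ne_zero (g : GL (Fin n) k) (i : Fin n) :
    ∃ j, g.val i j ≠ 0 ∧ ∀ c, c < j → g.val i c = 0 := by
  have h : ∃ j, g.val i j ≠ 0 := by
    by_contra! h
    have h1 : g.val * g⁻¹.val = 1 := g.mul_inv
    have h2 := congrFun (congrFun h1 i) i
    rw [Matrix.mul_apply] at h2
    simp [h] at h2
  obtain ⟨j, hj, hmin⟩ := WellFounded.has_min (wellFounded_lt (α := Fin n))
    {j | g.val i j ≠ 0} h
  exact ⟨j, hj, fun c hc => by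
    by_contra h
    exact hmin c h hc⟩

/-- Gaussian elimination with unipotent matrices, one row at a time from the bottom. The pivot is
the first non-zero entry of the next row: column operations to the right clear its row, row
operations upwards clear its column. -/
lemma HasMonomialRows.step {g : GL (Fin n) k} {r : ℕ} (hr : r < n) (h : HasMonomialRows g r) :
    ∃ u ∈ unipotent k n, ∃ u' ∈ unipotent k n, HasMonomialRows (u * g * u') (r + 1) := by
  let i₀ : Fin n := ⟨n - r - 1, by omega⟩
  obtain ⟨j, hj, hmin⟩ := exists_first_ne_zero g i₀
  let b : Fin n → k := fun c => if j < c then -(g.val i₀ c / g.val i₀ j) else 0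
  let d : Fin n → k := fun i => if i < i₀ then -(g.val i j / g.val i₀ j) else 0
  let B : GL (Fin n) k := mkUnipotent (1 + Matrix.of fun a c => if a = j then b c else 0)
    (fun a c hac => by
      rw [Matrix.add_apply, Matrix.one_apply_ne hac.ne', Matrix.of_apply]
      simp only [b]
      split_ifs with h1 h2
      · subst h1
        exact absurd h2 hac.asymm
      all_goals simp)
    (fun a => by
      rw [Matrix.add_apply, Matrix.one_apply_eq, Matrix.of_apply]
      simp only [b]
      split_ifs with h1 h2
      · subst h1
        exact absurd h2 (lt_irrefl _)
      all_goals simp)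
  let C : GL (Fin n) k := mkUnipotent (1 + Matrix.of fun i a => if a = i₀ then d i else 0)
    (fun a c hac => by
      rw [Matrix.add_apply, Matrix.one_apply_ne hac.ne', Matrix.of_apply]
      simp only [d]
      split_ifs with h1 h2
      · subst h1
        exact absurd h2 hac.asymm
      all_goals simp)
    (fun a => by
      rw [Matrix.add_apply, Matrix.one_apply_eq, Matrix.of_apply]
      simp only [d]
      split_ifs with h1 h2
      · subst h1
        exact absurd h2 (lt_irrefl _)
      all_goals simp)
  refine ⟨C, mkUnipotent_mem _ _ _, B, mkUnipotent_mem _ _ _, ?_⟩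
  have hgB : ∀ i c, (g * B).val i c = g.val i c + g.val i j * b c := by
    intro i c
    simp only [B, Units.val_mul, mkUnipotent_val, Matrix.mul_add, Matrix.mul_one, Matrix.add_apply]
    congr 1
    rw [Matrix.mul_apply]
    simp
  have hrow : ∀ c, g.val i₀ c + g.val i₀ j * b c = if c = j then g.val i₀ j else 0 := by
    intro c
    rcases lt_trichotomy c j with hc | hc | hc
    · simp [b, hmin c hc, hc.asymm, hc.ne]
    · simp [b, hc]
    · simp only [b, hc, if_true, hc.ne', if_false]
      field_simp
      ring
  have hent : ∀ i c, (C * g * B).val i c = g.val i c + g.val i j * b c +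
      d i * (if c = j then g.val i₀ j else 0) := by
    intro i c
    rw [mul_assoc, ← hrow, ← hgB, ← hgB]
    simp only [C, Units.val_mul C, Units.val_mul, mkUnipotent_val, Matrix.add_mul, Matrix.one_mul,
      Matrix.add_apply]
    congr 1
    rw [Matrix.mul_apply]
    simp
  have hdi₀ : d i₀ = 0 := by simp [d]
  have hbj : b j = 0 := by simp [b]
  -- Below the pivot there is nothing to clear: the pivot column of a treated row vanishes in row
  -- i₀, so it is not the column j.
  have hzero : ∀ i, i₀ < i → g.val i j = 0 := by
    intro i hi
    obtain ⟨c, h1, h2, h3⟩ := h i (by rw [Fin.lt_def] at hi; simp only [i₀] at hi; omega)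
    refine h2 j ?_
    rintro rfl
    exact hj (h3 i₀ hi.ne)
  intro i hi
  have hi' : i₀ ≤ i := by
    rw [Fin.le_def]
    simp only [i₀]
    omega
  rcases hi'.eq_or_lt with rfl | hlt
  · refine ⟨j, ?_, ?_, ?_⟩
    · rw [hent]
      simpa [hdi₀, hbj] using hj
    · intro c hc
      rw [hent, hrow, if_neg hc, hdi₀]
      simp
    · intro i hi
      rw [hent, hbj]
      rcases lt_or_gt_of_ne hi with h1 | h1
      · simp only [d, h1, if_true]
        field_simp
        ring
      · rw [hzero i h1]
        simp [d, h1.asymm]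
  · obtain ⟨c, h1, h2, h3⟩ := h i (by rw [Fin.lt_def] at hlt; simp only [i₀] at hlt; omega)
    have hcj : c ≠ j := by
      rintro rfl
      exact h1 (hzero i hlt)
    have hbc : b c = 0 := by
      simp only [b]
      split_ifs
      · rw [h3 i₀ hlt.ne]
        simp
      · rfl
    have hdi : d i = 0 := by simp [d, hlt.asymm]
    refine ⟨c, ?_, ?_, ?_⟩
    · rw [hent, hbc, if_neg hcj]
      simpa using h1
    · intro c' hc'
      rw [hent, h2 c' hc', hzero i hlt, hdi]
      simp
    · intro i' hi'
      rw [hent, h3 i' hi', hbc, if_neg hcj]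
      simp

/-- A weak form of the Bruhat decomposition: every double coset of `N` contains a monomial
matrix. -/
lemma exists_hasMonomialRows (g : GL (Fin n) k) :
    ∃ u ∈ unipotent k n, ∃ u' ∈ unipotent k n, HasMonomialRows (u * g * u') n := by
  have key : ∀ r ≤ n, ∃ u ∈ unipotent k n, ∃ u' ∈ unipotent k n,
      HasMonomialRows (u * g * u') r := by
    intro r
    induction r with
    | zero =>
      intro _
      exact ⟨1, one_mem _, 1, one_mem _, fun i hi => absurd i.2 (by omega)⟩
    | succ r ih =>
      intro hr
      obtain ⟨u, hu, u', hu', h⟩ := ih (by omega)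
      obtain ⟨v, hv, v', hv', h'⟩ := h.step (by omega)
      refine ⟨v * u, mul_mem hv hu, u' * v', mul_mem hu' hv', ?_⟩
      simpa only [mul_assoc] using h'
  exact key n le_rfl

lemma HasMonomialRows.exists_perm {g : GL (Fin n) k} (h : HasMonomialRows g n) :
    ∃ σ : Equiv.Perm (Fin n), (∀ c, g.val (σ c) c ≠ 0) ∧ ∀ i c, i ≠ σ c → g.val i c = 0 := by
  choose ρ h1 h2 h3 using fun i : Fin n => h i (by omega)
  have hinj : Function.Injective ρ := by
    intro i i' hii
    by_contra hne
    exact h1 i (hii ▸ h3 i' i hne)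
  let e := Equiv.ofBijective ρ (Finite.injective_iff_bijective.1 hinj)
  have he : ∀ c, ρ (e.symm c) = c := fun c => e.apply_symm_apply c
  refine ⟨e.symm, fun c => ?_, fun i c hic => ?_⟩
  · conv => lhs; rw [← he c]
    rw [he c]
    have := h1 (e.symm c)
    rwa [he] at this
  · have := h3 (e.symm c) i hic
    rwa [he] at this

end Bruhat

/-! ### Biequivariant functions are fixed by the antitransposition -/

section Symmetry

variable {k : Type uk} [Field k] {R : Type uR} [Field R] {n : ℕ}

/-- `f` transforms on both sides under `N` according to `ψ`. -/
def IsBiequivariant (ψ : AddChar k R) (f : GL (Fin n) k → R) : Prop :=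
  ∀ u ∈ unipotent k n, ∀ u' ∈ unipotent k n, ∀ g,
    f (u * g * u') = unipChar ψ u * unipChar ψ u' * f g

lemma IsBiequivariant.comp_antiTranspose {ψ : AddChar k R} {f : GL (Fin n) k → R}
    (hf : IsBiequivariant ψ f) : IsBiequivariant ψ fun g => f (antiTranspose g) := by
  intro u hu u' hu' g
  simp only [antiTranspose_mul]
  rw [← mul_assoc, hf _ (antiTranspose_mem hu') _ (antiTranspose_mem hu), unipChar_antiTranspose,
    unipChar_antiTranspose, mul_comm (unipChar ψ u)]

/-- The elementary matrix with entry `x` at `(i, j)`, for `i < j`. -/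
def elemGL {i j : Fin n} (hij : i < j) (x : k) : GL (Fin n) k :=
  mkUnipotent (1 + Matrix.single i j x)
    (fun a c hac => by
      rw [Matrix.add_apply, Matrix.one_apply_ne hac.ne', zero_add, Matrix.single_apply_of_ne]
      rintro ⟨rfl, rfl⟩
      exact hac.asymm hij)
    (fun a => by
      rw [Matrix.add_apply, Matrix.one_apply_eq, Matrix.single_apply_of_ne, add_zero]
      rintro ⟨rfl, h⟩
      exact hij.ne' h)

lemma elemGL_val {i j : Fin n} (hij : i < j) (x : k) :
    (elemGL hij x).val = 1 + Matrix.single i j x := rfl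

lemma elemGL_mem {i j : Fin n} (hij : i < j) (x : k) : elemGL hij x ∈ unipotent k n :=
  mkUnipotent_mem _ _ _

lemma unipChar_elemGL (ψ : AddChar k R) {i j : Fin n} (hij : i < j) (x : k) :
    unipChar ψ (elemGL hij x) = if i.val + 1 = j.val then ψ x else 1 := by
  have h1 : ∀ a b : Fin n, a.val + 1 = b.val →
      (elemGL hij x).val a b = if a = i ∧ b = j then x else 0 := by
    intro a b hab
    rw [elemGL_val, Matrix.add_apply, Matrix.one_apply_ne (by
      rintro rfl
      omega), zero_add, Matrix.single_apply]
    simp only [eq_comm]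
  rw [unipChar, Finset.sum_eq_single i]
  · split_ifs with h2 h3 h3
    · rw [h1 _ _ rfl, if_pos ⟨rfl, Fin.ext h3⟩]
    · rw [h1 _ _ rfl, if_neg, AddChar.map_zero_eq_one]
      rintro ⟨-, h4⟩
      exact h3 (by rw [← h4])
    · omega
    · simp
  · intro a _ ha
    split_ifs with h2
    · rw [h1 _ _ rfl, if_neg fun h => ha h.1]
    · rfl
  · simp

/-- A monomial matrix carries the simple root group at (c, c') on its right to the root group at (σ
c, σ c') on its left, which lies in N. As f does not vanish at g, the two values of ψ must agree for
every parameter x; non-triviality of ψ forces the second root to be simple and the two entries to be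
equal. -/
lemma IsBiequivariant.relevant {ψ : AddChar k R} (hψ : ψ ≠ 1) {f : GL (Fin n) k → R}
    (hf : IsBiequivariant ψ f) {g : GL (Fin n) k} (hg : f g ≠ 0) {σ : Equiv.Perm (Fin n)}
    (h1 : ∀ c, g.val (σ c) c ≠ 0) (h2 : ∀ i c, i ≠ σ c → g.val i c = 0) {c c' : Fin n}
    (hc : c.val + 1 = c'.val) (hσ : σ c < σ c') :
    (σ c).val + 1 = (σ c').val ∧ g.val (σ c) c = g.val (σ c') c' := by
  have hcc : c < c' := by
    rw [Fin.lt_def]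
    omega
  have key : ∀ x : k, ψ x = if (σ c).val + 1 = (σ c').val
      then ψ (x * (g.val (σ c) c / g.val (σ c') c')) else 1 := by
    intro x
    have h3 : g * elemGL hcc x = elemGL hσ (x * (g.val (σ c) c / g.val (σ c') c')) * g := by
      apply Units.ext
      rw [Units.val_mul, Units.val_mul, elemGL_val, elemGL_val, Matrix.mul_add, Matrix.add_mul,
        Matrix.mul_one, Matrix.one_mul]
      congr 1
      ext a b
      by_cases hb : b = c'
      · subst hb
        rw [Matrix.mul_single_apply_same]
        by_cases ha : a = σ c
        · subst ha
          rw [Matrix.single_mul_apply_same]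
          field_simp [h1 b]
        · rw [Matrix.single_mul_apply_of_ne _ _ _ _ _ ha, h2 _ _ ha, zero_mul]
      · rw [Matrix.mul_single_apply_of_ne _ _ _ _ _ hb]
        by_cases ha : a = σ c
        · subst ha
          rw [Matrix.single_mul_apply_same, h2 _ _ (fun h => hb (σ.injective h).symm), mul_zero]
        · rw [Matrix.single_mul_apply_of_ne _ _ _ _ _ ha]
    have h4 := hf 1 (one_mem _) _ (elemGL_mem hcc x) g
    have h5 := hf _ (elemGL_mem hσ (x * (g.val (σ c) c / g.val (σ c') c'))) 1 (one_mem _) g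
    rw [one_mul, h3] at h4
    rw [mul_one, h4] at h5
    have h6 := mul_right_cancel₀ hg h5
    rw [unipChar_one, one_mul, mul_one, unipChar_elemGL, unipChar_elemGL, if_pos hc] at h6
    exact h6
  by_cases had : (σ c).val + 1 = (σ c').val
  · refine ⟨had, ?_⟩
    by_contra hne
    apply hψ
    simp only [had, if_true] at key
    set q := g.val (σ c) c / g.val (σ c') c' with hq
    have hq1 : 1 - q ≠ 0 := by
      rw [sub_ne_zero, hq, ne_comm, ne_eq, div_eq_one_iff_eq (h1 c')]
      exact hne
    ext y
    have h3 := key (y / (1 - q))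
    have h4 : y = y / (1 - q) + -(y / (1 - q) * q) := by
      field_simp
      ring
    rw [h4, AddChar.map_add_eq_mul, h3, ← AddChar.map_add_eq_mul, add_neg_cancel,
      AddChar.map_zero_eq_one, AddChar.one_apply]
  · exfalso
    apply hψ
    ext y
    rw [key y, if_neg had, AddChar.one_apply]

/-- The condition forces g to be block antidiagonal with scalar blocks, and such a matrix is
symmetric about the antidiagonal. The blocks are split off from the left. -/
lemma antiTranspose_eq_self {g : GL (Fin n) k} {σ : Equiv.Perm (Fin n)}
    (h2 : ∀ i c, i ≠ σ c → g.val i c = 0)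
    (h3 : ∀ c c' : Fin n, c.val + 1 = c'.val → σ c < σ c' →
      (σ c).val + 1 = (σ c').val ∧ g.val (σ c) c = g.val (σ c') c') :
    antiTranspose g = g := by
  -- The first p columns have been treated: they occupy exactly the last p rows and already satisfy
  -- the symmetry. The induction is on the number q of remaining columns.
  have key : ∀ q, ∀ p, p + q = n → (∀ c : Fin n, c.val < p ↔ n ≤ (σ c).val + p) →
      (∀ c : Fin n, c.val < p → σ (σ c).rev = c.rev ∧
        g.val (σ (σ c).rev) (σ c).rev = g.val (σ c) c) →
      ∀ c : Fin n, σ (σ c).rev = c.rev ∧ g.val (σ (σ c).rev) (σ c).rev = g.val (σ c) c := by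
    intro q
    induction q using Nat.strong_induction_on with
    | _ q ih =>
      intro p hpq hp hsym
      rcases Nat.eq_zero_or_pos q with rfl | hq
      · exact fun c => hsym c (by omega)
      -- The column whose entry lies in the lowest unused row; it is the last column of the next
      -- block.
      let j : Fin n := σ.symm ⟨n - p - 1, by omega⟩
      have hj : (σ j).val = n - p - 1 := by simp [j]
      have hpj : p ≤ j.val := by
        by_contra h
        have := (hp j).1 (by omega)
        omega
      -- Going back from j to p, each column lies one row higher than the next and has the same
      -- entry. The first equation says that σ c is n - p - 1 - s, in a form convenient for natural
      -- subtraction.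
      have hblock : ∀ s, ∀ c : Fin n, p ≤ c.val → c.val + s = j.val →
          (σ c).val + s = n - p - 1 - s + s ∧ s ≤ n - p - 1 ∧ g.val (σ c) c = g.val (σ j) j := by
        intro s
        induction s using Nat.strong_induction_on with
        | _ s ihs =>
          intro c hc hs
          rcases Nat.eq_zero_or_pos s with rfl | hs0
          · have : c = j := Fin.ext (by omega)
            subst this
            exact ⟨by omega, by omega, rfl⟩
          let c' : Fin n := ⟨c.val + 1, by omega⟩
          have ih' := ihs (s - 1) (by omega) c' (by simp only [c']; omega)
            (by simp only [c']; omega)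
          have hlt : σ c < σ c' := by
            by_contra hge
            rw [not_lt, Fin.le_def] at hge
            have hne : (σ c).val ≠ (σ c').val := fun h => by
              have := congrArg Fin.val (σ.injective (Fin.ext h))
              simp [c'] at this
            have hup : (σ c).val + p < n := by
              by_contra h
              have := (hp c).2 (by omega)
              omega
            -- the rows strictly between are already used
            let e : Fin n := ⟨j.val - (n - p - 1 - (σ c).val), by omega⟩
            have ihe := ihs (n - p - 1 - (σ c).val) (by omega) e (by simp only [e]; omega)
              (by simp only [e]; omega)
            have : e = c := σ.injective (Fin.ext (by omega))
            have := congrArg Fin.val this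
            simp only [e] at this
            omega
          obtain ⟨h4, h5⟩ := h3 c c' rfl hlt
          exact ⟨by omega, by omega, h5.trans ih'.2.2⟩
      have hrow : ∀ c : Fin n, p ≤ c.val → c.val ≤ j.val →
          (σ c).val + p + 1 + j.val = n + c.val := by
        intro c hc hcj
        have := hblock (j.val - c.val) c hc (by omega)
        omega
      refine ih (n - (j.val + 1)) (by omega) (j.val + 1) (by omega) ?_ ?_
      · intro c
        constructor
        · intro hc
          by_cases hcp : c.val < p
          · have := (hp c).1 hcp
            omega
          · have := hrow c (by omega) (by omega)
            omega
        · intro hc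
          by_cases hcp : c.val < p
          · omega
          · by_contra hcj
            have h4 : ¬ n ≤ (σ c).val + p := fun h => hcp ((hp c).2 h)
            let e : Fin n := ⟨(σ c).val + p + 1 + j.val - n, by omega⟩
            have h5 := hrow e (by simp only [e]; omega) (by simp only [e]; omega)
            have : e = c := σ.injective (Fin.ext (by simp only [e] at h5 ⊢; omega))
            have := congrArg Fin.val this
            simp only [e] at this
            omega
      · intro c hc
        by_cases hcp : c.val < p
        · exact hsym c hcp
        · have h4 := hrow c (by omega) (by omega)
          have h5 : ((σ c).rev).val + c.val = p + j.val := by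
            rw [Fin.val_rev]
            omega
          have h6 := hrow (σ c).rev (by omega) (by omega)
          have h7 := hblock (j.val - c.val) c (by omega) (by omega)
          have h8 := hblock (j.val - ((σ c).rev).val) (σ c).rev (by omega) (by omega)
          refine ⟨Fin.ext ?_, h8.2.2.trans h7.2.2.symm⟩
          rw [Fin.val_rev]
          omega
  have hall := key n 0 (by omega) (fun c => by
    have := (σ c).2
    omega) (fun c hc => absurd hc (by omega))
  apply Units.ext
  ext i c
  rw [antiTranspose_apply]
  by_cases hi : i = σ c
  · subst hi
    obtain ⟨h4, h5⟩ := hall c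
    rw [← h4, h5]
  · rw [h2 _ _ hi, h2]
    intro h
    obtain ⟨h4, -⟩ := hall i.rev
    rw [← h, Fin.rev_rev, Fin.rev_rev] at h4
    exact hi h4.symm

/-- Functions on `GL n` which are `(N, ψ)`-equivariant on both sides are invariant under the
antitransposition. -/
theorem IsBiequivariant.apply_antiTranspose {ψ : AddChar k R} (hψ : ψ ≠ 1)
    {f : GL (Fin n) k → R} (hf : IsBiequivariant ψ f) (g : GL (Fin n) k) :
    f (antiTranspose g) = f g := by
  obtain ⟨u, hu, u', hu', h⟩ := exists_hasMonomialRows g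
  obtain ⟨σ, h1, h2⟩ := h.exists_perm
  suffices h3 : f (antiTranspose (u * g * u')) = f (u * g * u') by
    have h4 := hf.comp_antiTranspose u hu u' hu' g
    simp only at h4
    rw [h4, hf u hu u' hu' g] at h3
    exact mul_left_cancel₀ (mul_ne_zero (unipChar_ne_zero ψ u) (unipChar_ne_zero ψ u')) h3
  -- If one of the two values is non-zero, then f or its antitransposed function is non-zero at the
  -- monomial matrix, which is therefore fixed by the antitransposition.
  by_cases h0 : f (u * g * u') = 0 ∧ f (antiTranspose (u * g * u')) = 0
  · rw [h0.1, h0.2]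
  · rw [antiTranspose_eq_self h2 fun c c' hc hσ => ?_]
    rw [not_and_or] at h0
    rcases h0 with h0 | h0
    · exact hf.relevant hψ h0 h1 h2 hc hσ
    · exact hf.comp_antiTranspose.relevant hψ h0 h1 h2 hc hσ

end Symmetry

/-! ### Irreducible representations are generated by any non-zero vector -/

section Irreducible

variable {G : Type*} [Group G] {R : Type uR} [Field R] {V : Type v} [AddCommGroup V] [Module R V]

/-- The subrepresentation generated by a vector. -/
def orbitSpan (π : Representation R G V) (x : V) : Subrepresentation π where
  toSubmodule := Submodule.span R (Set.range fun g => π g x)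
  apply_mem_toSubmodule g y hy := by
    induction hy using Submodule.span_induction with
    | mem y hy =>
      obtain ⟨h, rfl⟩ := hy
      refine Submodule.subset_span ⟨g * h, ?_⟩
      simp
    | zero => simp
    | add y z _ _ hy hz => rw [map_add]; exact add_mem hy hz
    | smul c y _ hy => rw [map_smul]; exact Submodule.smul_mem _ c hy

lemma mem_orbitSpan (π : Representation R G V) (g : G) (x : V) :
    π g x ∈ (orbitSpan π x).toSubmodule := Submodule.subset_span ⟨g, rfl⟩

lemma self_mem_orbitSpan (π : Representation R G V) (x : V) :
    x ∈ (orbitSpan π x).toSubmodule := by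
  simpa using mem_orbitSpan π 1 x

lemma toSubmodule_eq_top_of_irreducible {π : Representation R G V} (hπ : π.IsIrreducible)
    (S : Subrepresentation π) {x : V} (hx : x ∈ S.toSubmodule) (hx0 : x ≠ 0) :
    S.toSubmodule = ⊤ := by
  rcases hπ.eq_bot_or_eq_top S with h | h
  · exfalso
    rw [h] at hx
    exact hx0 hx
  · rw [h]
    rfl

lemma orbitSpan_eq_top {π : Representation R G V} (hπ : π.IsIrreducible) {x : V} (hx : x ≠ 0) :
    (orbitSpan π x).toSubmodule = ⊤ :=
  toSubmodule_eq_top_of_irreducible hπ _ (self_mem_orbitSpan π x) hx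

lemma exists_ne_zero_of_irreducible {π : Representation R G V} (hπ : π.IsIrreducible) :
    ∃ x : V, x ≠ 0 := by
  by_contra! h
  have : (⊥ : Subrepresentation π) = ⊤ := by
    ext x
    simp only [h x]
    exact ⟨fun _ => zero_mem (⊤ : Submodule R V), fun _ => zero_mem (⊥ : Submodule R V)⟩
  exact bot_ne_top this

lemma finiteDimensional_of_irreducible [Finite G] {π : Representation R G V}
    (hπ : π.IsIrreducible) : FiniteDimensional R V := by
  obtain ⟨x, hx⟩ := exists_ne_zero_of_irreducible hπ
  have h := orbitSpan_eq_top hπ hx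
  refine ⟨⟨(Set.finite_range fun g => π g x).toFinset, ?_⟩⟩
  rw [Set.Finite.coe_toFinset]
  exact h

end Irreducible

/-! ### Hecke operators and uniqueness of Whittaker models -/

section Average

variable {k : Type uk} [Field k] [Finite k] {R : Type uR} [Field R] {n : ℕ}
  {V : Type v} [AddCommGroup V] [Module R V]

/-- The projector of a representation onto the `(N, ψ)`-eigenspace. -/
def whittakerAvg (ψ : AddChar k R) (π : Representation R (GL (Fin n) k) V) : V →ₗ[R] V :=
  (Nat.card (unipotent k n) : R)⁻¹ •
    ∑ u : unipotent k n, (unipChar ψ (u : GL (Fin n) k))⁻¹ • π u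

lemma whittakerAvg_apply (ψ : AddChar k R) (π : Representation R (GL (Fin n) k) V) (x : V) :
    whittakerAvg ψ π x = (Nat.card (unipotent k n) : R)⁻¹ •
      ∑ u : unipotent k n, (unipChar ψ (u : GL (Fin n) k))⁻¹ • π u x := by
  simp [whittakerAvg, LinearMap.sum_apply]

/-- The `(N, ψ)`-eigenspace of a representation. -/
def whittakerVectors (ψ : AddChar k R) (π : Representation R (GL (Fin n) k) V) :
    Submodule R V where
  carrier := {x | ∀ u ∈ unipotent k n, π u x = unipChar ψ u • x}
  zero_mem' := fun u _ => by simp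
  add_mem' {x y} hx hy := fun u hu => by rw [map_add, hx u hu, hy u hu, smul_add]
  smul_mem' c x hx := fun u hu => by rw [map_smul, hx u hu, smul_comm]

lemma whittakerAvg_map (ψ : AddChar k R) (π : Representation R (GL (Fin n) k) V)
    {u : GL (Fin n) k} (hu : u ∈ unipotent k n) (x : V) :
    whittakerAvg ψ π (π u x) = unipChar ψ u • whittakerAvg ψ π x := by
  rw [whittakerAvg_apply, whittakerAvg_apply, smul_comm, Finset.smul_sum (r := unipChar ψ u)]
  congr 1
  refine Fintype.sum_equiv (Equiv.mulRight (⟨u, hu⟩ : unipotent k n)) _ _ fun w => ?_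
  simp only [Equiv.coe_mulRight, Subgroup.coe_mul, unipChar_mul ψ w.2 hu, map_mul,
    Module.End.mul_apply, smul_smul]
  congr 1
  have := unipChar_ne_zero ψ u
  have := unipChar_ne_zero ψ (w : GL (Fin n) k)
  field_simp

lemma map_whittakerAvg (ψ : AddChar k R) (π : Representation R (GL (Fin n) k) V)
    {u : GL (Fin n) k} (hu : u ∈ unipotent k n) (x : V) :
    π u (whittakerAvg ψ π x) = unipChar ψ u • whittakerAvg ψ π x := by
  rw [whittakerAvg_apply, map_smul, smul_comm, Finset.smul_sum (r := unipChar ψ u), map_sum]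
  congr 1
  refine Fintype.sum_equiv (Equiv.mulLeft (⟨u, hu⟩ : unipotent k n)) _ _ fun w => ?_
  simp only [Equiv.coe_mulLeft, Subgroup.coe_mul, unipChar_mul ψ hu w.2, map_mul,
    Module.End.mul_apply, smul_smul, map_smul]
  congr 1
  have := unipChar_ne_zero ψ u
  have := unipChar_ne_zero ψ (w : GL (Fin n) k)
  field_simp

lemma whittakerAvg_mem (ψ : AddChar k R) (π : Representation R (GL (Fin n) k) V) (x : V) :
    whittakerAvg ψ π x ∈ whittakerVectors ψ π := fun _ hu => map_whittakerAvg ψ π hu x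

lemma whittakerAvg_of_mem (hchar : ringChar R ≠ ringChar k) {ψ : AddChar k R}
    {π : Representation R (GL (Fin n) k) V} {x : V} (hx : x ∈ whittakerVectors ψ π) :
    whittakerAvg ψ π x = x := by
  rw [whittakerAvg_apply, Finset.sum_congr rfl (g := fun _ => x) fun u _ => by
    rw [hx u u.2, smul_smul, inv_mul_cancel₀ (unipChar_ne_zero ψ _), one_smul]]
  rw [Finset.sum_const, Finset.card_univ, ← Nat.card_eq_fintype_card, ← Nat.cast_smul_eq_nsmul R,
    smul_smul, inv_mul_cancel₀ (card_unipotent_ne_zero hchar n), one_smul]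

lemma apply_whittakerAvg (hchar : ringChar R ≠ ringChar k) {ψ : AddChar k R}
    {π : Representation R (GL (Fin n) k) V} {ξ : Module.Dual R V}
    (hξ : ξ ∈ whittakerFunctionals ψ π) (x : V) : ξ (whittakerAvg ψ π x) = ξ x := by
  rw [whittakerAvg_apply, map_smul, map_sum, Finset.sum_congr rfl (g := fun _ => ξ x) fun u _ => by
    rw [map_smul, hξ u u.2, smul_eq_mul, inv_mul_cancel_left₀ (unipChar_ne_zero ψ _)]]
  rw [Finset.sum_const, Finset.card_univ, ← Nat.card_eq_fintype_card, ← Nat.cast_smul_eq_nsmul R,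
    smul_smul, inv_mul_cancel₀ (card_unipotent_ne_zero hchar n), one_smul]

lemma comp_whittakerAvg_mem (ψ : AddChar k R) (π : Representation R (GL (Fin n) k) V)
    (lam : Module.Dual R V) : lam ∘ₗ whittakerAvg ψ π ∈ whittakerFunctionals ψ π := by
  intro u hu x
  rw [LinearMap.comp_apply, whittakerAvg_map ψ π hu, map_smul, smul_eq_mul, LinearMap.comp_apply]

/-- The operators of the Hecke algebra of `(G, N, ψ)` on a representation. -/
def heckeOp (ψ : AddChar k R) (π : Representation R (GL (Fin n) k) V) (g : GL (Fin n) k) :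
    V →ₗ[R] V := whittakerAvg ψ π ∘ₗ π g ∘ₗ whittakerAvg ψ π

lemma heckeOp_apply (ψ : AddChar k R) (π : Representation R (GL (Fin n) k) V)
    (g : GL (Fin n) k) (x : V) :
    heckeOp ψ π g x = whittakerAvg ψ π (π g (whittakerAvg ψ π x)) := rfl

/-- All the matrix coefficients g ↦ lam(T_g x) are biequivariant under (N, ψ), so the symmetry of
such functions applies to each of them. -/
lemma heckeOp_antiTranspose {ψ : AddChar k R} (hψ : ψ ≠ 1)
    (π : Representation R (GL (Fin n) k) V) (g : GL (Fin n) k) (x : V) :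
    heckeOp ψ π (antiTranspose g) x = heckeOp ψ π g x := by
  rw [← sub_eq_zero]
  refine (Module.forall_dual_apply_eq_zero_iff R _).1 fun lam => ?_
  have hf : IsBiequivariant ψ fun g => lam (heckeOp ψ π g x) := by
    intro u hu u' hu' g
    simp only [heckeOp_apply, map_mul, Module.End.mul_apply]
    rw [whittakerAvg_map ψ π hu, map_whittakerAvg ψ π hu']
    simp only [map_smul, smul_eq_mul, mul_assoc]
  rw [map_sub, sub_eq_zero]
  exact hf.apply_antiTranspose hψ g

lemma heckeOp_heckeOp (hchar : ringChar R ≠ ringChar k) (ψ : AddChar k R)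
    (π : Representation R (GL (Fin n) k) V) (g h : GL (Fin n) k) (x : V) :
    heckeOp ψ π g (heckeOp ψ π h x) = (Nat.card (unipotent k n) : R)⁻¹ •
      ∑ u : unipotent k n, (unipChar ψ (u : GL (Fin n) k))⁻¹ • heckeOp ψ π (g * u * h) x := by
  rw [heckeOp_apply ψ π g, heckeOp_apply ψ π h, whittakerAvg_of_mem hchar (whittakerAvg_mem ψ π _),
    whittakerAvg_apply ψ π (π h _)]
  simp only [map_smul, map_sum, heckeOp_apply, map_mul, Module.End.mul_apply]

/-- Gelfand's trick: an anti-involution reverses products, but fixes each Hecke operator. -/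
lemma heckeOp_comm (hchar : ringChar R ≠ ringChar k) {ψ : AddChar k R} (hψ : ψ ≠ 1)
    (π : Representation R (GL (Fin n) k) V) (g h : GL (Fin n) k) (x : V) :
    heckeOp ψ π g (heckeOp ψ π h x) = heckeOp ψ π h (heckeOp ψ π g x) := by
  rw [← heckeOp_antiTranspose hψ π h, ← heckeOp_antiTranspose hψ π g x, heckeOp_heckeOp hchar,
    heckeOp_heckeOp hchar]
  congr 1
  let e : unipotent k n ≃ unipotent k n :=
    { toFun := fun u => ⟨antiTranspose (u : GL (Fin n) k), antiTranspose_mem u.2⟩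
      invFun := fun u => ⟨antiTranspose (u : GL (Fin n) k), antiTranspose_mem u.2⟩
      left_inv := fun u => by simp
      right_inv := fun u => by simp }
  refine Fintype.sum_equiv e _ _ fun u => ?_
  simp only [e, Equiv.coe_fn_mk, unipChar_antiTranspose]
  rw [← heckeOp_antiTranspose hψ π (g * u * antiTranspose h)]
  simp only [antiTranspose_mul, antiTranspose_antiTranspose, mul_assoc]

/-- Uniqueness of Whittaker models: the `(N, ψ)`-eigenspace of an irreducible representation has
dimension at most one. -/
theorem exists_smul_eq_of_mem_whittakerVectors [IsAlgClosed R] (hchar : ringChar R ≠ ringChar k)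
    {ψ : AddChar k R} (hψ : ψ ≠ 1) {π : Representation R (GL (Fin n) k) V}
    (hπ : π.IsIrreducible) {x y : V} (hx : x ∈ whittakerVectors ψ π) (hx0 : x ≠ 0)
    (hy : y ∈ whittakerVectors ψ π) : ∃ c : R, y = c • x := by
  have : FiniteDimensional R V := finiteDimensional_of_irreducible hπ
  -- The translates of z span V and averaging projects V onto the eigenspace, so the eigenspace is
  -- spanned by the vectors T_g z.
  have hgen : ∀ (S : Submodule R V) (z : V), z ∈ whittakerVectors ψ π → z ≠ 0 →
      (∀ g, heckeOp ψ π g z ∈ S) → ∀ y ∈ whittakerVectors ψ π, y ∈ S := by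
    intro S z hz hz0 hS y hy
    have h1 : y ∈ (orbitSpan π z).toSubmodule := by
      rw [orbitSpan_eq_top hπ hz0]
      trivial
    rw [← whittakerAvg_of_mem hchar hy]
    have h2 : Submodule.span R (Set.range fun g => π g z) ≤ S.comap (whittakerAvg ψ π) := by
      refine Submodule.span_le.2 ?_
      rintro _ ⟨g, rfl⟩
      have := hS g
      rwa [heckeOp_apply, whittakerAvg_of_mem hchar hz] at this
    exact h2 h1
  -- Let z be an eigenvector of T_g. By commutativity the corresponding kernel contains every T_h z,
  -- hence the whole eigenspace.
  have hscalar : ∀ g, ∃ c : R, ∀ y ∈ whittakerVectors ψ π, heckeOp ψ π g y = c • y := by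
    intro g
    let T : whittakerVectors ψ π →ₗ[R] whittakerVectors ψ π :=
      (heckeOp ψ π g).restrict fun y _ => whittakerAvg_mem ψ π _
    have : Nontrivial (whittakerVectors ψ π) :=
      ⟨⟨⟨x, hx⟩, 0, fun h => hx0 (congrArg Subtype.val h)⟩⟩
    obtain ⟨c, hc⟩ := Module.End.exists_eigenvalue T
    obtain ⟨z, hz⟩ := hc.exists_hasEigenvector
    have hz1 : heckeOp ψ π g z = c • (z : V) := congrArg Subtype.val hz.apply_eq_smul
    refine ⟨c, fun y hy => ?_⟩
    have h1 := hgen (LinearMap.ker (heckeOp ψ π g - c • LinearMap.id)) z z.2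
      (fun h => hz.2 (Subtype.ext h)) (fun h => by
        rw [LinearMap.mem_ker, LinearMap.sub_apply, heckeOp_comm hchar hψ, hz1]
        simp) y hy
    rw [LinearMap.mem_ker, LinearMap.sub_apply, sub_eq_zero] at h1
    exact h1
  have h1 := hgen (Submodule.span R {x}) x hx hx0 (fun g => by
    obtain ⟨c, hc⟩ := hscalar g
    rw [hc x hx]
    exact Submodule.smul_mem _ c (Submodule.mem_span_singleton_self x)) y hy
  obtain ⟨c, hc⟩ := Submodule.mem_span_singleton.1 h1
  exact ⟨c, hc.symm⟩

/-- A Whittaker functional vanishing on a generator of a one-dimensional space of Whittaker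
vectors vanishes. -/
lemma functional_eq_of_whittakerVectors (hchar : ringChar R ≠ ringChar k) {ψ : AddChar k R}
    {π : Representation R (GL (Fin n) k) V} {x : V}
    (hspan : ∀ y ∈ whittakerVectors ψ π, ∃ c : R, y = c • x) {ξ ξ' : Module.Dual R V}
    (hξ : ξ ∈ whittakerFunctionals ψ π) (hξ' : ξ' ∈ whittakerFunctionals ψ π)
    (h : ξ x = ξ' x) : ξ = ξ' := by
  ext y
  obtain ⟨c, hc⟩ := hspan _ (whittakerAvg_mem ψ π y)
  rw [← apply_whittakerAvg hchar hξ, ← apply_whittakerAvg hchar hξ', hc, map_smul, map_smul, h]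

end Average

/-! ### Cuspidality and forms invariant under unipotent radicals -/

section RegularRepresentation

variable {G : Type*} [Group G] {ι : Type*} (e : G ≃ ι) (R : Type uR) [Field R]

/-- The regular representation of `G` on the functions on a type in bijection with `G`. -/
def regularRep : Representation R G (ι → R) where
  toFun g := LinearMap.funLeft R R fun i => e (e.symm i * g)
  map_one' := by
    ext f i
    simp [LinearMap.funLeft_apply]
  map_mul' g h := by
    ext f i
    simp [LinearMap.funLeft_apply, mul_assoc]

lemma regularRep_single [DecidableEq ι] (g h : G) :
    regularRep e R g (Pi.single (e h) 1) = Pi.single (e (h * g⁻¹)) 1 := by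
  ext i
  obtain ⟨x, rfl⟩ := e.surjective i
  simp only [regularRep, MonoidHom.coe_mk, OneHom.coe_mk, LinearMap.funLeft_apply,
    Equiv.symm_apply_apply, Pi.single_apply]
  congr 1
  rw [e.injective.eq_iff, e.injective.eq_iff, eq_mul_inv_iff_mul_eq]

end RegularRepresentation

section Cuspidal

variable {k : Type uk} [Field k] {R : Type uR} [Field R] {n : ℕ}
  {V : Type v} [AddCommGroup V] [Module R V]

/-- There is no non-zero linear form on `π` invariant under the unipotent radical of a proper
standard parabolic subgroup. -/
def HasNoUnipotentForms (π : Representation R (GL (Fin n) k) V) : Prop :=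
  ∀ (a b : ℕ) (h : a + b = n), 0 < a → 0 < b → ∀ lam : Module.Dual R V,
    (∀ B x, lam (π (blockUpper h 1 B 1) x) = lam x) → lam = 0

lemma blockUpper_mul_blockUpper_eq {a b : ℕ} (h : a + b = n) (A A' : GL (Fin a) k)
    (B : Matrix (Fin a) (Fin b) k) (D D' : GL (Fin b) k) :
    blockUpper h A' 0 D' * blockUpper h A B D =
      blockUpper h 1 (A'.val * B * (D' * D)⁻¹.val) 1 * blockUpper h (A' * A) 0 (D' * D) := by
  rw [blockUpper_mul, blockUpper_mul, one_mul, one_mul]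
  congr 1
  have : (D' * D)⁻¹.val * (D' * D).val = 1 := (D' * D).inv_mul
  rw [Matrix.mul_assoc _ _ (D' * D).val, this]
  simp

/-- Frobenius reciprocity: a form invariant under the unipotent radical gives an intertwining map
into the representation induced from the regular representation of the Levi subgroup. It is not
injective by cuspidality, so it vanishes by irreducibility; its coefficient at the identity is the
given form. -/
theorem IsCuspidal.hasNoUnipotentForms [Finite k] {π : Representation R (GL (Fin n) k) V}
    (hπ : IsCuspidal π) : HasNoUnipotentForms π := by
  intro a b h ha hb lam hlam
  -- Functions on `Fin` rather than on the group keep the regular representation in the universe of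
  -- R, where `IsCuspidal` quantifies.
  let ea : GL (Fin a) k ≃ Fin (Fintype.card (GL (Fin a) k)) := Fintype.equivFin _
  let eb : GL (Fin b) k ≃ Fin (Fintype.card (GL (Fin b) k)) := Fintype.equivFin _
  let σ₁ := regularRep ea R
  let σ₂ := regularRep eb R
  let F : V →ₗ[R] (GL (Fin n) k →
      (Fin (Fintype.card (GL (Fin a) k)) → R) ⊗[R] (Fin (Fintype.card (GL (Fin b) k)) → R)) :=
    LinearMap.pi fun g => ∑ A : GL (Fin a) k, ∑ D : GL (Fin b) k,
      LinearMap.smulRight (lam ∘ₗ π (blockUpper h A 0 D * g))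
        ((Pi.single (ea A) (1 : R) : _ → R) ⊗ₜ[R] (Pi.single (eb D) (1 : R) : _ → R))
  have hF : ∀ x g, F x g = ∑ A : GL (Fin a) k, ∑ D : GL (Fin b) k,
      lam (π (blockUpper h A 0 D * g) x) •
        ((Pi.single (ea A) (1 : R) : _ → R) ⊗ₜ[R] (Pi.single (eb D) (1 : R) : _ → R)) := by
    intro x g
    simp [F]
  have hmem : ∀ x, F x ∈ parabolicSpace h σ₁ σ₂ := by
    intro x A B D g
    rw [hF, hF, map_sum]
    refine Fintype.sum_equiv (Equiv.mulRight A) _ _ fun A' => ?_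
    rw [map_sum]
    refine Fintype.sum_equiv (Equiv.mulRight D) _ _ fun D' => ?_
    rw [map_smul, TensorProduct.map_tmul, regularRep_single, regularRep_single, ← mul_assoc,
      blockUpper_mul_blockUpper_eq, mul_assoc, map_mul, Module.End.mul_apply, hlam]
    simp
  let f : π.IntertwiningMap (parabolicInduction h σ₁ σ₂) :=
    LinearMap.intertwiningMap_of_isIntertwiningMap π (parabolicInduction h σ₁ σ₂)
      (F.codRestrict _ hmem) (by
        intro g x
        apply Subtype.ext
        funext g'
        change F (π g x) g' = F x (g' * g)
        simp only [hF, ← Module.End.mul_apply, ← map_mul, mul_assoc])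
  have hf := hπ.2 a b h ha hb _ _ σ₁ σ₂ f
  have hker : ∃ x, x ≠ 0 ∧ F x = 0 := by
    by_contra! hx
    refine hf fun x y hxy => ?_
    by_contra hne
    refine hx (x - y) (sub_ne_zero.2 hne) ?_
    rw [map_sub, sub_eq_zero]
    exact congrArg Subtype.val hxy
  obtain ⟨x₀, hx₀, hFx₀⟩ := hker
  let S : Subrepresentation π :=
    { toSubmodule := LinearMap.ker F
      apply_mem_toSubmodule := fun g x hx => by
        rw [LinearMap.mem_ker] at hx ⊢
        funext g'
        have : F (π g x) g' = F x (g' * g) := by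
          simp only [hF, ← Module.End.mul_apply, ← map_mul, mul_assoc]
        rw [this, hx]
        rfl }
  have htop : LinearMap.ker F = ⊤ := toSubmodule_eq_top_of_irreducible hπ.1 S hFx₀ hx₀
  ext x
  have h1 : F x 1 = 0 := by
    rw [LinearMap.ker_eq_top.1 htop]
    rfl
  have h2 := congrArg ((TensorProduct.lid R R).toLinearMap ∘ₗ TensorProduct.map
    (LinearMap.proj (ea 1) : _ →ₗ[R] R) (LinearMap.proj (eb 1) : _ →ₗ[R] R)) h1
  rw [hF] at h2
  simp only [map_sum, map_smul, map_zero, LinearMap.comp_apply, TensorProduct.map_tmul,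
    LinearMap.proj_apply, LinearEquiv.coe_coe, TensorProduct.lid_tmul] at h2
  rw [Finset.sum_eq_single 1, Finset.sum_eq_single 1] at h2
  · simpa [blockUpper_one] using h2
  · intro D _ hD
    simp [hD.symm]
  · simp
  · intro A _ hA
    refine Finset.sum_eq_zero fun D _ => ?_
    simp [Pi.single_apply, hA.symm]
  · simp

end Cuspidal

/-! ### Orthogonality of additive characters -/

section Fourier

variable {k : Type uk} [Field k] {R : Type uR} [Field R]

lemma exists_addChar_ne_one {ψ : AddChar k R} (hψ : ψ ≠ 1) {a : k} (ha : a ≠ 0) :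
    ∃ x, ψ (a * x) ≠ 1 := by
  obtain ⟨x, hx⟩ := DFunLike.ne_iff.1 hψ
  refine ⟨a⁻¹ * x, ?_⟩
  rwa [mul_inv_cancel_left₀ ha]

lemma sum_addChar_dotProduct [Finite k] [DecidableEq k] {ψ : AddChar k R} (hψ : ψ ≠ 1) {ι : Type*} [Fintype ι] [DecidableEq ι]
    (y : ι → k) : ∑ v : ι → k, ψ (v ⬝ᵥ y) = if y = 0 then (Fintype.card (ι → k) : R) else 0 := by
  split_ifs with hy
  · subst hy
    simp
  · let χ : AddChar (ι → k) R :=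
      { toFun := fun v => ψ (v ⬝ᵥ y)
        map_zero_eq_one' := by simp
        map_add_eq_mul' := fun v w => by rw [add_dotProduct, AddChar.map_add_eq_mul] }
    have hχ : χ ≠ 0 := by
      obtain ⟨i, hi⟩ := Function.ne_iff.1 hy
      obtain ⟨x, hx⟩ := exists_addChar_ne_one hψ hi
      refine DFunLike.ne_iff.2 ⟨Pi.single i x, ?_⟩
      change ψ (Pi.single i x ⬝ᵥ y) ≠ 1
      rwa [single_dotProduct, mul_comm]
    exact AddChar.sum_eq_zero_of_ne_one hχ

end Fourier

/-! ### Filtration of N by columns -/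

section Matrices

variable {k : Type uk} [Field k] {R : Type uR} [Field R] {n : ℕ}

/-- An invertible matrix with prescribed non-zero row. -/
lemma exists_GL_row (v : Fin n → k) (i₀ l : Fin n) (hv : v i₀ ≠ 0) :
    ∃ M : GL (Fin n) k, (∀ c, M.val l c = v c) ∧
      ∀ r, r ≠ l → ∀ c, M.val r c = if c = Equiv.swap i₀ l r then 1 else 0 := by
  -- The other rows are the unit vectors except the one at i₀, with the one at l moved to row i₀.
  -- This explicit form is what later places M in a Levi subgroup or in H.
  let A : Matrix (Fin n) (Fin n) k :=
    Matrix.of fun r c => if r = l then v c else if c = Equiv.swap i₀ l r then 1 else 0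
  have hA : IsUnit A := by
    rw [← Matrix.mulVec_injective_iff_isUnit]
    refine (injective_iff_map_eq_zero (Matrix.mulVecLin A)).2 fun x hx => ?_
    have h0 : ∀ i, i ≠ i₀ → x i = 0 := by
      intro i hi
      have h1 := congrFun hx (Equiv.swap i₀ l i)
      have h2 : Equiv.swap i₀ l i ≠ l := by
        rw [ne_eq, Equiv.swap_apply_eq_iff, Equiv.swap_apply_right]
        exact hi
      rw [Matrix.mulVecLin_apply, Matrix.mulVec, dotProduct] at h1
      simpa [A, h2] using h1
    have h1 := congrFun hx l
    rw [Matrix.mulVecLin_apply, Matrix.mulVec, dotProduct, Finset.sum_eq_single i₀] at h1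
    · ext i
      by_cases hi : i = i₀
      · subst hi
        simpa [A, hv] using h1
      · exact h0 i hi
    · intro i _ hi
      rw [h0 i hi, mul_zero]
    · simp
  obtain ⟨M, hM⟩ := hA
  refine ⟨M, fun c => ?_, fun r hr c => ?_⟩
  · simp [hM, A]
  · simp [hM, A, hr]

/-- The matrices `diag(g, 1)` with `g` of size `j`. -/
def leviSubgroup (k : Type uk) [Field k] (n j : ℕ) : Subgroup (GL (Fin n) k) where
  carrier := {d | ∀ r c : Fin n, (j ≤ r.val ∨ j ≤ c.val) →
    d.val r c = (1 : Matrix (Fin n) (Fin n) k) r c}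
  one_mem' := fun r c _ => rfl
  mul_mem' {a b} ha hb := by
    rintro r c (h | h)
    · rw [Units.val_mul, Matrix.mul_apply,
        Finset.sum_congr rfl fun x _ => by rw [ha r x (Or.inl h)], ← Matrix.mul_apply,
        Matrix.one_mul, hb r c (Or.inl h)]
    · rw [Units.val_mul, Matrix.mul_apply,
        Finset.sum_congr rfl fun x _ => by rw [hb x c (Or.inr h)], ← Matrix.mul_apply,
        Matrix.mul_one, ha r c (Or.inr h)]
  inv_mem' {a} ha := by
    rintro r c (h | h)
    · have h1 : a.val * a⁻¹.val = 1 := a.mul_inv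
      rw [← h1, Matrix.mul_apply, Finset.sum_congr rfl fun x _ => by rw [ha r x (Or.inl h)],
        ← Matrix.mul_apply, Matrix.one_mul]
    · have h1 : a⁻¹.val * a.val = 1 := a.inv_mul
      rw [← h1, Matrix.mul_apply, Finset.sum_congr rfl fun x _ => by rw [ha x c (Or.inr h)],
        ← Matrix.mul_apply, Matrix.mul_one]

lemma exists_diagOne_of_mem_leviSubgroup {m j : ℕ} (hj : j ≤ m) {d : GL (Fin (m + 1)) k}
    (hd : d ∈ leviSubgroup k (m + 1) j) : ∃ g : GL (Fin m) k, d = diagOne g := by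
  obtain ⟨y, g, hg⟩ := exists_eq_colGL_mul_diagOne (g := d)
    (fun i => by
      rw [hd _ _ (Or.inl (by simpa using hj)), Matrix.one_apply_ne]
      exact (Fin.castSucc_lt_last i).ne')
    (by rw [hd _ _ (Or.inl (by simpa using hj)), Matrix.one_apply_eq])
  refine ⟨g, ?_⟩
  have hy : y = 0 := by
    ext i
    have h1 := hd i.castSucc (Fin.last m) (Or.inr (by simpa using hj))
    rw [hg, Matrix.one_apply_ne (Fin.castSucc_lt_last i).ne] at h1
    simpa [Units.val_mul, Matrix.mul_apply, Fin.sum_univ_castSucc] using h1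
  rw [hg, hy, colGL_zero, one_mul]

/-- The subgroup of the unipotent matrices whose first `j` columns are trivial. -/
def IsTail (j : ℕ) (u : GL (Fin n) k) : Prop :=
  u ∈ unipotent k n ∧ ∀ i c : Fin n, c.val < j → u.val i c = (1 : Matrix (Fin n) (Fin n) k) i c

/-- Triviality of the first j columns means that u fixes the first j basis vectors, and N preserves
their span. -/
lemma IsTail.conj {j : ℕ} {u w : GL (Fin n) k} (hu : IsTail j u) (hw : w ∈ unipotent k n) :
    IsTail j (w * u * w⁻¹) := by
  refine ⟨mul_mem (mul_mem hw hu.1) (inv_mem hw), fun i c hc => ?_⟩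
  have h1 : ∀ a, (u * w⁻¹).val a c = w⁻¹.val a c := by
    intro a
    rw [Units.val_mul, Matrix.mul_apply, ← Matrix.one_mul w⁻¹.val, Matrix.mul_apply, Matrix.one_mul]
    refine Finset.sum_congr rfl fun b _ => ?_
    by_cases hb : c < b
    · rw [(mem_unipotent_iff.1 (inv_mem hw)).1 _ _ hb, mul_zero, mul_zero]
    · rw [hu.2 a b]
      rw [not_lt, Fin.le_def] at hb
      omega
  have h2 : w.val * w⁻¹.val = 1 := w.mul_inv
  rw [mul_assoc, Units.val_mul, Matrix.mul_apply, ← h2, Matrix.mul_apply]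
  exact Finset.sum_congr rfl fun a _ => by rw [h1]

lemma unipChar_conj (ψ : AddChar k R) {u w : GL (Fin n) k} (hu : u ∈ unipotent k n)
    (hw : w ∈ unipotent k n) : unipChar ψ (w * u * w⁻¹) = unipChar ψ u := by
  rw [unipChar_mul ψ (mul_mem hw hu) (inv_mem hw), unipChar_mul ψ hw hu, unipChar_inv_elt ψ hw,
    mul_right_comm, mul_inv_cancel₀ (unipChar_ne_zero ψ w), one_mul]

lemma unipChar_congr (ψ : AddChar k R) {u u' : GL (Fin n) k}
    (h : ∀ i c : Fin n, i.val + 1 = c.val → u.val i c = u'.val i c) :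
    unipChar ψ u = unipChar ψ u' := by
  rw [unipChar, unipChar]
  congr 1
  refine Finset.sum_congr rfl fun i _ => ?_
  split_ifs with hi
  · exact h _ _ rfl
  · rfl

/-- Conjugation by diag(d, 1), with d of size j, can only change entries of u in the first j rows of
the columns after j. The superdiagonal entries of those columns lie lower, so ψ is preserved. -/
lemma IsTail.levi_conj_apply {j : ℕ} {u d : GL (Fin n) k} (hu : IsTail (j + 1) u)
    (hd : d ∈ leviSubgroup k n j) (i c : Fin n) :
    (c.val ≤ j → (d⁻¹ * u * d).val i c = (1 : Matrix (Fin n) (Fin n) k) i c) ∧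
    (j < c.val → j ≤ i.val → (d⁻¹ * u * d).val i c = u.val i c) := by
  constructor
  · intro hc
    have h1 : ∀ a, (u * d).val a c = d.val a c := by
      intro a
      rw [Units.val_mul, Matrix.mul_apply, ← Matrix.one_mul d.val, Matrix.mul_apply, Matrix.one_mul]
      refine Finset.sum_congr rfl fun b _ => ?_
      by_cases hb : b.val ≤ j
      · rw [hu.2 a b (by omega)]
      · rw [hd b c (Or.inl (by omega)), Matrix.one_apply_ne, mul_zero, mul_zero]
        rintro rfl
        omega
    have h2 : d⁻¹.val * d.val = 1 := d.inv_mul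
    rw [mul_assoc, Units.val_mul, Matrix.mul_apply, ← h2, Matrix.mul_apply]
    exact Finset.sum_congr rfl fun a _ => by rw [h1]
  · intro hc hi
    have hd' := inv_mem hd
    rw [Units.val_mul, Matrix.mul_apply,
      Finset.sum_congr rfl fun x _ => by rw [hd x c (Or.inr hc.le)], ← Matrix.mul_apply,
      Matrix.mul_one, Units.val_mul, Matrix.mul_apply,
      Finset.sum_congr rfl fun x _ => by rw [hd' i x (Or.inl hi)], ← Matrix.mul_apply,
      Matrix.one_mul]

lemma IsTail.levi_conj {j : ℕ} {u d : GL (Fin n) k} (hu : IsTail (j + 1) u)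
    (hd : d ∈ leviSubgroup k n j) : IsTail (j + 1) (d⁻¹ * u * d) := by
  have h := fun i c => hu.levi_conj_apply hd i c
  refine ⟨mem_unipotent_iff.2 ⟨fun i c hic => ?_, fun i => ?_⟩, fun i c hc => (h i c).1 (by omega)⟩
  · by_cases hc : c.val ≤ j
    · rw [(h i c).1 hc, Matrix.one_apply_ne hic.ne']
    · rw [Fin.lt_def] at hic
      rw [(h i c).2 (by omega) (by omega)]
      exact (mem_unipotent_iff.1 hu.1).1 _ _ hic
  · by_cases hc : i.val ≤ j
    · rw [(h i i).1 hc, Matrix.one_apply_eq]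
    · rw [(h i i).2 (by omega) (by omega)]
      exact (mem_unipotent_iff.1 hu.1).2 _

lemma IsTail.unipChar_levi_conj (ψ : AddChar k R) {j : ℕ} {u d : GL (Fin n) k}
    (hu : IsTail (j + 1) u) (hd : d ∈ leviSubgroup k n j) :
    unipChar ψ (d⁻¹ * u * d) = unipChar ψ u := by
  have h := fun i c => hu.levi_conj_apply hd i c
  refine unipChar_congr ψ fun i c hic => ?_
  by_cases hc : c.val ≤ j
  · rw [(h i c).1 hc, hu.2 i c (by omega)]
  · rw [(h i c).2 (by omega) (by omega)]

/-- The unipotent matrix whose only non-trivial column is the `j`-th one, with entries `y i` for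
`i < j`. -/
def columnGL (j : Fin n) (y : Fin n → k) : GL (Fin n) k :=
  mkUnipotent (1 + Matrix.of fun i c => if c = j then (if i < j then y i else 0) else 0)
    (fun i c hic => by
      rw [Matrix.add_apply, Matrix.one_apply_ne hic.ne', Matrix.of_apply, zero_add]
      split_ifs with h1 h2
      · subst h1
        exact absurd h2 hic.asymm
      all_goals rfl)
    (fun i => by
      rw [Matrix.add_apply, Matrix.one_apply_eq, Matrix.of_apply]
      split_ifs with h1 h2
      · subst h1
        exact absurd h2 (lt_irrefl _)
      all_goals simp)

lemma columnGL_mem (j : Fin n) (y : Fin n → k) : columnGL j y ∈ unipotent k n :=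
  mkUnipotent_mem _ _ _

lemma mul_columnGL_apply (g : GL (Fin n) k) (j : Fin n) (y : Fin n → k) (i c : Fin n) :
    (g * columnGL j y).val i c = g.val i c +
      if c = j then ∑ a, g.val i a * (if a < j then y a else 0) else 0 := by
  rw [columnGL, Units.val_mul, mkUnipotent_val, Matrix.mul_add, Matrix.mul_one, Matrix.add_apply]
  congr 1
  rw [Matrix.mul_apply]
  split_ifs with h
  · simp [h]
  · simp [h]

lemma columnGL_apply (j : Fin n) (y : Fin n → k) (i c : Fin n) :
    (columnGL j y).val i c = (1 : Matrix (Fin n) (Fin n) k) i c +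
      if c = j then (if i < j then y i else 0) else 0 := rfl

lemma columnGL_mul_apply (g : GL (Fin n) k) (j : Fin n) (y : Fin n → k) (i c : Fin n) :
    (columnGL j y * g).val i c = g.val i c + (if i < j then y i else 0) * g.val j c := by
  rw [columnGL, Units.val_mul, mkUnipotent_val, Matrix.add_mul, Matrix.one_mul, Matrix.add_apply]
  congr 1
  rw [Matrix.mul_apply]
  simp [ite_mul]

lemma columnGL_add (j : Fin n) (y z : Fin n → k) :
    columnGL j (y + z) = columnGL j y * columnGL j z := by
  apply Units.ext
  ext i c
  rw [columnGL_mul_apply, columnGL_apply, columnGL_apply, columnGL_apply]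
  rcases eq_or_ne c j with rfl | hc
  · simp
    split_ifs <;> ring
  · simp [hc, hc.symm]

lemma columnGL_eq_one {j : Fin n} {y : Fin n → k} (hy : ∀ i, i < j → y i = 0) :
    columnGL j y = 1 := by
  apply Units.ext
  ext i c
  rw [columnGL_apply, Units.val_one]
  split_ifs with h1 h2
  · rw [hy i h2, add_zero]
  all_goals rw [add_zero]

@[simp] lemma columnGL_zero (j : Fin n) : columnGL j (0 : Fin n → k) = 1 :=
  columnGL_eq_one fun _ _ => rfl

lemma levi_mul_columnGL {j : Fin n} {d : GL (Fin n) k} (hd : d ∈ leviSubgroup k n j)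
    {y : Fin n → k} (hy : ∀ i, j ≤ i → y i = 0) :
    d * columnGL j y = columnGL j (d.val *ᵥ y) * d := by
  apply Units.ext
  ext i c
  rw [mul_columnGL_apply, columnGL_mul_apply, hd j c (Or.inl le_rfl)]
  congr 1
  have h1 : ∀ a, (if a < j then y a else 0) = y a := fun a => by
    split_ifs with h
    · rfl
    · rw [hy a (not_lt.1 h)]
  simp only [h1]
  rcases eq_or_ne c j with rfl | hc
  · rw [if_pos rfl, Matrix.one_apply_eq, mul_one]
    split_ifs with h
    · rfl
    · rw [Finset.sum_congr rfl fun x _ => by rw [hd i x (Or.inl (not_lt.1 h))]]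
      simp [Matrix.one_apply, hy i (not_lt.1 h)]
  · rw [if_neg hc, Matrix.one_apply_ne hc.symm, mul_zero]

lemma unipChar_columnGL (ψ : AddChar k R) {j l : Fin n} (hl : l.val + 1 = j.val) (y : Fin n → k) :
    unipChar ψ (columnGL j y) = ψ (y l) := by
  have hlj : l < j := by
    rw [Fin.lt_def]
    omega
  have : unipChar ψ (columnGL j y) = unipChar ψ (elemGL hlj (y l)) := by
    refine unipChar_congr ψ fun i c hic => ?_
    rw [columnGL_apply, elemGL_val, Matrix.add_apply, Matrix.single_apply]
    congr 1
    by_cases hc : c = j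
    · have hi : i = l := Fin.ext (by rw [hc] at hic; omega)
      subst hc hi
      simp [hlj]
    · rw [if_neg hc, if_neg fun h => hc h.2.symm]
  rw [this, unipChar_elemGL, if_pos hl]

/-- A matrix with trivial columns before the `j`-th one can be cleared in the `j`-th one. -/
lemma IsTail.mul_columnGL {j : Fin n} {u : GL (Fin n) k} (hu : IsTail j u) :
    IsTail (j + 1) (u * columnGL j (-fun i => u.val i j)) := by
  refine ⟨mul_mem hu.1 (columnGL_mem _ _), fun i c hc => ?_⟩
  rw [mul_columnGL_apply]
  rcases eq_or_ne c j with rfl | hcj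
  · rw [if_pos rfl, Finset.sum_congr rfl (g := fun a => (1 : Matrix (Fin n) (Fin n) k) i a *
      (if a < c then -u.val a c else 0))]
    · simp only [Matrix.one_apply, ite_mul, one_mul, zero_mul, Finset.sum_ite_eq, Finset.mem_univ,
        if_true]
      rcases lt_trichotomy i c with h | h | h
      · simp [h, h.ne]
      · simp [h, (mem_unipotent_iff.1 hu.1).2]
      · simp [h.asymm, h.ne', (mem_unipotent_iff.1 hu.1).1 _ _ h]
    · intro a _
      by_cases ha : a < c
      · rw [hu.2 i a ha]
        rfl
      · simp [ha]
  · rw [if_neg hcj, add_zero, hu.2]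
    have : c.val ≠ j.val := fun h => hcj (Fin.ext h)
    omega

lemma blockUpper_one_one_apply {a b : ℕ} (h : a + b = n) (B : Matrix (Fin a) (Fin b) k)
    (i c : Fin n) (hic : a ≤ i.val ∨ c.val < a) :
    (blockUpper h (1 : GL (Fin a) k) B 1).val i c = (1 : Matrix (Fin n) (Fin n) k) i c := by
  subst h
  rw [blockUpper_val, Matrix.reindex_apply, Matrix.submatrix_apply]
  obtain ⟨i, rfl⟩ := (finSumFinEquiv.trans (finCongr rfl)).surjective i
  obtain ⟨c, rfl⟩ := (finSumFinEquiv.trans (finCongr rfl)).surjective c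
  rw [Equiv.symm_apply_apply, Equiv.symm_apply_apply]
  rcases i with i | i <;> rcases c with c | c
  · simp [Matrix.one_apply, Fin.ext_iff]
  · exfalso
    simp at hic
    omega
  · simp [Matrix.one_apply, Fin.ext_iff]
    omega
  · simp [Matrix.one_apply, Fin.ext_iff]

end Matrices

/-! ### The dual is spanned by translates of Whittaker functionals -/

section Derivatives

variable {k : Type uk} [Field k] {R : Type uR} [Field R] {n : ℕ}
  {V : Type v} [AddCommGroup V] [Module R V]

/-- The linear forms which are `ψ`-equivariant under the unipotent matrices whose first `j`
columns are trivial. -/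
def IsTailFunctional (ψ : AddChar k R) (π : Representation R (GL (Fin n) k) V) (j : ℕ)
    (lam : Module.Dual R V) : Prop :=
  ∀ u, IsTail j u → ∀ x, lam (π u x) = unipChar ψ u * lam x

/-- A linear form `(N, ψ)`-equivariant under the columns after the `j`-th one, and invariant under
the `j`-th column, vanishes. -/
lemma HasNoUnipotentForms.eq_zero_of_isTailFunctional {ψ : AddChar k R}
    {π : Representation R (GL (Fin n) k) V} (hπ : HasNoUnipotentForms π) {j : Fin n}
    (hj : 0 < j.val) {lam : Module.Dual R V} (hlam : IsTailFunctional ψ π (j + 1) lam)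
    (hcol : ∀ y x, lam (π (columnGL j y) x) = lam x) : lam = 0 := by
  refine hπ j.val (n - j.val) (by omega) hj (by omega) lam fun B x => ?_
  set p : GL (Fin n) k := blockUpper (show j.val + (n - j.val) = n by omega) 1 B 1 with hp
  have hent := blockUpper_one_one_apply (show j.val + (n - j.val) = n by omega) B
  rw [← hp] at hent
  have hT : IsTail j p := by
    refine ⟨mem_unipotent_iff.2 ⟨fun i c hic => ?_, fun i => ?_⟩,
      fun i c hc => hent i c (Or.inr hc)⟩
    · rw [Fin.lt_def] at hic
      rw [hent i c (by omega), Matrix.one_apply_ne]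
      rintro rfl
      omega
    · rw [hent i i (by omega), Matrix.one_apply_eq]
  have hT' := hT.mul_columnGL
  -- Split the element p of the unipotent radical into its column j and the later columns. The
  -- latter have no superdiagonal entry, since these would lie in rows from j on, where p is
  -- trivial.
  set u := p * columnGL j (-fun i => p.val i j) with hu
  have hpu : p = u * columnGL j (fun i => p.val i j) := by
    rw [hu, mul_assoc, ← columnGL_add, neg_add_cancel, columnGL_zero, mul_one]
  have hψ1 : unipChar ψ u = 1 := by
    rw [← unipChar_one ψ]
    refine unipChar_congr ψ fun i c hic => ?_
    by_cases hc : c.val ≤ j.val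
    · exact hT'.2 i c (by omega)
    · rw [hu, mul_columnGL_apply, if_neg (by rintro rfl; omega), add_zero, hent i c (by omega)]
      rfl
  rw [hpu, map_mul, Module.End.mul_apply, hlam u hT', hψ1, one_mul, hcol]

variable [Finite k]

/-- The component of a linear form for the character `y ↦ ψ (v ⬝ᵥ y)` of the group of the matrices
`columnGL j y`. -/
def columnComponent (ψ : AddChar k R) (π : Representation R (GL (Fin n) k) V) (j : Fin n)
    (lam : Module.Dual R V) (v : Fin n → k) : Module.Dual R V :=
  (Fintype.card (Fin n → k) : R)⁻¹ • ∑ y : Fin n → k, ψ (-(v ⬝ᵥ y)) • lam ∘ₗ π (columnGL j y)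

lemma columnComponent_apply (ψ : AddChar k R) (π : Representation R (GL (Fin n) k) V) (j : Fin n)
    (lam : Module.Dual R V) (v : Fin n → k) (x : V) : columnComponent ψ π j lam v x =
      (Fintype.card (Fin n → k) : R)⁻¹ * ∑ y : Fin n → k,
        ψ (-(v ⬝ᵥ y)) * lam (π (columnGL j y) x) := by
  simp [columnComponent, LinearMap.sum_apply]

/-- Fourier inversion: summing over all v kills every term except y = 0. The number of vectors is
invertible in R because the characteristics differ. -/
lemma sum_columnComponent (hchar : ringChar R ≠ ringChar k) {ψ : AddChar k R} (hψ : ψ ≠ 1)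
    (π : Representation R (GL (Fin n) k) V) (j : Fin n) (lam : Module.Dual R V) :
    ∑ v, columnComponent ψ π j lam v = lam := by
  classical
  ext x
  have hcard : (Fintype.card (Fin n → k) : R) ≠ 0 := by
    rw [Fintype.card_fun, Nat.cast_pow]
    exact pow_ne_zero _ (card_field_ne_zero hchar)
  simp only [LinearMap.sum_apply, columnComponent_apply, ← Finset.mul_sum]
  rw [Finset.sum_comm, Finset.sum_congr rfl (g := fun y =>
    if y = 0 then (Fintype.card (Fin n → k) : R) * lam (π (columnGL j y) x) else 0)]
  · rw [Finset.sum_ite_eq' Finset.univ (0 : Fin n → k), if_pos (Finset.mem_univ _),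
      inv_mul_cancel_left₀ hcard, columnGL_zero, map_one]
    rfl
  · intro y _
    rw [← Finset.sum_mul]
    have := sum_addChar_dotProduct hψ (-y)
    simp only [dotProduct_neg, neg_eq_zero] at this
    rw [this, ite_mul, zero_mul]

lemma columnComponent_columnGL (ψ : AddChar k R) (π : Representation R (GL (Fin n) k) V)
    (j : Fin n) (lam : Module.Dual R V) (v z : Fin n → k) (x : V) :
    columnComponent ψ π j lam v (π (columnGL j z) x) =
      ψ (v ⬝ᵥ z) * columnComponent ψ π j lam v x := by
  rw [columnComponent_apply, columnComponent_apply, mul_left_comm, Finset.mul_sum _ _ (ψ (v ⬝ᵥ z))]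
  congr 1
  refine Fintype.sum_equiv (Equiv.addRight z) _ _ fun y => ?_
  rw [Equiv.coe_addRight, columnGL_add, map_mul, Module.End.mul_apply, ← mul_assoc,
    ← AddChar.map_add_eq_mul]
  congr 2
  rw [dotProduct_add]
  ring

/-- The matrices of column j normalize the group of later columns and fix its character ψ. -/
lemma IsTailFunctional.columnComponent {ψ : AddChar k R} {π : Representation R (GL (Fin n) k) V}
    {j : Fin n} {lam : Module.Dual R V} (hlam : IsTailFunctional ψ π (j + 1) lam)
    (v : Fin n → k) : IsTailFunctional ψ π (j + 1) (columnComponent ψ π j lam v) := by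
  intro u hu x
  rw [columnComponent_apply, columnComponent_apply, mul_left_comm, Finset.mul_sum _ _ (unipChar ψ u)]
  congr 1
  refine Finset.sum_congr rfl fun y _ => ?_
  have h1 : columnGL j y * u = (columnGL j y * u * (columnGL j y)⁻¹) * columnGL j y := by group
  rw [← Module.End.mul_apply, ← map_mul, h1, map_mul, Module.End.mul_apply,
    hlam _ (hu.conj (columnGL_mem j y)), unipChar_conj ψ hu.1 (columnGL_mem j y)]
  ring

/-- The forms `ψ`-equivariant under the columns after the `j`-th one are spanned by translates of
the forms `ψ`-equivariant under the columns from the `j`-th one on. -/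
lemma HasNoUnipotentForms.isTailFunctional_mem (hchar : ringChar R ≠ ringChar k) {ψ : AddChar k R}
    (hψ : ψ ≠ 1) {π : Representation R (GL (Fin n) k) V} (hπ : HasNoUnipotentForms π)
    {j : Fin n} (hj : 0 < j.val) {S : Submodule R (Module.Dual R V)}
    (hS : ∀ lam, IsTailFunctional ψ π j lam → ∀ d ∈ leviSubgroup k n j, lam ∘ₗ π d ∈ S)
    {lam : Module.Dual R V} (hlam : IsTailFunctional ψ π (j + 1) lam) : lam ∈ S := by
  rw [← sum_columnComponent hchar hψ π j lam]
  refine sum_mem fun v _ => ?_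
  set μ := FiniteGL.columnComponent ψ π j lam v with hμ
  have hμ1 : IsTailFunctional ψ π (j + 1) μ := hlam.columnComponent v
  have hμ2 : ∀ z x, μ (π (columnGL j z) x) = ψ (v ⬝ᵥ z) * μ x :=
    columnComponent_columnGL ψ π j lam v
  -- The entries y i with j ≤ i do not affect `columnGL j y`, so a component whose character depends
  -- on them vanishes.
  by_cases hv : ∃ i, j ≤ i ∧ v i ≠ 0
  · obtain ⟨i, hi, hvi⟩ := hv
    obtain ⟨t, ht⟩ := exists_addChar_ne_one hψ hvi
    suffices μ = 0 by
      rw [this]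
      exact zero_mem _
    ext x
    have h1 := hμ2 (Pi.single i t) x
    rw [columnGL_eq_one (fun a ha => Pi.single_eq_of_ne (M := fun _ => k)
      (show a ≠ i from fun h => absurd ha (not_lt.2 (h ▸ hi))) t), map_one, Module.End.one_apply, dotProduct_single] at h1
    by_contra hx
    exact ht (mul_right_cancel₀ hx (by rw [← h1, one_mul]))
  push Not at hv
  -- The trivial character contributes nothing by cuspidality. All other characters are conjugate,
  -- under GL_j, to y ↦ ψ(y_{j-1}), the one that occurs in ψ on N.
  by_cases hv0 : v = 0
  · have : μ = 0 := hπ.eq_zero_of_isTailFunctional hj hμ1 fun y x => by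
      rw [hμ2, hv0, zero_dotProduct, AddChar.map_zero_eq_one, one_mul]
    rw [this]
    exact zero_mem _
  obtain ⟨i₀, hi₀⟩ := Function.ne_iff.1 hv0
  have hi₀j : i₀ < j := by
    by_contra h
    exact hi₀ (hv i₀ (not_lt.1 h))
  let l : Fin n := ⟨j.val - 1, by omega⟩
  have hl : l.val + 1 = j.val := by
    simp only [l]
    omega
  have hlj : l < j := by
    rw [Fin.lt_def]
    omega
  obtain ⟨d, hd1, hd2⟩ := exists_GL_row v i₀ l hi₀
  have hd : d ∈ leviSubgroup k n j := by
    intro r c hrc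
    by_cases hr : r = l
    · subst hr
      have hc : j.val ≤ c.val := by
        rw [Fin.lt_def] at hlj
        omega
      rw [hd1, hv c hc, Matrix.one_apply_ne]
      rintro rfl
      exact absurd hlj (not_lt.2 hc)
    · rw [hd2 r hr, Matrix.one_apply]
      congr 1
      apply propext
      by_cases hri : r = i₀
      · subst hri
        rw [Equiv.swap_apply_left]
        have hc : j ≤ c := by
          rw [Fin.lt_def] at hi₀j
          rw [Fin.le_def]
          omega
        constructor
        · rintro rfl
          exact absurd hlj (not_lt.2 hc)
        · rintro rfl
          exact absurd hi₀j (not_lt.2 hc)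
      · rw [Equiv.swap_apply_of_ne_of_ne hri hr, eq_comm]
  have key : μ = (μ ∘ₗ π d⁻¹) ∘ₗ π d := by
    ext x
    simp only [LinearMap.comp_apply, ← Module.End.mul_apply, ← map_mul, inv_mul_cancel, map_one,
      Module.End.one_apply]
  rw [key]
  refine hS _ ?_ d hd
  have hν1 : ∀ u, IsTail (j + 1) u → ∀ x, (μ ∘ₗ π d⁻¹) (π u x) =
      unipChar ψ u * (μ ∘ₗ π d⁻¹) x := by
    intro u hu x
    have h1 : d⁻¹ * u = (d⁻¹ * u * d) * d⁻¹ := by group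
    rw [LinearMap.comp_apply, LinearMap.comp_apply, ← Module.End.mul_apply, ← map_mul, h1, map_mul,
      Module.End.mul_apply, hμ1 _ (hu.levi_conj hd), hu.unipChar_levi_conj ψ hd]
  have hν2 : ∀ z : Fin n → k, (∀ i, j ≤ i → z i = 0) → ∀ x, (μ ∘ₗ π d⁻¹) (π (columnGL j z) x) =
      ψ (z l) * (μ ∘ₗ π d⁻¹) x := by
    intro z hz x
    have hdd : d.val * d⁻¹.val = 1 := d.mul_inv
    have hw : ∀ i, j ≤ i → (d⁻¹.val *ᵥ z) i = 0 := by
      intro i hi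
      rw [Matrix.mulVec, dotProduct,
        Finset.sum_congr rfl fun x _ => by rw [inv_mem hd i x (Or.inl hi)]]
      simp [Matrix.one_apply, hz i hi]
    have h1 := levi_mul_columnGL hd hw
    rw [Matrix.mulVec_mulVec, hdd, Matrix.one_mulVec] at h1
    have h2 : d⁻¹ * columnGL j z = columnGL j (d⁻¹.val *ᵥ z) * d⁻¹ := by
      rw [inv_mul_eq_iff_eq_mul, ← mul_assoc, h1]
      group
    rw [LinearMap.comp_apply, LinearMap.comp_apply, ← Module.End.mul_apply, ← map_mul, h2, map_mul,
      Module.End.mul_apply, hμ2]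
    congr 2
    have h3 : v ⬝ᵥ (d⁻¹.val *ᵥ z) = (d.val *ᵥ (d⁻¹.val *ᵥ z)) l := by
      rw [Matrix.mulVec, show d.val l = v from funext hd1]
    rw [h3, Matrix.mulVec_mulVec, hdd, Matrix.one_mulVec]
  intro u hu x
  have hT' := hu.mul_columnGL
  let z : Fin n → k := fun i => if i < j then u.val i j else 0
  have hz : columnGL j (fun i => u.val i j) = columnGL j z := by
    apply Units.ext
    ext a b
    rw [columnGL_apply, columnGL_apply]
    congr 2
    simp only [z]
    split_ifs <;> rfl
  have hpu : u = (u * columnGL j (-fun i => u.val i j)) * columnGL j z := by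
    rw [← hz, mul_assoc, ← columnGL_add, neg_add_cancel,
      columnGL_zero, mul_one]
  have h4 : unipChar ψ u = unipChar ψ (u * columnGL j (-fun i => u.val i j)) * ψ (z l) := by
    rw [← unipChar_columnGL ψ hl z, ← unipChar_mul ψ hT'.1 (columnGL_mem _ _), ← hpu]
  rw [h4, mul_assoc, ← hν2 z (fun i hi => if_neg (not_lt.2 hi)), ← hν1 _ hT',
    ← Module.End.mul_apply (π _) (π (columnGL j z)), ← map_mul, ← hpu]

/-- If `π` has no linear forms invariant under proper unipotent radicals, its dual is spanned by
translates of Whittaker functionals. -/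
theorem HasNoUnipotentForms.dual_mem (hchar : ringChar R ≠ ringChar k) {ψ : AddChar k R}
    (hψ : ψ ≠ 1) {m : ℕ} {π : Representation R (GL (Fin (m + 1)) k) V}
    (hπ : HasNoUnipotentForms π) {S : Submodule R (Module.Dual R V)}
    (hS : ∀ ξ ∈ whittakerFunctionals ψ π, ∀ g : GL (Fin m) k, ξ ∘ₗ π (diagOne g) ∈ S)
    (lam : Module.Dual R V) : lam ∈ S := by
  have key : ∀ j, j ≤ m + 1 → ∀ lam, IsTailFunctional ψ π j lam →
      ∀ g : GL (Fin m) k, lam ∘ₗ π (diagOne g) ∈ S := by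
    intro j
    induction j with
    | zero =>
      intro _ lam hlam g
      exact hS lam (fun u hu x => hlam u ⟨hu, fun i c hc => absurd hc (by omega)⟩ x) g
    | succ j ih =>
      intro hj lam hlam g
      -- The first column of a unipotent matrix is always trivial, so passing from j = 1 to j = 0
      -- changes nothing.
      rcases Nat.eq_zero_or_pos j with rfl | hj0
      · refine ih (by omega) lam (fun u hu x => hlam u ⟨hu.1, fun i c hc => ?_⟩ x) g
        have hc0 : c = 0 := Fin.ext (by simpa using hc)
        subst hc0
        rcases eq_or_ne i 0 with rfl | hi
        · rw [Matrix.one_apply_eq, (mem_unipotent_iff.1 hu.1).2]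
        · rw [Matrix.one_apply_ne hi, (mem_unipotent_iff.1 hu.1).1 _ _ (Fin.pos_of_ne_zero hi)]
      · let j' : Fin (m + 1) := ⟨j, by omega⟩
        -- Pulling S back by translation by diag(g, 1) absorbs g, so that the translations by d and
        -- by g compose.
        let T : Submodule R (Module.Dual R V) :=
          S.comap (LinearMap.lcomp R R (π (diagOne g)))
        have : lam ∈ T := by
          refine hπ.isTailFunctional_mem hchar hψ (j := j') hj0 (fun μ hμ d hd => ?_) hlam
          obtain ⟨g', rfl⟩ := exists_diagOne_of_mem_leviSubgroup (by simp only [j']; omega) hd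
          have h1 := ih (by omega) μ hμ (g' * g)
          rw [diagOne_mul, map_mul] at h1
          exact h1
        exact this
  have h := key (m + 1) le_rfl lam (fun u hu x => by
    have : u = 1 := by
      apply Units.ext
      ext i c
      exact hu.2 i c c.2
    rw [this, map_one, unipChar_one, one_mul]
    rfl) 1
  rw [diagOne_one, map_one] at h
  exact h

end Derivatives

/-! ### Functions supported on N H in the mirabolic subgroup -/

section Support

variable {k : Type uk} [Field k] {R : Type uR} [Field R]

/-- The last row of `g` is `(0, …, 0, 1)`. -/
def HasMirabolicRow {m : ℕ} (g : GL (Fin (m + 1)) k) : Prop :=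
  (∀ i : Fin m, g.val (Fin.last m) i.castSucc = 0) ∧ g.val (Fin.last m) (Fin.last m) = 1

/-- A function on `GL (r + 1)` that is `ψ`-equivariant under `N` on the left and equivariant under
the mirabolic part of `H` on the right is supported on `N H` on the mirabolic subgroup. -/
theorem exists_mul_of_apply_diagOne_ne_zero (ψ : AddChar k R)
    (H : (r : ℕ) → Subgroup (GL (Fin r) k)) (χ : (r : ℕ) → GL (Fin r) k → R)
    (hH : ∀ r, ∀ h ∈ H r, diagOne h ∈ H (r + 1))
    (hχ : ∀ r, ∀ h ∈ H r, χ (r + 1) (diagOne h) = χ r h)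
    (hχ0 : ∀ r, ∀ h ∈ H r, χ r h ≠ 0)
    (hrow : ∀ (r : ℕ) (g : GL (Fin (r + 1)) k),
      (∀ y, colGL y ∈ H (r + 2) → ψ ((g.val *ᵥ y) (Fin.last r)) = χ (r + 2) (colGL y)) →
      ∃ h ∈ H (r + 1), HasMirabolicRow (g * h)) :
    ∀ (r : ℕ) (F : GL (Fin (r + 1)) k → R),
      (∀ u ∈ unipotent k (r + 1), ∀ g, F (u * g) = unipChar ψ u * F g) →
      (∀ h ∈ H r, ∀ g, F (g * diagOne h) = χ r h * F g) →
      (∀ y, colGL y ∈ H (r + 1) → ∀ g, F (g * colGL y) = χ (r + 1) (colGL y) * F g) →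
      ∀ g : GL (Fin r) k, F (diagOne g) ≠ 0 → ∃ u ∈ unipotent k r, ∃ h ∈ H r, g = u * h := by
  intro r
  induction r with
  | zero =>
    intro F _ _ _ g _
    exact ⟨1, one_mem _, 1, one_mem _, Units.ext (Subsingleton.elim _ _)⟩
  | succ r ih =>
    intro F h1 h2 h3 g hg
    -- Moving a column matrix through diag(g, 1) turns y into g y. Comparing the two equivariances
    -- at a point of the support constrains the last row of g, which an element of H can then make
    -- equal to (0, …, 0, 1).
    obtain ⟨h, hh, hgh⟩ := hrow r g fun y hy => by
      have h4 := h3 y hy (diagOne g)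
      rw [diagOne_mul_colGL, h1 _ (colGL_mem_unipotent _), unipChar_colGL] at h4
      exact mul_right_cancel₀ hg h4
    obtain ⟨y, g', hg'⟩ := exists_eq_colGL_mul_diagOne hgh.1 hgh.2
    -- The remaining factor has smaller size, and the restricted function inherits the same
    -- equivariances.
    obtain ⟨u, hu, h', hh', rfl⟩ := ih (fun x => F (diagOne x))
      (fun u hu x => by
        rw [diagOne_mul, h1 _ (diagOne_mem_unipotent.2 hu), unipChar_diagOne])
      (fun h' hh' x => by
        rw [diagOne_mul, h2 _ (hH r h' hh'), hχ r h' hh'])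
      (fun y hy x => by rw [diagOne_mul, h2 _ hy]) g' (fun h0 => by
        have h4 := h2 h hh (diagOne g)
        rw [← diagOne_mul, hg', diagOne_mul,
          h1 _ (diagOne_mem_unipotent.2 (colGL_mem_unipotent _)), h0, mul_zero] at h4
        exact mul_ne_zero (hχ0 _ h hh) hg h4.symm)
    refine ⟨colGL y * diagOne u, mul_mem (colGL_mem_unipotent _) (diagOne_mem_unipotent.2 hu),
      diagOne h' * h⁻¹, mul_mem (hH _ _ hh') (inv_mem hh), ?_⟩
    rw [← mul_assoc, eq_mul_inv_iff_mul_eq, hg', diagOne_mul, mul_assoc]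

/-- A family of subgroups for which the trivial character of `H` occurs only on `N H` in the
restriction to mirabolic subgroups of functions equivariant under `(N, ψ)`. -/
structure IsMirabolicFamily (ψ : AddChar k R) (H : (r : ℕ) → Subgroup (GL (Fin r) k)) : Prop where
  diagOne_mem : ∀ r, ∀ h ∈ H r, diagOne h ∈ H (r + 1)
  exists_row : ∀ (r : ℕ) (g : GL (Fin (r + 1)) k),
    (∀ y, colGL y ∈ H (r + 2) → ψ ((g.val *ᵥ y) (Fin.last r)) = 1) →
    ∃ h ∈ H (r + 1), HasMirabolicRow (g * h)

end Support

/-! ### The Kirillov model and its Bessel vector -/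

section Kirillov

variable {k : Type uk} [Field k] {R : Type uR} [Field R]
  {V : Type v} [AddCommGroup V] [Module R V] {m : ℕ}

/-- A Whittaker functional `ξ` and a vector `x₀` such that the functions `g ↦ ξ (π (diag(g, 1)) x)`
determine `x`, and the one attached to `x₀` is supported on `N`. -/
structure IsKirillovPair (ψ : AddChar k R) (π : Representation R (GL (Fin (m + 1)) k) V)
    (ξ : Module.Dual R V) (x₀ : V) : Prop where
  mem : ξ ∈ whittakerFunctionals ψ π
  map_unipotent : x₀ ∈ whittakerVectors ψ π
  apply_unipotent : ∀ u ∈ unipotent k m, ξ (π (diagOne u) x₀) = unipChar ψ u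
  apply_of_notMem : ∀ g, g ∉ unipotent k m → ξ (π (diagOne g) x₀) = 0
  eq_zero : ∀ x, (∀ g : GL (Fin m) k, ξ (π (diagOne g) x) = 0) → x = 0
  exists_smul : ∀ ξ' ∈ whittakerFunctionals ψ π, ∃ c : R, ξ' = c • ξ

lemma IsKirillovPair.apply_diagOne_mul {ψ : AddChar k R}
    {π : Representation R (GL (Fin (m + 1)) k) V} {ξ : Module.Dual R V} {x₀ : V}
    (h : IsKirillovPair ψ π ξ x₀) {u : GL (Fin m) k}
    (hu : u ∈ unipotent k m) (g : GL (Fin m) k) (x : V) :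
    ξ (π (diagOne (u * g)) x) = unipChar ψ u * ξ (π (diagOne g) x) := by
  rw [diagOne_mul, map_mul, Module.End.mul_apply, h.mem _ (diagOne_mem_unipotent.2 hu),
    unipChar_diagOne]

variable [Finite k]

/-- A Whittaker functional exists because translates of such functionals span the dual, and it
separates vectors for the same reason. The vector x₀ is an (N, ψ)-eigenvector normalized by ξ(x₀) =
1. -/
theorem exists_isKirillovPair [IsAlgClosed R] (hchar : ringChar R ≠ ringChar k) {ψ : AddChar k R}
    (hψ : ψ ≠ 1) {π : Representation R (GL (Fin (m + 1)) k) V} (hirr : π.IsIrreducible)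
    (hπ : HasNoUnipotentForms π) : ∃ ξ x₀, IsKirillovPair ψ π ξ x₀ := by
  have hex : ∃ ξ ∈ whittakerFunctionals ψ π, ξ ≠ 0 := by
    by_contra! h
    obtain ⟨x, hx⟩ := exists_ne_zero_of_irreducible hirr
    refine hx ((Module.forall_dual_apply_eq_zero_iff R x).1 fun lam => ?_)
    have : lam ∈ (⊥ : Submodule R (Module.Dual R V)) :=
      hπ.dual_mem hchar hψ (fun ξ hξ g => by
        rw [h ξ hξ, LinearMap.zero_comp]
        exact zero_mem _) lam
    rw [(Submodule.mem_bot R).1 this]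
    rfl
  obtain ⟨ξ₁, hξ₁, hne⟩ := hex
  obtain ⟨y, hy⟩ : ∃ y, ξ₁ y ≠ 0 := by
    by_contra! h
    exact hne (LinearMap.ext h)
  set x₀ := whittakerAvg ψ π y with hx₀
  have hx₀m : x₀ ∈ whittakerVectors ψ π := whittakerAvg_mem ψ π y
  have hx₁ : ξ₁ x₀ ≠ 0 := by rwa [hx₀, apply_whittakerAvg hchar hξ₁]
  have hx₀0 : x₀ ≠ 0 := fun h => hx₁ (by rw [h, map_zero])
  set ξ : Module.Dual R V := (ξ₁ x₀)⁻¹ • ξ₁ with hξdef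
  have hξ : ξ ∈ whittakerFunctionals ψ π := Submodule.smul_mem _ _ hξ₁
  have hξx : ξ x₀ = 1 := by
    rw [hξdef, LinearMap.smul_apply, smul_eq_mul, inv_mul_cancel₀ hx₁]
  have hspan : ∀ ξ' ∈ whittakerFunctionals ψ π, ∃ c : R, ξ' = c • ξ := fun ξ' hξ' => by
    refine ⟨ξ' x₀, functional_eq_of_whittakerVectors hchar
      (fun z hz => exists_smul_eq_of_mem_whittakerVectors hchar hψ hirr hx₀m hx₀0 hz) hξ'
      (Submodule.smul_mem _ _ hξ) ?_⟩
    rw [LinearMap.smul_apply, hξx, smul_eq_mul, mul_one]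
  have huni : ∀ u ∈ unipotent k m, ξ (π (diagOne u) x₀) = unipChar ψ u := fun u hu => by
    rw [hξ _ (diagOne_mem_unipotent.2 hu), hξx, mul_one, unipChar_diagOne]
  refine ⟨ξ, x₀, hξ, hx₀m, huni, fun g hg => ?_, fun x hx => ?_, hspan⟩
  · by_contra h0
    -- Here the support statement is applied with N itself as H and ψ as χ: the Bessel function
    -- ξ(π(g)x₀) is supported on N N = N.
    obtain ⟨u, hu, h, hh, rfl⟩ := exists_mul_of_apply_diagOne_ne_zero ψ (unipotent k)
      (fun r => unipChar ψ) (fun r h hh => diagOne_mem_unipotent.2 hh)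
      (fun r h _ => unipChar_diagOne ψ h) (fun r h _ => unipChar_ne_zero ψ h)
      (fun r g hg => by
        refine ⟨1, one_mem _, ?_⟩
        have h1 : ∀ i, g.val (Fin.last r) i = (1 : Matrix (Fin (r + 1)) (Fin (r + 1)) k)
            (Fin.last r) i := by
          intro i
          by_contra hne
          obtain ⟨t, ht⟩ := exists_addChar_ne_one hψ (sub_ne_zero.2 hne)
          refine ht ?_
          have h2 := hg (Pi.single i t) (colGL_mem_unipotent _)
          rw [unipChar_colGL, Matrix.mulVec, dotProduct_single] at h2
          have h3 : (Pi.single i t : Fin (r + 1) → k) (Fin.last r) =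
              (1 : Matrix (Fin (r + 1)) (Fin (r + 1)) k) (Fin.last r) i * t := by
            rw [Pi.single_apply, Matrix.one_apply]
            split_ifs <;> simp
          rw [h3] at h2
          rw [sub_mul, AddChar.map_sub_eq_div, h2, div_self (addChar_ne_zero ψ _)]
        rw [mul_one]
        exact ⟨fun i => by rw [h1, Matrix.one_apply_ne (Fin.castSucc_lt_last i).ne'],
          by rw [h1, Matrix.one_apply_eq]⟩)
      m (fun g => ξ (π g x₀)) (fun u hu g => by
        rw [map_mul, Module.End.mul_apply, hξ u hu])
      (fun h hh g => by
        rw [map_mul, Module.End.mul_apply, hx₀m _ (diagOne_mem_unipotent.2 hh), map_smul, map_smul,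
          unipChar_diagOne, smul_eq_mul])
      (fun y hy g => by
        rw [map_mul, Module.End.mul_apply, hx₀m _ hy, map_smul, map_smul, smul_eq_mul]) g h0
    exact hg (mul_mem hu hh)
  · refine (Module.forall_dual_apply_eq_zero_iff R x).1 fun lam => ?_
    have : lam ∈ LinearMap.ker (Module.Dual.eval R V x) :=
      hπ.dual_mem hchar hψ (fun ξ' hξ' g => by
        obtain ⟨c, rfl⟩ := hspan ξ' hξ'
        rw [LinearMap.mem_ker, Module.Dual.eval_apply, LinearMap.comp_apply, LinearMap.smul_apply,
          hx, smul_zero]) lam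
    exact this

namespace IsKirillovPair

variable {ψ : AddChar k R} {π : Representation R (GL (Fin (m + 1)) k) V} {ξ : Module.Dual R V}
  {x₀ : V}

/-- The sum over `g` of a function against the delta function of the Kirillov model. -/
lemma sum_mul_apply (h : IsKirillovPair ψ π ξ x₀) (f : GL (Fin m) k → R) (c : R)
    (hf : ∀ u ∈ unipotent k m, f u * unipChar ψ u = c) :
    ∑ g, f g * ξ (π (diagOne g) x₀) = (Nat.card (unipotent k m) : R) * c := by
  classical
  have h1 : ∀ g, f g * ξ (π (diagOne g) x₀) = if g ∈ unipotent k m then c else 0 := by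
    intro g
    split_ifs with hg
    · rw [h.apply_unipotent g hg, hf g hg]
    · rw [h.apply_of_notMem g hg, mul_zero]
  simp only [h1]
  rw [← Finset.sum_filter, Finset.sum_const, nsmul_eq_mul]
  congr 2
  rw [Nat.card_eq_fintype_card, ← Fintype.card_subtype]

/-- A vector is recovered from its Kirillov function. -/
lemma eq_sum (hchar : ringChar R ≠ ringChar k) (h : IsKirillovPair ψ π ξ x₀) (x : V) :
    x = (Nat.card (unipotent k m) : R)⁻¹ •
      ∑ g : GL (Fin m) k, ξ (π (diagOne g) x) • π (diagOne g⁻¹) x₀ := by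
  rw [← sub_eq_zero]
  refine h.eq_zero _ fun g => ?_
  rw [map_sub, map_sub, sub_eq_zero, map_smul, map_smul, map_sum, map_sum, smul_eq_mul]
  -- Both sides have the same Kirillov function: after the substitution a = g b⁻¹, for b the
  -- summation variable, only the terms with a in N survive.
  have h1 := h.sum_mul_apply (fun a => ξ (π (diagOne (a⁻¹ * g)) x)) (ξ (π (diagOne g) x))
    (fun u hu => by
      rw [h.apply_diagOne_mul (inv_mem hu), unipChar_inv_elt ψ hu, mul_right_comm,
        inv_mul_cancel₀ (unipChar_ne_zero ψ u), one_mul])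
  rw [eq_inv_mul_iff_mul_eq₀ (card_unipotent_ne_zero hchar m), ← h1]
  refine Fintype.sum_equiv ((Equiv.inv _).trans (Equiv.mulRight g)) _ _ fun a => ?_
  simp only [Equiv.trans_apply, Equiv.inv_apply, Equiv.coe_mulRight, map_smul, smul_eq_mul]
  rw [← Module.End.mul_apply, ← map_mul π, ← diagOne_mul]
  congr 5
  group

/-- A linear form invariant under the mirabolic part of `H` is determined by its value at `x₀`. -/
lemma eq_zero_of_invariant (hchar : ringChar R ≠ ringChar k) (h : IsKirillovPair ψ π ξ x₀)
    {H : (r : ℕ) → Subgroup (GL (Fin r) k)} (hH : IsMirabolicFamily ψ⁻¹ H) {μ : Module.Dual R V}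
    (h1 : ∀ a ∈ H m, ∀ x, μ (π (diagOne a) x) = μ x)
    (h2 : ∀ y, colGL y ∈ H (m + 1) → ∀ x, μ (π (colGL y) x) = μ x) (h0 : μ x₀ = 0) : μ = 0 := by
  have hF : ∀ u ∈ unipotent k (m + 1), ∀ g, μ (π (u * g)⁻¹ x₀) =
      unipChar ψ⁻¹ u * μ (π g⁻¹ x₀) := fun u hu g => by
    rw [_root_.mul_inv_rev, map_mul, Module.End.mul_apply, h.map_unipotent _ (inv_mem hu), map_smul,
      map_smul, smul_eq_mul, unipChar_inv_char, unipChar_inv_elt ψ hu]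
  -- As a function of g this is supported on N H, where equivariance reduces it to the value at x₀.
  have key : ∀ g : GL (Fin m) k, μ (π (diagOne g)⁻¹ x₀) = 0 := by
    intro g
    by_contra hg
    obtain ⟨u, hu, a, ha, rfl⟩ := exists_mul_of_apply_diagOne_ne_zero ψ⁻¹ H (fun _ _ => (1 : R))
      hH.diagOne_mem (fun _ _ _ => rfl) (fun _ _ _ => one_ne_zero) hH.exists_row m
      (fun g => μ (π g⁻¹ x₀)) hF
      (fun a ha g => by
        rw [_root_.mul_inv_rev, map_mul, Module.End.mul_apply, ← diagOne_inv, h1 _ (inv_mem ha),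
          one_mul])
      (fun y hy g => by
        rw [_root_.mul_inv_rev, map_mul, Module.End.mul_apply, ← colGL_neg, h2, one_mul]
        rw [colGL_neg]
        exact inv_mem hy) g hg
    apply hg
    rw [diagOne_mul, hF _ (diagOne_mem_unipotent.2 hu), ← diagOne_inv, h1 _ (inv_mem ha), h0,
      mul_zero]
  ext x
  rw [h.eq_sum hchar x, map_smul, map_sum, Finset.sum_eq_zero, smul_zero]
  · rfl
  · intro g _
    rw [map_smul, diagOne_inv, key, smul_zero]

end IsKirillovPair

end Kirillov

/-! ### The two families H satisfy the mirabolic condition -/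

section Families

variable {k : Type uk} [Field k] {R : Type uR} [Field R]

lemma exists_last_row_ne_zero {r : ℕ} (g : GL (Fin (r + 1)) k) :
    ∃ i, g.val (Fin.last r) i ≠ 0 := by
  obtain ⟨j, hj, -⟩ := exists_first_ne_zero g (Fin.last r)
  exact ⟨j, hj⟩

lemma hasMirabolicRow_mul_inv {r : ℕ} {g M : GL (Fin (r + 1)) k}
    (h : ∀ c, M.val (Fin.last r) c = g.val (Fin.last r) c) : HasMirabolicRow (g * M⁻¹) := by
  have h1 : ∀ c, (g * M⁻¹).val (Fin.last r) c =
      (1 : Matrix (Fin (r + 1)) (Fin (r + 1)) k) (Fin.last r) c := by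
    intro c
    have h2 : M.val * M⁻¹.val = 1 := M.mul_inv
    rw [Units.val_mul, Matrix.mul_apply, ← h2, Matrix.mul_apply]
    exact Finset.sum_congr rfl fun a _ => by rw [h]
  exact ⟨fun i => by rw [h1, Matrix.one_apply_ne (Fin.castSucc_lt_last i).ne'],
    by rw [h1, Matrix.one_apply_eq]⟩

section Levi

/-- The diagonal matrix with entries `ε i`, where `ε i = ± 1`. -/
def signDiag (ε : ℕ → k) (hε : ∀ i, ε i * ε i = 1) (n : ℕ) : GL (Fin n) k where
  val := Matrix.diagonal fun i : Fin n => ε i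
  inv := Matrix.diagonal fun i : Fin n => ε i
  val_inv := by simp [Matrix.diagonal_mul_diagonal, hε]
  inv_val := by simp [Matrix.diagonal_mul_diagonal, hε]

lemma mem_centralizer_signDiag {ε : ℕ → k} (hε : ∀ i, ε i * ε i = 1) {n : ℕ} {h : GL (Fin n) k} :
    h ∈ Subgroup.centralizer {signDiag ε hε n} ↔
      ∀ i j : Fin n, ε i ≠ ε j → h.val i j = 0 := by
  rw [Subgroup.mem_centralizer_singleton_iff, Units.ext_iff, Units.val_mul, Units.val_mul,
    ← Matrix.ext_iff]
  refine forall_congr' fun i => forall_congr' fun j => ?_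
  simp only [signDiag, Matrix.mul_diagonal, Matrix.diagonal_mul]
  constructor
  · intro h1 hij
    have h2 : (ε i - ε j) * h.val i j = 0 := by linear_combination -h1
    exact (mul_eq_zero.1 h2).resolve_left (sub_ne_zero.2 hij)
  · intro h1
    by_cases hij : ε i = ε j
    · rw [hij, mul_comm]
    · rw [h1 hij]
      simp

/-- Columns of H are free at the indices of the same sign as r + 1, so the last row of g vanishes
there. If the sign changes at r + 1, the row is supported on the indices of the sign of r and is the
last row of an element of H. If no earlier sign differs from that at r + 1, the row would be zero,
which is impossible. This second alternative serves the sequence -1, -1, 1, -1, …. -/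
lemma isMirabolicFamily_signDiag {ψ : AddChar k R} (hψ : ψ ≠ 1) {ε : ℕ → k}
    (hε : ∀ i, ε i * ε i = 1)
    (halt : ∀ r, ε (r + 1) ≠ ε r ∨ ∀ i ≤ r, ε i = ε (r + 1)) :
    IsMirabolicFamily ψ fun r => Subgroup.centralizer {signDiag ε hε r} where
  diagOne_mem r h hh := by
    rw [mem_centralizer_signDiag] at *
    intro i j hij
    induction i using Fin.lastCases with
    | last => induction j using Fin.lastCases with
      | last => exact absurd rfl hij
      | cast j => simp
    | cast i => induction j using Fin.lastCases with
      | last => simp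
      | cast j => simpa using hh i j (by simpa using hij)
  exists_row r g hg := by
    have hv : ∀ i : Fin (r + 1), ε i = ε (r + 1) → g.val (Fin.last r) i = 0 := by
      intro i hi
      by_contra hne
      obtain ⟨t, ht⟩ := exists_addChar_ne_one hψ hne
      refine ht ?_
      have h1 := hg (Pi.single i t) (by
        rw [mem_centralizer_signDiag]
        intro a b hab
        induction a using Fin.lastCases with
        | last => induction b using Fin.lastCases with
          | last => exact absurd rfl hab
          | cast b => simp
        | cast a => induction b using Fin.lastCases with
          | last =>
            rw [colGL_castSucc_last, Pi.single_eq_of_ne]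
            rintro rfl
            exact hab (by simpa using hi)
          | cast b =>
            rw [colGL_castSucc_castSucc, Matrix.one_apply_ne]
            rintro rfl
            exact hab rfl)
      rwa [Matrix.mulVec, dotProduct_single] at h1
    obtain ⟨i₀, hi₀⟩ := exists_last_row_ne_zero g
    have hsign : ∀ i : Fin (r + 1), ε i ≠ ε (r + 1) → ε i = ε r := by
      intro i hi
      rcases halt r with h | h
      · rcases mul_self_eq_one_iff.1 (hε i) with h1 | h1 <;>
          rcases mul_self_eq_one_iff.1 (hε r) with h2 | h2 <;>
          rcases mul_self_eq_one_iff.1 (hε (r + 1)) with h3 | h3 <;> simp_all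
      · exact absurd (h i (by omega)) hi
    obtain ⟨M, hM1, hM2⟩ := exists_GL_row (g.val (Fin.last r)) i₀ (Fin.last r) hi₀
    refine ⟨M⁻¹, inv_mem ?_, hasMirabolicRow_mul_inv hM1⟩
    rw [mem_centralizer_signDiag]
    intro i j hij
    by_cases hi : i = Fin.last r
    · subst hi
      rw [hM1]
      by_contra hne
      exact hij (hsign j fun h => hne (hv j h)).symm
    · rw [hM2 i hi, if_neg]
      rintro rfl
      by_cases hii : i = i₀
      · subst hii
        rw [Equiv.swap_apply_left] at hij
        exact hij (hsign i fun h => hi₀ (hv i h))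
      · rw [Equiv.swap_apply_of_ne_of_ne hii hi] at hij
        exact hij rfl

lemma neg_one_pow_mul_self (i : ℕ) : ((-1 : k) ^ (i + 1)) * (-1) ^ (i + 1) = 1 := by
  rw [← mul_pow]
  simp

lemma signGL_eq_signDiag (n : ℕ) :
    signGL k n = signDiag (fun i => (-1 : k) ^ (i + 1)) neg_one_pow_mul_self n := Units.ext rfl

lemma neg_one_pow_succ_ne (h2 : ringChar k ≠ 2) (i : ℕ) : (-1 : k) ^ (i + 1) ≠ (-1) ^ i := by
  have := Ring.neg_one_ne_one_of_char_ne_two h2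
  rcases Nat.even_or_odd i with h | h
  · rw [h.neg_one_pow, h.add_one.neg_one_pow]
    exact this
  · rw [h.neg_one_pow, h.add_one.neg_one_pow]
    exact this.symm

lemma isMirabolicFamily_signGL {ψ : AddChar k R} (hψ : ψ ≠ 1) (h2 : ringChar k ≠ 2) :
    IsMirabolicFamily ψ fun r => Subgroup.centralizer {signGL k r} := by
  simp only [signGL_eq_signDiag]
  exact isMirabolicFamily_signDiag hψ _ fun r => Or.inl (neg_one_pow_succ_ne h2 _)

lemma starGL_signGL (n : ℕ) : starGL (signGL k n) = signGL k n := by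
  apply Units.ext
  rw [starGL_val]
  change (Matrix.diagonal _)ᵀ = Matrix.diagonal _
  rw [Matrix.diagonal_transpose]

lemma starGL_mem_centralizer {n : ℕ} {h : GL (Fin n) k}
    (hh : h ∈ Subgroup.centralizer {signGL k n}) :
    starGL h ∈ Subgroup.centralizer {signGL k n} := by
  rw [Subgroup.mem_centralizer_singleton_iff] at *
  rw [← starGL_signGL, ← starGL_mul, hh, starGL_mul]

/-- Superdiagonal entries join indices of opposite signs, so they vanish on H. -/
lemma unipChar_eq_one_of_mem_centralizer (h2 : ringChar k ≠ 2) (ψ : AddChar k R) {n : ℕ}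
    {u : GL (Fin n) k} (hu : u ∈ Subgroup.centralizer {signGL k n}) : unipChar ψ u = 1 := by
  rw [signGL_eq_signDiag, mem_centralizer_signDiag] at hu
  rw [← unipChar_one ψ]
  refine unipChar_congr ψ fun i c hic => ?_
  rw [hu, Units.val_one, Matrix.one_apply_ne]
  · rintro rfl
    omega
  · rw [← hic]
    exact (neg_one_pow_succ_ne h2 _).symm

/-- For odd n an index and its reverse have the same parity. -/
lemma antidiagGL_mem_centralizer {n : ℕ} (hn : Odd n) :
    antidiagGL k n ∈ Subgroup.centralizer {signGL k n} := by
  rw [signGL_eq_signDiag, mem_centralizer_signDiag]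
  intro i j hij
  rw [antidiagGL_apply, if_neg]
  rintro rfl
  apply hij
  simp only [pow_succ, mul_neg, mul_one, neg_inj]
  obtain ⟨t, ht⟩ := hn
  have h1 : i.rev.val + i.val = 2 * t := by
    rw [Fin.val_rev]
    omega
  have h3 : (-1 : k) ^ (i.rev.val) * (-1) ^ i.val = 1 := by
    rw [← pow_add, h1, pow_mul]
    simp
  have h4 : (-1 : k) ^ i.val * (-1) ^ i.val = 1 := by
    rw [← mul_pow]
    simp
  have h5 : (-1 : k) ^ i.val ≠ 0 := fun h => by simp [h] at h4
  exact (mul_right_cancel₀ h5 (h3.trans h4.symm)).symm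

end Levi

section Galois

variable (k₀ : Subfield k)

lemma mem_range_map_subtype_iff {n : ℕ} {g : GL (Fin n) k} :
    g ∈ (Matrix.GeneralLinearGroup.map (n := Fin n) k₀.subtype).range ↔
      ∀ i j, g.val i j ∈ k₀ := by
  constructor
  · rintro ⟨h, rfl⟩ i j
    exact (h.val i j).2
  · intro hg
    let A : Matrix (Fin n) (Fin n) k₀ := Matrix.of fun i j => ⟨g.val i j, hg i j⟩
    have hA : A.map k₀.subtype = g.val := rfl
    have hdet : A.det ≠ 0 := by
      intro h0
      have h1 : k₀.subtype A.det = g.val.det := by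
        rw [RingHom.map_det]
        rfl
      rw [h0, map_zero] at h1
      have h3 : IsUnit g.val.det := (Matrix.isUnit_iff_isUnit_det _).1 g.isUnit
      exact h3.ne_zero h1.symm
    exact ⟨Matrix.GeneralLinearGroup.mkOfDetNeZero A hdet, Units.ext hA⟩

variable {k₀}

/-- Otherwise 1 and a form a basis of k over k₀, and ψ would be trivial on both lines, hence on k.
-/
lemma mem_subfield_of_addChar (hfin : Module.finrank k₀ k = 2) {ψ : AddChar k R} (hψ : ψ ≠ 1)
    (hψ0 : ∀ x ∈ k₀, ψ x = 1) {a : k} (ha : ∀ t ∈ k₀, ψ (a * t) = 1) : a ∈ k₀ := by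
  by_contra hna
  apply hψ
  have hli : LinearIndependent k₀ ![(1 : k), a] := by
    rw [LinearIndependent.pair_iff]
    intro s t hst
    have ht : t = 0 := by
      by_contra ht
      apply hna
      have ht' : (t : k) ≠ 0 := fun h => ht (Subtype.ext h)
      have : a = ((-s / t : k₀) : k) := by
        simp only [Subfield.smul_def, smul_eq_mul, mul_one] at hst
        push_cast
        field_simp
        linear_combination hst
      rw [this]
      exact (-s / t).2
    subst ht
    refine ⟨?_, rfl⟩
    rw [zero_smul, add_zero, Subfield.smul_def, smul_eq_mul, mul_one] at hst
    exact Subtype.ext hst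
  have hspan := hli.span_eq_top_of_card_eq_finrank (by rw [hfin]; rfl)
  ext x
  have hx : x ∈ Submodule.span k₀ (Set.range ![(1 : k), a]) := by
    rw [hspan]
    trivial
  rw [Matrix.range_cons, Matrix.range_cons, Matrix.range_empty, Set.union_empty,
    Set.singleton_union, Submodule.mem_span_pair] at hx
  obtain ⟨s, t, rfl⟩ := hx
  rw [Subfield.smul_def, Subfield.smul_def, smul_eq_mul, smul_eq_mul, mul_one,
    AddChar.map_add_eq_mul, hψ0 _ s.2, mul_comm (t : k), ha _ t.2, one_mul, AddChar.one_apply]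

/-- Testing against columns over k₀ shows that the last row of g has entries in k₀; it can be
completed to an invertible matrix over k₀. -/
lemma isMirabolicFamily_galois (hfin : Module.finrank k₀ k = 2) {ψ : AddChar k R} (hψ : ψ ≠ 1)
    (hψ0 : ∀ x ∈ k₀, ψ x = 1) : IsMirabolicFamily ψ fun r =>
      (Matrix.GeneralLinearGroup.map (n := Fin r) k₀.subtype).range where
  diagOne_mem r h hh := by
    rw [mem_range_map_subtype_iff] at *
    intro i j
    induction i using Fin.lastCases with
    | last => induction j using Fin.lastCases with
      | last => simp [one_mem]
      | cast j => simp [zero_mem]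
    | cast i => induction j using Fin.lastCases with
      | last => simp [zero_mem]
      | cast j => simpa using hh i j
  exists_row r g hg := by
    have hv : ∀ i, g.val (Fin.last r) i ∈ k₀ := by
      intro i
      refine mem_subfield_of_addChar hfin hψ hψ0 fun t ht => ?_
      have h1 := hg (Pi.single i t) (by
        rw [mem_range_map_subtype_iff]
        intro a b
        induction a using Fin.lastCases with
        | last => induction b using Fin.lastCases with
          | last => simp [one_mem]
          | cast b => simp [zero_mem]
        | cast a => induction b using Fin.lastCases with
          | last =>
            rw [colGL_castSucc_last, Pi.single_apply]
            split_ifs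
            · exact ht
            · exact zero_mem _
          | cast b =>
            rw [colGL_castSucc_castSucc, Matrix.one_apply]
            split_ifs
            · exact one_mem _
            · exact zero_mem _)
      rwa [Matrix.mulVec, dotProduct_single] at h1
    obtain ⟨i₀, hi₀⟩ := exists_last_row_ne_zero g
    obtain ⟨M, hM1, hM2⟩ := exists_GL_row (g.val (Fin.last r)) i₀ (Fin.last r) hi₀
    refine ⟨M⁻¹, inv_mem ?_, hasMirabolicRow_mul_inv hM1⟩
    rw [mem_range_map_subtype_iff]
    intro i j
    by_cases hi : i = Fin.last r
    · subst hi
      rw [hM1]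
      exact hv j
    · rw [hM2 i hi]
      split_ifs
      · exact one_mem _
      · exact zero_mem _

lemma starGL_mem_range {n : ℕ} {h : GL (Fin n) k}
    (hh : h ∈ (Matrix.GeneralLinearGroup.map (n := Fin n) k₀.subtype).range) :
    starGL h ∈ (Matrix.GeneralLinearGroup.map (n := Fin n) k₀.subtype).range := by
  have h1 := inv_mem hh
  rw [mem_range_map_subtype_iff] at *
  exact fun i j => h1 j i

lemma unipChar_eq_one_of_mem_range {ψ : AddChar k R} (hψ0 : ∀ x ∈ k₀, ψ x = 1) {n : ℕ}
    {u : GL (Fin n) k} (hu : u ∈ (Matrix.GeneralLinearGroup.map (n := Fin n) k₀.subtype).range) :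
    unipChar ψ u = 1 := by
  rw [mem_range_map_subtype_iff] at hu
  refine hψ0 _ (sum_mem fun i _ => ?_)
  split_ifs
  · exact hu _ _
  · exact zero_mem _

lemma antidiagGL_mem_range (n : ℕ) :
    antidiagGL k n ∈ (Matrix.GeneralLinearGroup.map (n := Fin n) k₀.subtype).range := by
  rw [mem_range_map_subtype_iff]
  intro i j
  rw [antidiagGL_apply]
  split_ifs
  · exact one_mem _
  · exact zero_mem _

end Galois

end Families

/-! ### No distinguished cuspidal representations for odd n ≥ 3 in the Levi case -/

section OddLevi

variable {k : Type uk} [Field k] {R : Type uR} [Field R]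
  {V : Type v} [AddCommGroup V] [Module R V] {m : ℕ}

/-- The signs `-1, -1, 1, -1, 1, …`. -/
def shiftedSign (k : Type uk) [Field k] (i : ℕ) : k := if i = 0 then -1 else (-1) ^ i

lemma shiftedSign_mul_self (i : ℕ) : shiftedSign k i * shiftedSign k i = 1 := by
  rw [shiftedSign]
  split_ifs
  · simp
  · rw [← mul_pow]
    simp

/-- The permutation fixing `0` and exchanging `2 i + 1` and `2 i + 2`. -/
def shiftPerm (hm : Even m) : Equiv.Perm (Fin (m + 1)) :=
  have hlt : ∀ i : Fin (m + 1), (if i.val = 0 then 0 else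
      if Even i.val then i.val - 1 else i.val + 1) < m + 1 := by
    intro i
    split_ifs with h1 h2
    · omega
    · omega
    · have : i.val ≠ m := by
        intro h
        rw [h] at h2
        exact h2 hm
      omega
  Function.Involutive.toPerm (fun i => ⟨_, hlt i⟩) (by
    intro i
    apply Fin.ext
    simp only
    rcases Nat.even_or_odd i.val with h | h
    · by_cases h0 : i.val = 0
      · simp [h0]
      · have h1 : i.val - 1 ≠ 0 := by
          intro h1
          have : i.val = 1 := by omega
          rw [this] at h
          simp at h
        have h2 : ¬ Even (i.val - 1) := by
          rw [Nat.even_sub (by omega)]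
          simp [h]
        simp only [h0, if_false, h, if_true, h1, h2]
        omega
    · have h0 : i.val ≠ 0 := by
        intro h0
        rw [h0] at h
        simp at h
      have h1 : ¬ Even i.val := Nat.not_even_iff_odd.2 h
      simp [h0, h1, h.add_one])

lemma neg_one_pow_shiftPerm (hm : Even m) (i : Fin (m + 1)) :
    (-1 : k) ^ ((shiftPerm hm i).val + 1) = shiftedSign k i := by
  change (-1 : k) ^ ((if i.val = 0 then 0 else if Even i.val then i.val - 1 else i.val + 1) + 1) = _
  rw [shiftedSign]
  split_ifs with h1 h2
  · simp
  · rw [Nat.sub_add_cancel (by omega)]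
  · rw [pow_succ, pow_succ]
    simp

/-- The matrix of a permutation. -/
def permGL {n : ℕ} (e : Equiv.Perm (Fin n)) : GL (Fin n) k where
  val := Matrix.of fun r c => if r = e c then 1 else 0
  inv := Matrix.of fun r c => if c = e r then 1 else 0
  val_inv := by
    ext r c
    rw [Matrix.mul_apply, Finset.sum_eq_single (e.symm r)]
    · simp [Matrix.one_apply, eq_comm]
    · intro b _ hb
      simp only [Matrix.of_apply]
      rw [if_neg, zero_mul]
      rintro rfl
      simp at hb
    · simp
  inv_val := by
    ext r c
    simp [Matrix.mul_apply, Matrix.one_apply, eq_comm]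

lemma permGL_mul_signDiag (hm : Even m) :
    permGL (shiftPerm hm) * signDiag (shiftedSign k) shiftedSign_mul_self (m + 1) =
      signGL k (m + 1) * permGL (shiftPerm hm) := by
  apply Units.ext
  ext r c
  rw [signGL_eq_signDiag]
  simp only [permGL, signDiag, Units.val_mul, Matrix.mul_diagonal, Matrix.diagonal_mul,
    Matrix.of_apply]
  split_ifs with h
  · rw [h, neg_one_pow_shiftPerm]
    ring
  · simp

/-- Cuspidal representations of `GL n`, with `n ≥ 3` odd, are not distinguished by
`GL ((n + 1) / 2) × GL ((n - 1) / 2)`. -/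
theorem not_isDistinguished_of_even [Finite k] [IsAlgClosed R] (hchar : ringChar R ≠ ringChar k)
    {ψ : AddChar k R} (hψ : ψ ≠ 1) {π : Representation R (GL (Fin (m + 1)) k) V}
    (hirr : π.IsIrreducible) (hπ : HasNoUnipotentForms π) (h2 : ringChar k ≠ 2) (hm : Even m)
    (hm1 : 1 ≤ m) : ¬ IsDistinguished (Subgroup.centralizer {signGL k (m + 1)}) π := by
  rintro ⟨μ, hμ0, hμ⟩
  obtain ⟨ξ, x₀, hK⟩ := exists_isKirillovPair hchar hψ hirr hπ
  set P : GL (Fin (m + 1)) k := permGL (shiftPerm hm) with hP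
  have hψ' : ψ⁻¹ ≠ 1 := inv_ne_one.2 hψ
  have halt : ∀ r, shiftedSign k (r + 1) ≠ shiftedSign k r ∨
      ∀ i ≤ r, shiftedSign k i = shiftedSign k (r + 1) := by
    intro r
    rcases Nat.eq_zero_or_pos r with rfl | hr
    · right
      intro i hi
      have : i = 0 := by omega
      subst this
      simp [shiftedSign]
    · left
      rw [shiftedSign, shiftedSign, if_neg (by omega), if_neg (by omega)]
      exact neg_one_pow_succ_ne h2 r
  have hfam := isMirabolicFamily_signDiag hψ' shiftedSign_mul_self halt
  -- The signs are permuted so that the first two agree; the form is transported to the conjugate of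
  -- H.
  have hinv : ∀ h ∈ Subgroup.centralizer {signDiag (shiftedSign k) shiftedSign_mul_self (m + 1)},
      ∀ x, (μ ∘ₗ π P) (π h x) = (μ ∘ₗ π P) x := by
    intro h hh x
    rw [Subgroup.mem_centralizer_singleton_iff] at hh
    have h1 : P * h * P⁻¹ ∈ Subgroup.centralizer {signGL k (m + 1)} := by
      rw [Subgroup.mem_centralizer_singleton_iff]
      have h3 : signGL k (m + 1) =
          P * signDiag (shiftedSign k) shiftedSign_mul_self (m + 1) * P⁻¹ := by
        rw [eq_mul_inv_iff_mul_eq, permGL_mul_signDiag]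
      rw [h3]
      simp only [mul_assoc, inv_mul_cancel_left]
      simp only [← mul_assoc]
      rw [mul_assoc P, hh, ← mul_assoc]
    have h4 : P * h = (P * h * P⁻¹) * P := by group
    rw [LinearMap.comp_apply, LinearMap.comp_apply, ← Module.End.mul_apply, ← map_mul, h4, map_mul,
      Module.End.mul_apply, hμ _ h1]
  -- The conjugate subgroup now contains the root group at (0, 1), on which ψ is not trivial: it
  -- fixes the form but multiplies x₀ by ψ(t).
  have hx₀ : (μ ∘ₗ π P) x₀ = 0 := by
    obtain ⟨t, ht⟩ := exists_addChar_ne_one hψ one_ne_zero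
    rw [one_mul] at ht
    have h01 : (⟨0, by omega⟩ : Fin (m + 1)) < ⟨1, by omega⟩ := by
      rw [Fin.lt_def]
      simp
    have h1 := hinv (elemGL h01 t) (by
      rw [mem_centralizer_signDiag]
      intro i j hij
      rw [elemGL_val, Matrix.add_apply, Matrix.one_apply_ne (by rintro rfl; exact hij rfl),
        zero_add, Matrix.single_apply_of_ne]
      rintro ⟨rfl, rfl⟩
      exact hij (by simp [shiftedSign])) x₀
    rw [hK.map_unipotent _ (elemGL_mem h01 t), map_smul, unipChar_elemGL, if_pos rfl,
      smul_eq_mul] at h1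
    by_contra hne
    exact ht (mul_right_cancel₀ hne (h1.trans (one_mul _).symm))
  have h0 := hK.eq_zero_of_invariant hchar hfam (fun a ha x => hinv _ (hfam.diagOne_mem _ a ha) x)
    (fun y hy x => hinv _ hy x) hx₀
  apply hμ0
  ext x
  have h1 := LinearMap.congr_fun h0 (π P⁻¹ x)
  rw [LinearMap.comp_apply, ← Module.End.mul_apply, ← map_mul, mul_inv_cancel, map_one] at h1
  exact h1

end OddLevi

/-! ### Sums over cosets -/

section CosetSum

variable {G : Type*} [Group G] [Fintype G] {R : Type uR} [Field R]

/-- Summation over a group along the right cosets of a subgroup. -/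
lemma sum_eq_sum_quotient (S : Subgroup G) [Fintype S] [Fintype (Quotient (QuotientGroup.rightRel S))]
    (F : G → R) :
    ∑ g, F g = ∑ q : Quotient (QuotientGroup.rightRel S), ∑ s : S, F (s * q.out) := by
  rw [← Fintype.sum_prod_type']
  have hq : ∀ (q : Quotient (QuotientGroup.rightRel S)) (s : S),
      (Quotient.mk (QuotientGroup.rightRel S) (s * q.out)) = q := by
    intro q s
    conv => rhs; rw [← q.out_eq]
    refine Quotient.sound ?_
    change QuotientGroup.rightRel S _ _
    rw [QuotientGroup.rightRel_apply, _root_.mul_inv_rev, mul_inv_cancel_left]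
    exact inv_mem s.2
  refine (Fintype.sum_bijective (fun p : Quotient (QuotientGroup.rightRel S) × S =>
    (p.2 : G) * p.1.out) ⟨?_, ?_⟩ _ _ fun _ => rfl).symm
  · rintro ⟨q, s⟩ ⟨q', s'⟩ h
    simp only at h
    have h1 : q = q' := by rw [← hq q s, ← hq q' s', h]
    subst h1
    rw [mul_left_inj] at h
    rw [Subtype.ext h]
  · intro g
    let q := Quotient.mk (QuotientGroup.rightRel S) g
    have h1 : QuotientGroup.rightRel S q.out g := Quotient.exact q.out_eq
    rw [QuotientGroup.rightRel_apply] at h1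
    exact ⟨(q, ⟨_, h1⟩), by simp⟩

/-- Replaces a sum over chosen representatives by a sum over the group; for unipotent S the factor
is invertible in R. -/
lemma card_mul_cosetSum (S : Subgroup G) (F : G → R) (hF : ∀ s ∈ S, ∀ g, F (s * g) = F g) :
    (Nat.card S : R) * cosetSum S F = ∑ g, F g := by
  classical
  have : Fintype S := Fintype.ofFinite _
  have : Fintype (Quotient (QuotientGroup.rightRel S)) := Fintype.ofFinite _
  rw [sum_eq_sum_quotient S F, cosetSum, finsum_eq_sum_of_fintype, Finset.mul_sum]
  refine Finset.sum_congr rfl fun q _ => ?_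
  rw [Finset.sum_congr rfl fun (s : S) _ => hF s s.2 q.out, Finset.sum_const, Finset.card_univ,
    nsmul_eq_mul, Nat.card_eq_fintype_card]

end CosetSum

/-! ### The twist by g ↦ g^* and Whittaker functions -/

section StarRepresentation

variable {k : Type uk} [Field k] {R : Type uR} [Field R] {n : ℕ}
  {V : Type v} [AddCommGroup V] [Module R V]

/-- The twist of a representation by `g ↦ g^*`. -/
def starRep (π : Representation R (GL (Fin n) k) V) : Representation R (GL (Fin n) k) V where
  toFun g := π (starGL g)
  map_one' := by rw [starGL_one, map_one]
  map_mul' g h := by rw [starGL_mul, map_mul]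

lemma starRep_apply (π : Representation R (GL (Fin n) k) V) (g : GL (Fin n) k) :
    starRep π g = π (starGL g) := rfl

lemma isIrreducible_starRep {π : Representation R (GL (Fin n) k) V} (hπ : π.IsIrreducible) :
    (starRep π).IsIrreducible := by
  obtain ⟨x, hx⟩ := exists_ne_zero_of_irreducible hπ
  have : Nontrivial (Subrepresentation (starRep π)) :=
    ⟨⟨⊥, ⊤, fun h => hx (by
      have h1 : x ∈ (⊤ : Subrepresentation (starRep π)).toSubmodule := Submodule.mem_top
      rw [← h] at h1
      exact h1)⟩⟩
  refine ⟨fun S => ?_⟩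
  let T : Subrepresentation π :=
    { toSubmodule := S.toSubmodule
      apply_mem_toSubmodule := fun g y hy => by
        have := S.apply_mem_toSubmodule (starGL g) hy
        rwa [starRep_apply, starGL_starGL] at this }
  rcases hπ.eq_bot_or_eq_top T with h | h
  · exact Or.inl (Subrepresentation.toSubmodule_injective
      (show T.toSubmodule = (⊥ : Subrepresentation π).toSubmodule by rw [h]))
  · exact Or.inr (Subrepresentation.toSubmodule_injective
      (show T.toSubmodule = (⊤ : Subrepresentation π).toSubmodule by rw [h]))

lemma exists_eq_blockUpper {a b : ℕ} (h : a + b = n) {g : GL (Fin n) k}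
    (hg : ∀ i c : Fin n, (a ≤ i.val ∨ c.val < a) →
      g.val i c = (1 : Matrix (Fin n) (Fin n) k) i c) :
    ∃ B, g = blockUpper h 1 B 1 := by
  subst h
  refine ⟨Matrix.of fun i j => g.val (Fin.castAdd b i) (Fin.natAdd a j), Units.ext ?_⟩
  ext i c
  by_cases hic : a ≤ i.val ∨ c.val < a
  · rw [hg i c hic, blockUpper_one_one_apply _ _ _ _ hic]
  · rw [blockUpper_val, Matrix.reindex_apply, Matrix.submatrix_apply]
    push Not at hic
    obtain ⟨i, rfl⟩ : ∃ i', i = Fin.castAdd b i' := ⟨⟨i.val, hic.1⟩, rfl⟩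
    obtain ⟨c, rfl⟩ : ∃ c', c = Fin.natAdd a c' :=
      ⟨⟨c.val - a, by omega⟩, Fin.ext (by simp; omega)⟩
    simp

/-- The map g ↦ w g^* w carries the unipotent radical of type (b, a) to that of type (a, b), so
composing with π(w) exchanges the two invariance conditions. -/
lemma HasNoUnipotentForms.starRep {π : Representation R (GL (Fin n) k) V}
    (hπ : HasNoUnipotentForms π) : HasNoUnipotentForms (starRep π) := by
  intro a b h ha hb lam hlam
  have h0 : lam ∘ₗ π (antidiagGL k n) = 0 := by
    refine hπ b a (by omega) hb ha _ fun B x => ?_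
    set p : GL (Fin n) k := blockUpper (show b + a = n by omega) 1 B 1 with hp
    have hinv : p⁻¹ = blockUpper (show b + a = n by omega) 1 (-B) 1 := by
      rw [inv_eq_iff_mul_eq_one, hp, blockUpper_mul]
      simp [blockUpper_one]
    obtain ⟨B', hB'⟩ := exists_eq_blockUpper h (g := antiTranspose p⁻¹) (fun i c hic => by
      rw [antiTranspose_apply, hinv, blockUpper_one_one_apply]
      · rw [Matrix.one_apply, Matrix.one_apply]
        congr 1
        rw [Fin.rev_inj]
        exact propext eq_comm
      · rw [Fin.val_rev, Fin.val_rev]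
        omega)
    have h1 : antidiagGL k n * p = starGL (antiTranspose p⁻¹) * antidiagGL k n := by
      rw [antiTranspose, starGL_inv, inv_inv, starGL_mul, starGL_mul, starGL_antidiagGL,
        starGL_starGL, mul_assoc _ (antidiagGL k n) (antidiagGL k n),
        antidiagGL_mul_self, mul_one]
    rw [LinearMap.comp_apply, LinearMap.comp_apply, ← Module.End.mul_apply, ← map_mul, h1, map_mul,
      Module.End.mul_apply, hB']
    exact hlam B' _
  ext x
  have h1 := LinearMap.congr_fun h0 (π (antidiagGL k n) x)
  rw [LinearMap.comp_apply, ← Module.End.mul_apply, ← map_mul, antidiagGL_mul_self, map_one] at h1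
  exact h1

lemma comp_antidiagGL_mem {ψ : AddChar k R} {π : Representation R (GL (Fin n) k) V}
    {ξ : Module.Dual R V} (hξ : ξ ∈ whittakerFunctionals ψ π) :
    ξ ∘ₗ π (antidiagGL k n) ∈ whittakerFunctionals ψ⁻¹ (starRep π) := by
  intro u hu x
  have h1 : antidiagGL k n * starGL u =
      antidiagGL k n * starGL u * antidiagGL k n * antidiagGL k n := by
    rw [mul_assoc _ (antidiagGL k n) (antidiagGL k n), antidiagGL_mul_self, mul_one]
  rw [LinearMap.comp_apply, LinearMap.comp_apply, starRep_apply, ← Module.End.mul_apply, ← map_mul,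
    h1, map_mul, Module.End.mul_apply, hξ _ (antidiag_conj_starGL_mem hu),
    unipChar_antidiag_conj_starGL ψ hu]

/-- This identifies W~ with a Whittaker function of the twisted representation, attached to the same
vector x; results on Λ thereby apply to Λ^*. -/
lemma tilde_whittaker (π : Representation R (GL (Fin n) k) V) (ξ : Module.Dual R V) (x : V) :
    tilde (fun g => ξ (π g x)) = fun g => (ξ ∘ₗ π (antidiagGL k n)) (starRep π g x) := by
  funext g
  rw [tilde, map_mul]
  rfl

end StarRepresentation

section WhittakerFunctions

variable {k : Type uk} [Field k] {R : Type uR} [Field R] {n : ℕ}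

/-- `W` is `(N, ψ)`-equivariant on the left. -/
def IsWhittakerFunction (ψ : AddChar k R) (W : GL (Fin n) k → R) : Prop :=
  ∀ u ∈ unipotent k n, ∀ g, W (u * g) = unipChar ψ u * W g

lemma isWhittakerFunction_of_mem {ψ : AddChar k R} {V : Type*} [AddCommGroup V] [Module R V]
    {π : Representation R (GL (Fin n) k) V} {ξ : Module.Dual R V}
    (hξ : ξ ∈ whittakerFunctionals ψ π) (x : V) : IsWhittakerFunction ψ fun g => ξ (π g x) := by
  intro u hu g
  simp only [map_mul, Module.End.mul_apply]
  exact hξ u hu _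

lemma IsWhittakerFunction.tilde {ψ : AddChar k R} {W : GL (Fin n) k → R}
    (hW : IsWhittakerFunction ψ W) : IsWhittakerFunction ψ⁻¹ (tilde W) := by
  intro u hu g
  have h1 : antidiagGL k n * starGL (u * g) =
      antidiagGL k n * starGL u * antidiagGL k n * (antidiagGL k n * starGL g) := by
    rw [← mul_assoc, mul_assoc _ (antidiagGL k n) (antidiagGL k n), antidiagGL_mul_self, mul_one,
      starGL_mul, mul_assoc]
  rw [FiniteGL.tilde, h1, hW _ (antidiag_conj_starGL_mem hu), unipChar_antidiag_conj_starGL ψ hu]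
  rfl

lemma IsWhittakerFunction.diagOne {m : ℕ} {ψ : AddChar k R} {W : GL (Fin (m + 1)) k → R}
    (hW : IsWhittakerFunction ψ W) : IsWhittakerFunction ψ fun g => W (diagOne g) := by
  intro u hu g
  simp only
  rw [diagOne_mul, hW _ (diagOne_mem_unipotent.2 hu), unipChar_diagOne]

lemma rankinSelbergSum_eq [Finite k] (hchar : ringChar R ≠ ringChar k) {m : ℕ} {ψ : AddChar k R}
    {W : GL (Fin (m + 1)) k → R} {W' : GL (Fin m) k → R} (hW : IsWhittakerFunction ψ W)
    (hW' : IsWhittakerFunction ψ⁻¹ W') : rankinSelbergSum W W' =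
      (Nat.card (unipotent k m) : R)⁻¹ * ∑ g, W (diagOne g) * W' g := by
  rw [eq_inv_mul_iff_mul_eq₀ (card_unipotent_ne_zero hchar m), rankinSelbergSum]
  refine card_mul_cosetSum _ _ fun u hu g => ?_
  rw [diagOne_mul, hW _ (diagOne_mem_unipotent.2 hu), unipChar_diagOne, hW' u hu, unipChar_inv_char, mul_mul_mul_comm,
    mul_inv_cancel₀ (unipChar_ne_zero ψ u), one_mul]

/-- Against a (N, ψ)-equivariant function the projector may be dropped: translating by u in each
term cancels the character. -/
lemma sum_mul_whittakerProj [Finite k] (hchar : ringChar R ≠ ringChar k) {ψ : AddChar k R}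
    {F : GL (Fin n) k → R} (hF : IsWhittakerFunction ψ F) (f : GL (Fin n) k → R) :
    ∑ g, F g * whittakerProj ψ⁻¹ f g = ∑ g, F g * f g := by
  have h1 : ∀ u : unipotent k n, ∑ g, F g * (unipChar ψ (u : GL (Fin n) k) * f (u * g)) =
      ∑ g, F g * f g := by
    intro u
    refine Fintype.sum_equiv (Equiv.mulLeft (u : GL (Fin n) k)) _ _ fun g => ?_
    rw [Equiv.coe_mulLeft, hF u u.2]
    ring
  have h2 : ∀ g, F g * whittakerProj ψ⁻¹ f g = (Nat.card (unipotent k n) : R)⁻¹ *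
      ∑ u : unipotent k n, F g * (unipChar ψ (u : GL (Fin n) k) * f (u * g)) := by
    intro g
    rw [whittakerProj, finsum_eq_sum_of_fintype, inv_inv, ← Finset.mul_sum]
    ring
  simp only [h2]
  rw [← Finset.mul_sum, Finset.sum_comm, Finset.sum_congr rfl fun u _ => h1 u, Finset.sum_const,
    Finset.card_univ, nsmul_eq_mul, ← Nat.card_eq_fintype_card,
    inv_mul_cancel_left₀ (card_unipotent_ne_zero hchar n)]

end WhittakerFunctions

/-! ### The forms Λ and Λ^* on the space of π -/

section Admissible

variable {k : Type uk} [Field k] {R : Type uR} [Field R] {m : ℕ}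

/-- The properties of the subgroups `H` common to the two cases. -/
structure IsAdmissibleFamily (ψ : AddChar k R) (H : (r : ℕ) → Subgroup (GL (Fin r) k)) (m : ℕ) :
    Prop where
  mirabolic : IsMirabolicFamily ψ H
  mirabolic_inv : IsMirabolicFamily ψ⁻¹ H
  starGL_mem : ∀ r, ∀ h ∈ H r, starGL h ∈ H r
  unipChar_eq_one : ∀ r, ∀ u ∈ H r, unipChar ψ u = 1
  antidiagGL_mem : antidiagGL k m ∈ H m
  neg_one_mem : -1 ∈ H m

lemma IsAdmissibleFamily.inv {ψ : AddChar k R} {H : (r : ℕ) → Subgroup (GL (Fin r) k)}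
    (h : IsAdmissibleFamily ψ H m) : IsAdmissibleFamily ψ⁻¹ H m where
  mirabolic := h.mirabolic_inv
  mirabolic_inv := by
    rw [inv_inv]
    exact h.mirabolic
  starGL_mem := h.starGL_mem
  unipChar_eq_one r u hu := by rw [unipChar_inv_char, h.unipChar_eq_one r u hu, inv_one]
  antidiagGL_mem := h.antidiagGL_mem
  neg_one_mem := h.neg_one_mem

end Admissible

section Forms

variable {k : Type uk} [Field k] [Finite k] {R : Type uR} [Field R] {m : ℕ}
  {V : Type v} [AddCommGroup V] [Module R V]

/-- The linear form on `π` corresponding to `Λ` on the Whittaker model. -/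
def lambdaForm (H : Subgroup (GL (Fin m) k)) (π : Representation R (GL (Fin (m + 1)) k) V)
    (ξ : Module.Dual R V) : Module.Dual R V :=
  (Nat.card ((unipotent k m).subgroupOf H) : R)⁻¹ •
    ∑ h : H, ξ ∘ₗ π (diagOne (h : GL (Fin m) k))

lemma lambdaForm_apply (H : Subgroup (GL (Fin m) k))
    (π : Representation R (GL (Fin (m + 1)) k) V) (ξ : Module.Dual R V) (x : V) :
    lambdaForm H π ξ x = (Nat.card ((unipotent k m).subgroupOf H) : R)⁻¹ *
      ∑ h : H, ξ (π (diagOne (h : GL (Fin m) k)) x) := by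
  simp [lambdaForm, LinearMap.sum_apply]

lemma lambdaForm_smul (H : Subgroup (GL (Fin m) k))
    (π : Representation R (GL (Fin (m + 1)) k) V) (c : R) (ξ : Module.Dual R V) :
    lambdaForm H π (c • ξ) = c • lambdaForm H π ξ := by
  ext x
  simp only [lambdaForm_apply, LinearMap.smul_apply, smul_eq_mul, ← Finset.mul_sum]
  ring

lemma formΛ_eq (hchar : ringChar R ≠ ringChar k) {ψ : AddChar k R} {H : Subgroup (GL (Fin m) k)}
    (hH : ∀ u ∈ H, unipChar ψ u = 1) {π : Representation R (GL (Fin (m + 1)) k) V}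
    {ξ : Module.Dual R V} (hξ : ξ ∈ whittakerFunctionals ψ π) (x : V) :
    formΛ H (fun g => ξ (π g x)) = lambdaForm H π ξ x := by
  rw [lambdaForm_apply, eq_inv_mul_iff_mul_eq₀ (card_unipotent_subgroupOf_ne_zero hchar H), formΛ]
  refine card_mul_cosetSum _ _ fun u hu g => ?_
  have h1 := (isWhittakerFunction_of_mem hξ x).diagOne u hu g
  rw [hH _ u.2, one_mul] at h1
  exact h1

lemma lambdaForm_apply_diagOne (H : Subgroup (GL (Fin m) k))
    (π : Representation R (GL (Fin (m + 1)) k) V) (ξ : Module.Dual R V) {a : GL (Fin m) k}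
    (ha : a ∈ H) (x : V) : lambdaForm H π ξ (π (diagOne a) x) = lambdaForm H π ξ x := by
  rw [lambdaForm_apply, lambdaForm_apply]
  congr 1
  refine Fintype.sum_equiv (Equiv.mulRight (⟨a, ha⟩ : H)) _ _ fun h => ?_
  rw [Equiv.coe_mulRight, Subgroup.coe_mul, diagOne_mul, map_mul, Module.End.mul_apply]

variable {ψ : AddChar k R} {H : (r : ℕ) → Subgroup (GL (Fin r) k)}
  {π : Representation R (GL (Fin (m + 1)) k) V} {ξ : Module.Dual R V} {x₀ : V}

/-- Moved to the left of diag(a, 1), the column stays in N ∩ H, where ψ is trivial. -/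
lemma IsAdmissibleFamily.lambdaForm_apply_colGL (h : IsAdmissibleFamily ψ H m)
    (hξ : ξ ∈ whittakerFunctionals ψ π) {y : Fin m → k} (hy : colGL y ∈ H (m + 1)) (x : V) :
    lambdaForm (H m) π ξ (π (colGL y) x) = lambdaForm (H m) π ξ x := by
  rw [lambdaForm_apply, lambdaForm_apply]
  congr 1
  refine Finset.sum_congr rfl fun a _ => ?_
  have h1 : colGL ((a : GL (Fin m) k).val *ᵥ y) ∈ H (m + 1) := by
    rw [← mul_inv_eq_iff_eq_mul.2 (diagOne_mul_colGL (a : GL (Fin m) k) y)]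
    have := h.mirabolic.diagOne_mem m a a.2
    exact mul_mem (mul_mem this hy) (inv_mem this)
  rw [← Module.End.mul_apply, ← map_mul, diagOne_mul_colGL, map_mul, Module.End.mul_apply,
    hξ _ (colGL_mem_unipotent _), h.unipChar_eq_one _ _ h1, one_mul]

lemma IsAdmissibleFamily.lambdaForm_apply_self (hchar : ringChar R ≠ ringChar k)
    (h : IsAdmissibleFamily ψ H m) (hK : IsKirillovPair ψ π ξ x₀) :
    lambdaForm (H m) π ξ x₀ = 1 := by
  classical
  rw [lambdaForm_apply, inv_mul_eq_one₀ (card_unipotent_subgroupOf_ne_zero hchar (H m))]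
  have h1 : ∀ a : H m, ξ (π (diagOne (a : GL (Fin m) k)) x₀) =
      if a ∈ (unipotent k m).subgroupOf (H m) then 1 else 0 := by
    intro a
    split_ifs with ha
    · exact (hK.apply_unipotent _ ha).trans (h.unipChar_eq_one _ _ a.2)
    · exact hK.apply_of_notMem _ ha
  simp only [h1]
  rw [← Finset.sum_filter, Finset.sum_const, nsmul_eq_mul, mul_one, Nat.card_eq_fintype_card,
    ← Fintype.card_subtype]

/-- Linear forms invariant under the mirabolic part of `H` are multiples of `Λ`. -/
lemma IsAdmissibleFamily.eq_smul_lambdaForm (hchar : ringChar R ≠ ringChar k)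
    (h : IsAdmissibleFamily ψ H m) (hK : IsKirillovPair ψ π ξ x₀) {μ : Module.Dual R V}
    (h1 : ∀ a ∈ H m, ∀ x, μ (π (diagOne a) x) = μ x)
    (h2 : ∀ y, colGL y ∈ H (m + 1) → ∀ x, μ (π (colGL y) x) = μ x) :
    μ = μ x₀ • lambdaForm (H m) π ξ := by
  rw [← sub_eq_zero]
  refine hK.eq_zero_of_invariant hchar h.mirabolic_inv (fun a ha x => ?_) (fun y hy x => ?_) ?_
  · simp only [LinearMap.sub_apply, LinearMap.smul_apply]
    rw [h1 a ha, lambdaForm_apply_diagOne _ _ _ ha]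
  · simp only [LinearMap.sub_apply, LinearMap.smul_apply]
    rw [h2 y hy, h.lambdaForm_apply_colGL hK.mem hy]
  · simp only [LinearMap.sub_apply, LinearMap.smul_apply]
    rw [h.lambdaForm_apply_self hchar hK, smul_eq_mul, mul_one, sub_self]

/-- An H-invariant form is a non-zero multiple of Λ, by uniqueness under the mirabolic part alone;
the full invariance therefore passes to Λ. -/
lemma IsAdmissibleFamily.lambdaForm_invariant (hchar : ringChar R ≠ ringChar k)
    (h : IsAdmissibleFamily ψ H m) (hK : IsKirillovPair ψ π ξ x₀)
    (hdist : IsDistinguished (H (m + 1)) π) :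
    ∀ a ∈ H (m + 1), ∀ x, lambdaForm (H m) π ξ (π a x) = lambdaForm (H m) π ξ x := by
  obtain ⟨μ, hμ0, hμ⟩ := hdist
  have h1 := h.eq_smul_lambdaForm hchar hK (μ := μ)
    (fun a ha x => hμ _ (h.mirabolic.diagOne_mem m a ha) x) (fun y hy x => hμ _ hy x)
  have h2 : μ x₀ ≠ 0 := fun h2 => hμ0 (by rw [h1, h2, zero_smul])
  intro a ha x
  have h3 := hμ a ha x
  rw [h1] at h3
  simp only [LinearMap.smul_apply, smul_eq_mul] at h3
  exact mul_left_cancel₀ h2 h3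

/-- The form `Λ^*` is a non-zero multiple of `Λ`. -/
theorem IsAdmissibleFamily.exists_ratio [IsAlgClosed R] (hchar : ringChar R ≠ ringChar k)
    (hψ : ψ ≠ 1) (h : IsAdmissibleFamily ψ H m) (hirr : π.IsIrreducible)
    (hπ : HasNoUnipotentForms π) (hK : IsKirillovPair ψ π ξ x₀)
    (hdist : IsDistinguished (H (m + 1)) π) :
    ∃ c : R, c ≠ 0 ∧ lambdaForm (H m) (starRep π) (ξ ∘ₗ π (antidiagGL k (m + 1))) =
      c • lambdaForm (H m) π ξ := by
  obtain ⟨ξ', x₀', hK'⟩ := exists_isKirillovPair hchar (inv_ne_one.2 hψ)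
    (isIrreducible_starRep hirr) hπ.starRep
  -- The functional ξ ∘ π(w) is a Whittaker functional of the twist for ψ⁻¹, hence a non-zero
  -- multiple of the normalized one.
  obtain ⟨c₀, hc₀⟩ := hK'.exists_smul _ (comp_antidiagGL_mem hK.mem)
  have hc₀0 : c₀ ≠ 0 := by
    rintro rfl
    rw [zero_smul] at hc₀
    have h1 := LinearMap.congr_fun hc₀ (π (antidiagGL k (m + 1)) x₀)
    rw [LinearMap.comp_apply, ← Module.End.mul_apply, ← map_mul, antidiagGL_mul_self, ← diagOne_one,
      hK.apply_unipotent 1 (one_mem _), unipChar_one] at h1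
    exact one_ne_zero h1
  -- The same form works, since H is stable under g ↦ g^*.
  have hdist' : IsDistinguished (H (m + 1)) (starRep π) := by
    obtain ⟨μ, hμ0, hμ⟩ := hdist
    exact ⟨μ, hμ0, fun a ha x => hμ _ (h.starGL_mem _ a ha) x⟩
  set ν := lambdaForm (H m) (starRep π) (ξ ∘ₗ π (antidiagGL k (m + 1))) with hν
  have hν1 : ν = c₀ • lambdaForm (H m) (starRep π) ξ' := by rw [hν, hc₀, lambdaForm_smul]
  have hν2 : ν x₀' ≠ 0 := by
    rw [hν1, LinearMap.smul_apply, h.inv.lambdaForm_apply_self hchar hK', smul_eq_mul, mul_one]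
    exact hc₀0
  have hinv : ∀ a ∈ H (m + 1), ∀ x, ν (π a x) = ν x := by
    intro a ha x
    have h1 := h.inv.lambdaForm_invariant hchar hK' hdist' _ (h.starGL_mem _ a ha) x
    rw [starRep_apply, starGL_starGL] at h1
    rw [hν1, LinearMap.smul_apply, LinearMap.smul_apply, h1]
  have h2 := h.eq_smul_lambdaForm hchar hK (μ := ν)
    (fun a ha x => hinv _ (h.mirabolic.diagOne_mem m a ha) x) (fun y hy x => hinv _ hy x)
  exact ⟨ν x₀, fun h0 => hν2 (by rw [h2, h0, zero_smul]; rfl), h2⟩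

/-- Distinction is needed only for w_m in the Levi case: it forces n = m + 1 to be even, so that m
is odd. -/
theorem isAdmissibleFamily_of_case [IsAlgClosed R] (hchar : ringChar R ≠ ringChar k) (hψ : ψ ≠ 1)
    (hH : IsGaloisCase ψ H ∨ IsLeviCase H) (hm : 1 ≤ m) (hirr : π.IsIrreducible)
    (hπ : HasNoUnipotentForms π) (hdist : IsDistinguished (H (m + 1)) π) :
    IsAdmissibleFamily ψ H m := by
  have hψ' : ψ⁻¹ ≠ 1 := inv_ne_one.2 hψ
  rcases hH with ⟨k₀, hfin, hψ0, hH⟩ | ⟨h2, hH⟩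
  · obtain rfl : H = fun r => (Matrix.GeneralLinearGroup.map (n := Fin r) k₀.subtype).range :=
      funext hH
    refine ⟨isMirabolicFamily_galois hfin hψ hψ0, isMirabolicFamily_galois hfin hψ' fun x hx => ?_,
      fun r u hu => starGL_mem_range hu, fun r u hu => unipChar_eq_one_of_mem_range hψ0 hu,
      antidiagGL_mem_range m, ?_⟩
    · rw [AddChar.inv_apply, hψ0 _ (neg_mem hx)]
    · rw [mem_range_map_subtype_iff]
      intro i j
      rw [Units.val_neg, Units.val_one, Matrix.neg_apply, Matrix.one_apply]
      split_ifs
      · exact neg_mem (one_mem _)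
      · exact neg_mem (zero_mem _)
  · obtain rfl : H = fun r => Subgroup.centralizer {signGL k r} := funext hH
    have hodd : Odd m := by
      rw [← Nat.not_even_iff_odd]
      intro hm2
      exact not_isDistinguished_of_even hchar hψ hirr hπ h2 hm2 hm hdist
    refine ⟨isMirabolicFamily_signGL hψ h2, isMirabolicFamily_signGL hψ' h2,
      fun r u hu => starGL_mem_centralizer hu,
      fun r u hu => unipChar_eq_one_of_mem_centralizer h2 ψ hu,
      antidiagGL_mem_centralizer hodd, ?_⟩
    rw [Subgroup.mem_centralizer_singleton_iff]
    simp

end Forms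

/-! ### Exchanging ψ and ψ⁻¹ -/

section ChangeOfCharacter

variable {k : Type uk} [Field k] {R : Type uR} [Field R] {n : ℕ}
  {V : Type v} [AddCommGroup V] [Module R V]

lemma signGL_mul_self (n : ℕ) : signGL k n * signGL k n = 1 :=
  Units.ext (signGL k n).mul_inv

lemma signGL_conj_apply (u : GL (Fin n) k) (i j : Fin n) :
    (signGL k n * u * signGL k n).val i j =
      (-1) ^ (i.val + 1) * u.val i j * (-1) ^ (j.val + 1) := by
  simp only [signGL, Units.val_mul, Matrix.mul_diagonal, Matrix.diagonal_mul]

lemma signGL_conj_mem {u : GL (Fin n) k} (hu : u ∈ unipotent k n) :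
    signGL k n * u * signGL k n ∈ unipotent k n := by
  rw [mem_unipotent_iff] at *
  refine ⟨fun i j hij => ?_, fun i => ?_⟩
  · rw [signGL_conj_apply, hu.1 i j hij]
    simp
  · rw [signGL_conj_apply, hu.2, mul_one, neg_one_pow_mul_self]

lemma unipChar_signGL_conj (ψ : AddChar k R) (u : GL (Fin n) k) :
    unipChar ψ (signGL k n * u * signGL k n) = unipChar ψ⁻¹ u := by
  rw [unipChar, unipChar, AddChar.inv_apply, ← Finset.sum_neg_distrib]
  congr 1
  refine Finset.sum_congr rfl fun i _ => ?_
  split_ifs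
  · rw [signGL_conj_apply]
    have := neg_one_pow_mul_self (k := k) i.val
    rw [pow_succ (-1 : k) (i.val + 1)]
    linear_combination (-u.val i _) * this
  · simp

/-- Conjugation by the alternating signs negates the superdiagonal. Since π' is assumed of Whittaker
type for ψ, this supplies its functional for ψ⁻¹. -/
lemma comp_signGL_mem {ψ : AddChar k R} {π : Representation R (GL (Fin n) k) V}
    {ξ : Module.Dual R V} (hξ : ξ ∈ whittakerFunctionals ψ π) :
    ξ ∘ₗ π (signGL k n) ∈ whittakerFunctionals ψ⁻¹ π := by
  intro u hu x
  have h1 : signGL k n * u = signGL k n * u * signGL k n * signGL k n := by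
    rw [mul_assoc _ (signGL k n) (signGL k n), signGL_mul_self, mul_one]
  rw [LinearMap.comp_apply, LinearMap.comp_apply, ← Module.End.mul_apply, ← map_mul,
    h1, map_mul, Module.End.mul_apply, hξ _ (signGL_conj_mem hu), unipChar_signGL_conj]

lemma finrank_submodule_eq_one_iff {M : Type*} [AddCommGroup M] [Module R M]
    (S : Submodule R M) : Module.finrank R S = 1 ↔ ∃ ξ : S, ξ ≠ 0 ∧ ∀ η : S, ∃ c : R, c • ξ = η :=
  finrank_eq_one_iff'

lemma IsWhittakerType.exists_generator {ψ : AddChar k R} {π : Representation R (GL (Fin n) k) V}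
    (hπ : IsWhittakerType ψ π) : ∃ ξ ∈ whittakerFunctionals ψ π, ξ ≠ 0 ∧
      ∀ η ∈ whittakerFunctionals ψ π, ∃ c : R, η = c • ξ := by
  obtain ⟨ξ, hξ0, hξ⟩ : ∃ ξ : whittakerFunctionals ψ π, ξ ≠ 0 ∧
      ∀ η : whittakerFunctionals ψ π, ∃ c : R, c • ξ = η := 
    (finrank_submodule_eq_one_iff (whittakerFunctionals ψ π)).1 hπ
  refine ⟨ξ, ξ.2, fun h => hξ0 (Subtype.ext h), fun η hη => ?_⟩
  obtain ⟨c, hc⟩ := hξ ⟨η, hη⟩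
  exact ⟨c, (congrArg Subtype.val hc).symm⟩

lemma exists_smul_comp_signGL {ψ : AddChar k R} {π : Representation R (GL (Fin n) k) V}
    {ξ : Module.Dual R V} (hξ : ∀ η ∈ whittakerFunctionals ψ π, ∃ c : R, η = c • ξ) :
    ∀ η ∈ whittakerFunctionals ψ⁻¹ π, ∃ c : R, η = c • (ξ ∘ₗ π (signGL k n)) := by
  intro η hη
  have h1 := comp_signGL_mem hη
  rw [inv_inv] at h1
  obtain ⟨c, hc⟩ := hξ _ h1
  refine ⟨c, ?_⟩
  rw [← LinearMap.smul_comp, ← hc, LinearMap.comp_assoc, ← Module.End.mul_eq_comp, ← map_mul,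
    signGL_mul_self, map_one]
  rfl

lemma neg_one_mul_comm_GL (g : GL (Fin n) k) : -1 * g = g * -1 := by simp

lemma comp_neg_one_mem {ψ : AddChar k R} {π : Representation R (GL (Fin n) k) V}
    {ξ : Module.Dual R V} (hξ : ξ ∈ whittakerFunctionals ψ π) :
    ξ ∘ₗ π (-1) ∈ whittakerFunctionals ψ π := by
  intro u hu x
  rw [LinearMap.comp_apply, LinearMap.comp_apply, ← Module.End.mul_apply, ← map_mul,
    neg_one_mul_comm_GL, map_mul, Module.End.mul_apply, hξ u hu]

end ChangeOfCharacter

/-! ### The central character of the generic subquotient -/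

section GenericSubquotient

variable {k : Type uk} [Field k] [Finite k] {R : Type uR} [Field R] {n : ℕ}
  {V : Type v} [AddCommGroup V] [Module R V] {ψ : AddChar k R}
  {π : Representation R (GL (Fin n) k) V}

lemma coe_whittakerAvg_toRepresentation (T : Subrepresentation π) (x : T.toSubmodule) :
    (whittakerAvg ψ T.toRepresentation x : V) = whittakerAvg ψ π x := by
  rw [whittakerAvg_apply, whittakerAvg_apply, Submodule.coe_smul, Submodule.coe_sum]
  rfl

lemma map_whittakerAvg_of_intertwining {W : Type w} [AddCommGroup W] [Module R W]
    {τ : Representation R (GL (Fin n) k) W} (f : V →ₗ[R] W) (hf : ∀ g x, f (π g x) = τ g (f x))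
    (x : V) : f (whittakerAvg ψ π x) = whittakerAvg ψ τ (f x) := by
  rw [whittakerAvg_apply, whittakerAvg_apply, map_smul, map_sum]
  congr 1
  exact Finset.sum_congr rfl fun u _ => by rw [map_smul, hf]

/-- The value at `-1` of the central character of a generic subquotient can be read off the
Whittaker functionals. -/
lemma IsGenericSignValue.comp_neg_one (hchar : ringChar R ≠ ringChar k) {s : R}
    (hs : IsGenericSignValue ψ π s) {ξ : Module.Dual R V}
    (hspan : ∀ η ∈ whittakerFunctionals ψ π, ∃ c : R, η = c • ξ) {s' : R}
    (hs' : ξ ∘ₗ π (-1) = s' • ξ) : s = s' := by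
  obtain ⟨W, _, _, τ, ⟨-, hτ⟩, ⟨T, f, hf⟩, hsτ⟩ := hs
  obtain ⟨η, hη, hη0, -⟩ := IsWhittakerType.exists_generator hτ
  obtain ⟨ext, hext⟩ := LinearMap.exists_extend (p := T.toSubmodule) (η ∘ₗ f.toLinearMap)
  have hηf : η ∘ₗ f.toLinearMap ∈ whittakerFunctionals ψ T.toRepresentation := by
    intro u hu x
    rw [LinearMap.comp_apply, LinearMap.comp_apply, Representation.IntertwiningMap.toLinearMap_apply,
      f.isIntertwining, hη u hu]
    rfl
  have hζ : ∀ x : T.toSubmodule, (ext ∘ₗ whittakerAvg ψ π) x = η (f x) := by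
    intro x
    rw [LinearMap.comp_apply, ← coe_whittakerAvg_toRepresentation]
    exact (LinearMap.congr_fun hext _).trans (apply_whittakerAvg hchar hηf x)
  -- The functional of the subquotient is extended linearly from T to π and then averaged over N, so
  -- it becomes a multiple of ξ.
  obtain ⟨c, hc⟩ := hspan _ (comp_whittakerAvg_mem ψ π ext)
  obtain ⟨y, hy⟩ : ∃ y, η y ≠ 0 := by
    by_contra! h
    exact hη0 (LinearMap.ext h)
  obtain ⟨x, rfl⟩ := hf y
  have h1 := hζ (T.toRepresentation (-1) x)
  rw [f.isIntertwining, hsτ, map_smul, ← hζ x, hc, smul_eq_mul] at h1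
  have h2 := LinearMap.congr_fun hs' (x : V)
  have h3 := hζ x
  rw [hc] at h3
  rw [← h3] at hy
  refine mul_right_cancel₀ hy (h1.symm.trans ?_)
  rw [LinearMap.smul_apply, LinearMap.smul_apply, smul_eq_mul, smul_eq_mul]
  rw [LinearMap.comp_apply, LinearMap.smul_apply, smul_eq_mul] at h2
  change c * ξ (π (-1) x) = _
  rw [h2]
  ring

/-- Representations of Whittaker type have a generic subquotient. -/
lemma exists_isGenericSignValue (hchar : ringChar R ≠ ringChar k) {ξ : Module.Dual R V}
    (hξ : ξ ∈ whittakerFunctionals ψ π) (hξ0 : ξ ≠ 0)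
    (hspan : ∀ η ∈ whittakerFunctionals ψ π, ∃ c : R, η = c • ξ) {s : R}
    (hs : ξ ∘ₗ π (-1) = s • ξ) : IsGenericSignValue ψ π s := by
  obtain ⟨y, hy⟩ : ∃ y, ξ y ≠ 0 := by
    by_contra! h
    exact hξ0 (LinearMap.ext h)
  set x₀ := whittakerAvg ψ π y with hx₀
  have hx₀m : x₀ ∈ whittakerVectors ψ π := whittakerAvg_mem ψ π y
  have hξx : ξ x₀ ≠ 0 := by rwa [hx₀, apply_whittakerAvg hchar hξ]
  have hvec : ∀ z ∈ whittakerVectors ψ π, z = (ξ z / ξ x₀) • x₀ := by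
    intro z hz
    rw [← sub_eq_zero]
    refine (Module.forall_dual_apply_eq_zero_iff R _).1 fun lam => ?_
    obtain ⟨c, hc⟩ := hspan _ (comp_whittakerAvg_mem ψ π lam)
    have h1 : ∀ z ∈ whittakerVectors ψ π, lam z = c * ξ z := by
      intro z hz
      have := LinearMap.congr_fun hc z
      rwa [LinearMap.comp_apply, whittakerAvg_of_mem hchar hz] at this
    rw [map_sub, map_smul, h1 z hz, h1 x₀ hx₀m, smul_eq_mul]
    field_simp
    ring
  -- The generic subquotient is the subrepresentation generated by the Whittaker vector x₀, modulo
  -- the vectors whose Whittaker function vanishes.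
  let T := orbitSpan π x₀
  let κ : T.toSubmodule →ₗ[R] (GL (Fin n) k → R) :=
    LinearMap.pi fun g => ξ ∘ₗ π g ∘ₗ T.toSubmodule.subtype
  have hκ : ∀ t : T.toSubmodule, t ∈ LinearMap.ker κ ↔ ∀ g, ξ (π g t) = 0 := by
    intro t
    rw [LinearMap.mem_ker, funext_iff]
    rfl
  have hle : ∀ g, LinearMap.ker κ ≤ (LinearMap.ker κ).comap (T.toRepresentation g) := by
    intro g t ht
    rw [Submodule.mem_comap, hκ]
    rw [hκ] at ht
    intro h
    have h1 := ht (h * g)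
    rwa [map_mul] at h1
  let τ := T.toRepresentation.quotient (LinearMap.ker κ) hle
  have hτ : ∀ g t, (LinearMap.ker κ).mkQ (T.toRepresentation g t) =
      τ g ((LinearMap.ker κ).mkQ t) := fun g t => rfl
  let t₀ : T.toSubmodule := ⟨x₀, self_mem_orbitSpan π x₀⟩
  set e₀ := (LinearMap.ker κ).mkQ t₀ with he₀
  have havg : ∀ t : T.toSubmodule, whittakerAvg ψ τ ((LinearMap.ker κ).mkQ t) =
      (ξ t / ξ x₀) • e₀ := by
    intro t
    rw [← map_whittakerAvg_of_intertwining _ hτ, he₀, ← map_smul]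
    congr 1
    apply Subtype.ext
    rw [coe_whittakerAvg_toRepresentation, hvec _ (whittakerAvg_mem ψ π _),
      apply_whittakerAvg hchar hξ]
    rfl
  have he₀0 : e₀ ≠ 0 := by
    intro h
    rw [he₀, Submodule.mkQ_apply, Submodule.Quotient.mk_eq_zero, hκ] at h
    have := h 1
    rw [map_one] at this
    exact hξx this
  have hgen : ∀ S : Subrepresentation τ, e₀ ∈ S.toSubmodule → S = ⊤ := by
    intro S hS
    apply Subrepresentation.toSubmodule_injective
    have h1 : (orbitSpan π x₀).toSubmodule ≤
        (S.toSubmodule.comap (LinearMap.ker κ).mkQ).map T.toSubmodule.subtype := by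
      refine Submodule.span_le.2 ?_
      rintro _ ⟨g, rfl⟩
      refine ⟨T.toRepresentation g t₀, ?_, rfl⟩
      change (LinearMap.ker κ).mkQ (T.toRepresentation g t₀) ∈ S.toSubmodule
      rw [hτ]
      exact S.apply_mem_toSubmodule g hS
    refine eq_top_iff.2 fun z _ => ?_
    obtain ⟨t, rfl⟩ := (LinearMap.ker κ).mkQ_surjective z
    obtain ⟨t', ht', htt⟩ := h1 t.2
    have : t' = t := Subtype.ext htt
    rw [← this]
    exact ht'
  have hirr : τ.IsIrreducible := by
    have : Nontrivial (Subrepresentation τ) := ⟨⟨⊥, ⊤, fun h => he₀0 (by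
      have h1 : e₀ ∈ (⊤ : Subrepresentation τ).toSubmodule := Submodule.mem_top
      rw [← h] at h1
      exact h1)⟩⟩
    refine ⟨fun S => ?_⟩
    by_cases hS : ∀ z ∈ S.toSubmodule, z = 0
    · left
      apply Subrepresentation.toSubmodule_injective
      exact (Submodule.eq_bot_iff _).2 hS
    · right
      push Not at hS
      obtain ⟨z, hz, hz0⟩ := hS
      obtain ⟨t, rfl⟩ := (LinearMap.ker κ).mkQ_surjective z
      rw [ne_eq, Submodule.mkQ_apply, Submodule.Quotient.mk_eq_zero, hκ] at hz0
      push Not at hz0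
      obtain ⟨g, hg⟩ := hz0
      -- A vector with Whittaker function non-zero at g averages, after translation by g, to a
      -- non-zero multiple of the generator.
      have h1 : whittakerAvg ψ τ ((LinearMap.ker κ).mkQ (T.toRepresentation g t)) ∈
          S.toSubmodule := by
        rw [whittakerAvg_apply]
        refine Submodule.smul_mem _ _ (sum_mem fun u _ => Submodule.smul_mem _ _ ?_)
        refine S.apply_mem_toSubmodule _ ?_
        rw [hτ]
        exact S.apply_mem_toSubmodule _ hz
      rw [havg] at h1
      refine hgen S ((Submodule.smul_mem_iff _ (div_ne_zero ?_ hξx)).1 h1)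
      exact hg
  have hker : LinearMap.ker κ ≤ LinearMap.ker (ξ ∘ₗ T.toSubmodule.subtype) := by
    intro t ht
    rw [hκ] at ht
    have := ht 1
    rw [map_one] at this
    exact this
  let η := (LinearMap.ker κ).liftQ (ξ ∘ₗ T.toSubmodule.subtype) hker
  have hη : η ∈ whittakerFunctionals ψ τ := by
    intro u hu z
    obtain ⟨t, rfl⟩ := (LinearMap.ker κ).mkQ_surjective z
    rw [← hτ]
    exact hξ u hu t
  have hηe : η e₀ = ξ x₀ := rfl
  have htype : IsWhittakerType ψ τ := by
    let η' : whittakerFunctionals ψ τ := ⟨η, hη⟩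
    have h0 : ∃ η' : whittakerFunctionals ψ τ, η' ≠ 0 ∧
        ∀ ζ : whittakerFunctionals ψ τ, ∃ c : R, c • η' = ζ := by
      refine ⟨η', fun h => hξx ?_, fun ζ => ⟨ζ.1 e₀ / ξ x₀, Subtype.ext ?_⟩⟩
      · have h1 : η = 0 := congrArg Subtype.val h
        rw [← hηe, h1]
        rfl
      · refine functional_eq_of_whittakerVectors hchar (x := e₀) (fun z hz => ?_)
          (Submodule.smul_mem _ _ hη) ζ.2 ?_
        · obtain ⟨t, rfl⟩ := (LinearMap.ker κ).mkQ_surjective z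
          exact ⟨_, (whittakerAvg_of_mem hchar hz).symm.trans (havg t)⟩
        · change ζ.1 e₀ / ξ x₀ * η e₀ = ζ.1 e₀
          rw [hηe]
          exact div_mul_cancel₀ _ hξx
    exact (finrank_submodule_eq_one_iff (whittakerFunctionals ψ τ)).2 h0
  refine ⟨_, _, _, τ, ⟨hirr, htype⟩, ⟨T, LinearMap.intertwiningMap_of_isIntertwiningMap _ _
    (LinearMap.ker κ).mkQ hτ, (LinearMap.ker κ).mkQ_surjective⟩, fun z => ?_⟩
  have hx₀s : π (-1) x₀ = s • x₀ := by
    have h1 : π (-1) x₀ ∈ whittakerVectors ψ π := by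
      intro u hu
      rw [← Module.End.mul_apply, ← map_mul, ← neg_one_mul_comm_GL, map_mul, Module.End.mul_apply,
        hx₀m u hu, map_smul]
    rw [hvec _ h1]
    congr 1
    have h2 := LinearMap.congr_fun hs x₀
    rw [LinearMap.comp_apply, LinearMap.smul_apply, smul_eq_mul] at h2
    rw [h2, mul_div_cancel_right₀ _ hξx]
  have hTs : T.toSubmodule ≤ LinearMap.ker (π (-1) - s • LinearMap.id) := by
    refine Submodule.span_le.2 ?_
    rintro _ ⟨g, rfl⟩
    change _ = _
    rw [LinearMap.sub_apply, LinearMap.smul_apply, LinearMap.id_apply, ← Module.End.mul_apply,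
      ← map_mul, neg_one_mul_comm_GL, map_mul, Module.End.mul_apply, hx₀s, map_smul, sub_self]
  obtain ⟨t, rfl⟩ := (LinearMap.ker κ).mkQ_surjective z
  rw [← hτ, ← map_smul]
  congr 1
  apply Subtype.ext
  exact sub_eq_zero.1 (hTs t.2)

end GenericSubquotient

/-! ### Rankin–Selberg forms and the gamma factor -/

section WhittakerModel

variable {k : Type uk} [Field k] {R : Type uR} [Field R] {n : ℕ}
  {V : Type v} [AddCommGroup V] [Module R V]

lemma exists_eq_of_mem_whittakerModel {ψ : AddChar k R}
    {π : Representation R (GL (Fin n) k) V} {ξ : Module.Dual R V}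
    (hspan : ∀ η ∈ whittakerFunctionals ψ π, ∃ c : R, η = c • ξ) {W : GL (Fin n) k → R}
    (hW : W ∈ whittakerModel ψ π) : ∃ x, W = fun g => ξ (π g x) := by
  obtain ⟨η, hη, x, rfl⟩ := hW
  obtain ⟨c, rfl⟩ := hspan η hη
  exact ⟨c • x, by simp⟩

lemma antidiagGL_mul_starGL_involutive (g : GL (Fin n) k) :
    antidiagGL k n * starGL (antidiagGL k n * starGL g) = g := by
  rw [starGL_mul, starGL_starGL, starGL_antidiagGL, ← mul_assoc, antidiagGL_mul_self, one_mul]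

lemma whittakerProj_neg_one_mul {H : Subgroup (GL (Fin n) k)} (hH : -1 ∈ H)
    (ψ : AddChar k R) {f : GL (Fin n) k → R} (hf : f ∈ inducedTrivial R H) (g : GL (Fin n) k) :
    whittakerProj ψ f (-1 * g) = whittakerProj ψ f g := by
  rw [whittakerProj, whittakerProj]
  congr 1
  refine finsum_congr fun u => ?_
  rw [← mul_assoc, ← neg_one_mul_comm_GL, mul_assoc, hf _ hH]

end WhittakerModel

section Pairing

variable {k : Type uk} [Field k] [Finite k] {R : Type uR} [Field R] {m : ℕ}
  {V : Type v} [AddCommGroup V] [Module R V] {V' : Type w} [AddCommGroup V'] [Module R V']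

/-- The Rankin–Selberg sum as a bilinear form on a pair of representations with Whittaker
functionals `ξ` and `ξ'`. -/
def rankinSelbergForm (π : Representation R (GL (Fin (m + 1)) k) V)
    (π' : Representation R (GL (Fin m) k) V') (ξ : Module.Dual R V) (ξ' : Module.Dual R V') :
    V →ₗ[R] V' →ₗ[R] R :=
  (Nat.card (unipotent k m) : R)⁻¹ •
    ∑ g, (LinearMap.mul R R).compl₁₂ (ξ ∘ₗ π (diagOne g)) (ξ' ∘ₗ π' g)

lemma rankinSelbergForm_apply (π : Representation R (GL (Fin (m + 1)) k) V)
    (π' : Representation R (GL (Fin m) k) V') (ξ : Module.Dual R V) (ξ' : Module.Dual R V')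
    (x : V) (v : V') : rankinSelbergForm π π' ξ ξ' x v =
      (Nat.card (unipotent k m) : R)⁻¹ * ∑ g, ξ (π (diagOne g) x) * ξ' (π' g v) := by
  simp [rankinSelbergForm, LinearMap.sum_apply]

lemma rankinSelbergForm_diagOne (π : Representation R (GL (Fin (m + 1)) k) V)
    (π' : Representation R (GL (Fin m) k) V') (ξ : Module.Dual R V) (ξ' : Module.Dual R V')
    (a : GL (Fin m) k) (x : V) (v : V') :
    rankinSelbergForm π π' ξ ξ' (π (diagOne a) x) (π' a v) = rankinSelbergForm π π' ξ ξ' x v := by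
  rw [rankinSelbergForm_apply, rankinSelbergForm_apply]
  congr 1
  refine Fintype.sum_equiv (Equiv.mulRight a) _ _ fun g => ?_
  rw [Equiv.coe_mulRight, diagOne_mul, map_mul, map_mul, Module.End.mul_apply,
    Module.End.mul_apply]

lemma rankinSelbergForm_starRep_diagOne (π : Representation R (GL (Fin (m + 1)) k) V)
    (π' : Representation R (GL (Fin m) k) V') (ξ : Module.Dual R V) (ξ' : Module.Dual R V')
    (a : GL (Fin m) k) (x : V) (v : V') :
    rankinSelbergForm (starRep π) (starRep π') ξ ξ' (π (diagOne a) x) (π' a v) =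
      rankinSelbergForm (starRep π) (starRep π') ξ ξ' x v := by
  have h := rankinSelbergForm_diagOne (starRep π) (starRep π') ξ ξ' (starGL a) x v
  rwa [starRep_apply, starRep_apply, ← starGL_diagOne, starGL_starGL, starGL_starGL] at h

variable {ψ : AddChar k R} {π : Representation R (GL (Fin (m + 1)) k) V}
  {π' : Representation R (GL (Fin m) k) V'} {ξ : Module.Dual R V} {x₀ : V} {ξ' : Module.Dual R V'}

lemma rankinSelbergSum_eq_form (hchar : ringChar R ≠ ringChar k)
    (hξ : ξ ∈ whittakerFunctionals ψ π) (hξ' : ξ' ∈ whittakerFunctionals ψ⁻¹ π') (x : V) (v : V') :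
    rankinSelbergSum (fun g => ξ (π g x)) (fun g => ξ' (π' g v)) =
      rankinSelbergForm π π' ξ ξ' x v := by
  rw [rankinSelbergForm_apply]
  exact rankinSelbergSum_eq hchar (isWhittakerFunction_of_mem hξ x)
    (isWhittakerFunction_of_mem hξ' v)

lemma rankinSelbergSum_tilde (hchar : ringChar R ≠ ringChar k)
    (hξ : ξ ∈ whittakerFunctionals ψ π) (hξ' : ξ' ∈ whittakerFunctionals ψ⁻¹ π') (x : V) (v : V') :
    rankinSelbergSum (tilde fun g => ξ (π g x)) (tilde fun g => ξ' (π' g v)) =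
      rankinSelbergForm (starRep π) (starRep π') (ξ ∘ₗ π (antidiagGL k (m + 1)))
        (ξ' ∘ₗ π' (antidiagGL k m)) x v := by
  rw [tilde_whittaker, tilde_whittaker]
  exact rankinSelbergSum_eq_form hchar (comp_antidiagGL_mem hξ) (comp_antidiagGL_mem hξ') x v

/-- Invariant bilinear forms are multiples of the Rankin–Selberg form. -/
lemma IsKirillovPair.eq_smul_rankinSelbergForm (hchar : ringChar R ≠ ringChar k)
    (hK : IsKirillovPair ψ π ξ x₀)
    (hspan : ∀ η ∈ whittakerFunctionals ψ⁻¹ π', ∃ c : R, η = c • ξ') (J : V →ₗ[R] V' →ₗ[R] R)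
    (hJ : ∀ a x v, J (π (diagOne a) x) (π' a v) = J x v) :
    ∃ c : R, ∀ x v, J x v = c * rankinSelbergForm π π' ξ ξ' x v := by
  -- Invariance moves u to the Bessel vector, so J(x₀, ·) is a Whittaker functional of π'; the delta
  -- expansion of x then recovers J.
  have hmem : J x₀ ∈ whittakerFunctionals ψ⁻¹ π' := by
    intro u hu v
    rw [← hJ u⁻¹, ← Module.End.mul_apply, ← map_mul, inv_mul_cancel, map_one, Module.End.one_apply,
      hK.map_unipotent _ (diagOne_mem_unipotent.2 (inv_mem hu)), map_smul, LinearMap.smul_apply,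
      unipChar_diagOne, unipChar_inv_elt ψ hu, unipChar_inv_char, smul_eq_mul]
  obtain ⟨c, hc⟩ := hspan _ hmem
  refine ⟨c, fun x v => ?_⟩
  have h1 : ∀ g, J (π (diagOne g⁻¹) x₀) v = c * ξ' (π' g v) := by
    intro g
    rw [← hJ g, ← Module.End.mul_apply, ← map_mul, ← diagOne_mul, mul_inv_cancel, diagOne_one,
      map_one, Module.End.one_apply, hc, LinearMap.smul_apply, smul_eq_mul]
  conv_lhs => rw [hK.eq_sum hchar x]
  rw [map_smul, map_sum, LinearMap.smul_apply, LinearMap.sum_apply, rankinSelbergForm_apply,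
    smul_eq_mul, mul_left_comm, Finset.mul_sum _ _ c]
  congr 1
  refine Finset.sum_congr rfl fun g _ => ?_
  rw [map_smul, LinearMap.smul_apply, h1, smul_eq_mul, mul_left_comm]

/-- Pairing with the delta function at N evaluates the other variable at the identity. This provides
the non-vanishing needed to identify the scalar. -/
lemma IsKirillovPair.rankinSelbergForm_diagOne_inv (hchar : ringChar R ≠ ringChar k)
    (hK : IsKirillovPair ψ π ξ x₀) (hξ' : ξ' ∈ whittakerFunctionals ψ⁻¹ π') (g : GL (Fin m) k)
    (v : V') : rankinSelbergForm π π' ξ ξ' (π (diagOne g⁻¹) x₀) v = ξ' (π' g v) := by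
  have h1 := rankinSelbergForm_diagOne π π' ξ ξ' g (π (diagOne g⁻¹) x₀) v
  rw [← Module.End.mul_apply, ← map_mul, ← diagOne_mul, mul_inv_cancel, diagOne_one,
    map_one, Module.End.one_apply] at h1
  rw [← h1, rankinSelbergForm_apply, inv_mul_eq_iff_eq_mul₀ (card_unipotent_ne_zero hchar m),
    ← hK.sum_mul_apply (fun a => ξ' (π' a (π' g v)))]
  · exact Finset.sum_congr rfl fun a _ => mul_comm _ _
  · intro u hu
    rw [hξ' u hu, unipChar_inv_char, mul_right_comm, inv_mul_cancel₀ (unipChar_ne_zero ψ u),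
      one_mul]

lemma sum_mul_inducedTrivial (H : Subgroup (GL (Fin m) k)) (F : GL (Fin m) k → R)
    {f : GL (Fin m) k → R} (hf : f ∈ inducedTrivial R H)
    [Fintype (Quotient (QuotientGroup.rightRel H))] :
    ∑ g, F g * f g = ∑ q : Quotient (QuotientGroup.rightRel H),
      f q.out * ∑ h : H, F (h * q.out) := by
  rw [sum_eq_sum_quotient H]
  refine Finset.sum_congr rfl fun q _ => ?_
  rw [Finset.mul_sum]
  refine Finset.sum_congr rfl fun h _ => ?_
  rw [hf _ h.2, mul_comm]

lemma sum_eq_card_mul_lambdaForm (hchar : ringChar R ≠ ringChar k) (H : Subgroup (GL (Fin m) k))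
    (π : Representation R (GL (Fin (m + 1)) k) V) (ξ : Module.Dual R V) (x : V) :
    ∑ h : H, ξ (π (diagOne (h : GL (Fin m) k)) x) =
      (Nat.card ((unipotent k m).subgroupOf H) : R) * lambdaForm H π ξ x := by
  rw [lambdaForm_apply, mul_inv_cancel_left₀ (card_unipotent_subgroupOf_ne_zero hchar H)]

/-- Unfolding: the projector is dropped, then the sum is grouped along H-cosets, on which f is
constant; each inner sum is a value of Λ. -/
lemma rankinSelbergForm_of_whittakerProj (hchar : ringChar R ≠ ringChar k)
    {H : Subgroup (GL (Fin m) k)} [Fintype (Quotient (QuotientGroup.rightRel H))]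
    (hξ : ξ ∈ whittakerFunctionals ψ π)
    {f : GL (Fin m) k → R} (hf : f ∈ inducedTrivial R H) {v : V'}
    (hv : ∀ g, ξ' (π' g v) = whittakerProj ψ⁻¹ f g) (x : V) :
    rankinSelbergForm π π' ξ ξ' x v = (Nat.card (unipotent k m) : R)⁻¹ *
      ∑ q : Quotient (QuotientGroup.rightRel H), f q.out *
        ((Nat.card ((unipotent k m).subgroupOf H) : R) *
          lambdaForm H π ξ (π (diagOne q.out) x)) := by
  simp only [rankinSelbergForm_apply, hv]
  rw [sum_mul_whittakerProj hchar (isWhittakerFunction_of_mem hξ x).diagOne f,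
    sum_mul_inducedTrivial H _ hf]
  congr 1
  refine Finset.sum_congr rfl fun q _ => ?_
  rw [← sum_eq_card_mul_lambdaForm hchar]
  congr 1
  refine Finset.sum_congr rfl fun h _ => ?_
  rw [diagOne_mul, map_mul, Module.End.mul_apply]

/-- The substitution g ↦ w g^* is made first on GL_m and then on H, which it preserves because w
lies in H. The translates π(diag(q, 1))x are thus the same as in the untwisted sum. -/
lemma rankinSelbergForm_starRep_of_whittakerProj (hchar : ringChar R ≠ ringChar k)
    {H : Subgroup (GL (Fin m) k)} [Fintype (Quotient (QuotientGroup.rightRel H))]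
    (hstar : ∀ h ∈ H, starGL h ∈ H) (hw : antidiagGL k m ∈ H) {η : Module.Dual R V}
    (hη : η ∈ whittakerFunctionals ψ⁻¹ (starRep π))
    {f : GL (Fin m) k → R} (hf : f ∈ inducedTrivial R H) {v : V'}
    (hv : ∀ g, ξ' (π' g v) = whittakerProj ψ⁻¹ f g) (x : V) :
    rankinSelbergForm (starRep π) (starRep π') η (ξ' ∘ₗ π' (antidiagGL k m)) x v =
      (Nat.card (unipotent k m) : R)⁻¹ *
      ∑ q : Quotient (QuotientGroup.rightRel H), f q.out *
        ((Nat.card ((unipotent k m).subgroupOf H) : R) *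
          lambdaForm H (starRep π) η (π (diagOne q.out) x)) := by
  have hΦ := (isWhittakerFunction_of_mem hη x).diagOne.tilde
  rw [inv_inv] at hΦ
  let e : GL (Fin m) k ≃ GL (Fin m) k :=
    ⟨fun g => antidiagGL k m * starGL g, fun g => antidiagGL k m * starGL g,
      antidiagGL_mul_starGL_involutive, antidiagGL_mul_starGL_involutive⟩
  have he : ∀ g, e g = antidiagGL k m * starGL g := fun _ => rfl
  let eH : H ≃ H :=
    ⟨fun g => ⟨antidiagGL k m * starGL g, mul_mem hw (hstar _ g.2)⟩,
      fun g => ⟨antidiagGL k m * starGL g, mul_mem hw (hstar _ g.2)⟩,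
      fun g => Subtype.ext (antidiagGL_mul_starGL_involutive _),
      fun g => Subtype.ext (antidiagGL_mul_starGL_involutive _)⟩
  have heH : ∀ h, (eH h : GL (Fin m) k) = antidiagGL k m * starGL h := fun _ => rfl
  have h1 : ∑ g, η (starRep π (diagOne g) x) * (ξ' ∘ₗ π' (antidiagGL k m)) (starRep π' g v) =
      ∑ g, tilde (fun g => η (starRep π (diagOne g) x)) g * whittakerProj ψ⁻¹ f g := by
    refine Fintype.sum_equiv e _ _ fun g => ?_
    rw [he, ← hv, tilde, antidiagGL_mul_starGL_involutive, map_mul π', Module.End.mul_apply,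
      LinearMap.comp_apply, starRep_apply π']
  rw [rankinSelbergForm_apply, h1, sum_mul_whittakerProj hchar hΦ f, sum_mul_inducedTrivial H _ hf]
  congr 1
  refine Finset.sum_congr rfl fun q _ => ?_
  rw [← sum_eq_card_mul_lambdaForm hchar]
  congr 1
  refine Fintype.sum_equiv eH _ _ fun h => ?_
  rw [heH, tilde, starGL_mul, ← mul_assoc, diagOne_mul, map_mul, Module.End.mul_apply,
    starRep_apply π (diagOne (starGL q.out)), ← starGL_diagOne, starGL_starGL]

/-- If `Λ^* = c · Λ`, then the functional equation with the scalar `c` holds for functions in the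
image of `Ind_H^G(1)`. -/
lemma rankinSelbergForm_starRep_eq_mul (hchar : ringChar R ≠ ringChar k)
    {H : Subgroup (GL (Fin m) k)} (hstar : ∀ h ∈ H, starGL h ∈ H) (hw : antidiagGL k m ∈ H)
    (hξ : ξ ∈ whittakerFunctionals ψ π) {c : R}
    (hc : lambdaForm H (starRep π) (ξ ∘ₗ π (antidiagGL k (m + 1))) = c • lambdaForm H π ξ)
    {f : GL (Fin m) k → R} (hf : f ∈ inducedTrivial R H) {v : V'}
    (hv : ∀ g, ξ' (π' g v) = whittakerProj ψ⁻¹ f g) (x : V) :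
    rankinSelbergForm (starRep π) (starRep π') (ξ ∘ₗ π (antidiagGL k (m + 1)))
        (ξ' ∘ₗ π' (antidiagGL k m)) x v = c * rankinSelbergForm π π' ξ ξ' x v := by
  classical
  have : Fintype (Quotient (QuotientGroup.rightRel H)) := Fintype.ofFinite _
  rw [rankinSelbergForm_of_whittakerProj hchar hξ hf hv,
    rankinSelbergForm_starRep_of_whittakerProj hchar hstar hw (comp_antidiagGL_mem hξ) hf hv,
    hc, mul_left_comm c, Finset.mul_sum _ _ c]
  congr 1
  refine Finset.sum_congr rfl fun q _ => ?_
  rw [LinearMap.smul_apply, smul_eq_mul]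
  ring

theorem isFormRatio_iff (hchar : ringChar R ≠ ringChar k)
    {H : (r : ℕ) → Subgroup (GL (Fin r) k)} (hH : IsAdmissibleFamily ψ H m)
    (hK : IsKirillovPair ψ π ξ x₀) {c : R}
    (hc : lambdaForm (H m) (starRep π) (ξ ∘ₗ π (antidiagGL k (m + 1))) =
      c • lambdaForm (H m) π ξ) (a : R) : IsFormRatio ψ (H m) π a ↔ a = c := by
  have h1 : ∀ x, formΛ (H m) (fun g => ξ (π g x)) = lambdaForm (H m) π ξ x :=
    formΛ_eq hchar (hH.unipChar_eq_one m) hK.mem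
  have h2 : ∀ x, formΛStar (H m) (fun g => ξ (π g x)) = c * lambdaForm (H m) π ξ x := by
    intro x
    rw [formΛStar, tilde_whittaker,
      formΛ_eq hchar (hH.inv.unipChar_eq_one m) (comp_antidiagGL_mem hK.mem), hc]
    rfl
  constructor
  · intro h
    have h3 := h _ ⟨ξ, hK.mem, x₀, rfl⟩
    rwa [h1, h2, hH.lambdaForm_apply_self hchar hK, mul_one, mul_one, eq_comm] at h3
  · rintro rfl W hW
    obtain ⟨x, rfl⟩ := exists_eq_of_mem_whittakerModel hK.exists_smul hW
    rw [h1, h2]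

/-- Uniqueness of invariant bilinear forms gives one scalar γ for all pairs. It is identified with c
on the vector v₀ coming from Ind(1), where the unfolded sums can be compared. -/
theorem isGammaFactor_iff (hchar : ringChar R ≠ ringChar k)
    {H : (r : ℕ) → Subgroup (GL (Fin r) k)} (hH : IsAdmissibleFamily ψ H m)
    (hK : IsKirillovPair ψ π ξ x₀) {c : R}
    (hc : lambdaForm (H m) (starRep π) (ξ ∘ₗ π (antidiagGL k (m + 1))) =
      c • lambdaForm (H m) π ξ) (hπ' : IsWhittakerType ψ π') (hmeet : MeetsInduced ψ⁻¹ (H m) π')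
    (a : R) : IsGammaFactor ψ π π' a ↔ a = c := by
  obtain ⟨ζ, hζ, hζ0, hζspan⟩ := hπ'.exists_generator
  set ξ' := ζ ∘ₗ π' (signGL k m) with hξ'
  have hmem : ξ' ∈ whittakerFunctionals ψ⁻¹ π' := comp_signGL_mem hζ
  have hspan : ∀ η ∈ whittakerFunctionals ψ⁻¹ π', ∃ c : R, η = c • ξ' :=
    exists_smul_comp_signGL hζspan
  obtain ⟨s, hs⟩ := hζspan _ (comp_neg_one_mem hζ)
  obtain ⟨W, ⟨hW, f, hf, hWf⟩, hW0⟩ := hmeet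
  obtain ⟨v₀, rfl⟩ := exists_eq_of_mem_whittakerModel hspan hW
  obtain ⟨g₀, hg₀⟩ : ∃ g, ξ' (π' g v₀) ≠ 0 := by
    by_contra! h
    exact hW0 (funext h)
  -- Since -1 is central and lies in H, the function I(f) is invariant under it; being non-zero, it
  -- detects the scalar by which -1 acts.
  have hs1 : s = 1 := by
    have h1 := whittakerProj_neg_one_mul hH.neg_one_mem ψ⁻¹ hf g₀
    rw [hWf] at h1
    have h2 : ξ' (π' (-1 * g₀) v₀) = s * ξ' (π' g₀ v₀) := by
      rw [hξ', LinearMap.comp_apply, LinearMap.comp_apply, ← Module.End.mul_apply, ← map_mul,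
        ← mul_assoc, ← neg_one_mul_comm_GL, mul_assoc, map_mul, map_mul, Module.End.mul_apply]
      exact LinearMap.congr_fun hs _
    exact mul_right_cancel₀ hg₀ ((h2.symm.trans h1).trans (one_mul _).symm)
  have hproj := rankinSelbergForm_starRep_eq_mul hchar (hH.starGL_mem m)
    hH.antidiagGL_mem hK.mem hc hf (fun g => congrFun hWf.symm g)
  have hne : rankinSelbergForm π π' ξ ξ' (π (diagOne g₀⁻¹) x₀) v₀ ≠ 0 := by
    rwa [hK.rankinSelbergForm_diagOne_inv hchar hmem]
  obtain ⟨γ, hγ⟩ := hK.eq_smul_rankinSelbergForm hchar hspan _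
    (rankinSelbergForm_starRep_diagOne π π' (ξ ∘ₗ π (antidiagGL k (m + 1)))
      (ξ' ∘ₗ π' (antidiagGL k m)))
  obtain rfl : γ = c := mul_right_cancel₀ hne ((hγ _ _).symm.trans (hproj _))
  constructor
  · rintro ⟨t, ht, h⟩
    obtain rfl : t = 1 := (ht.comp_neg_one hchar hζspan hs).trans hs1
    have h1 := h _ ⟨ξ, hK.mem, π (diagOne g₀⁻¹) x₀, rfl⟩ _ ⟨ξ', hmem, v₀, rfl⟩
    rw [rankinSelbergSum_eq_form hchar hK.mem hmem, rankinSelbergSum_tilde hchar hK.mem hmem,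
      hγ, one_pow, one_mul] at h1
    exact (mul_right_cancel₀ hne h1).symm
  · rintro rfl
    refine ⟨s, exists_isGenericSignValue hchar hζ hζ0 hζspan hs, fun W hW W' hW' => ?_⟩
    obtain ⟨x, rfl⟩ := exists_eq_of_mem_whittakerModel hK.exists_smul hW
    obtain ⟨v, rfl⟩ := exists_eq_of_mem_whittakerModel hspan hW'
    rw [rankinSelbergSum_eq_form hchar hK.mem hmem, rankinSelbergSum_tilde hchar hK.mem hmem,
      hγ, hs1, one_pow, one_mul]

end Pairing

end FiniteGL

end

/-- Here n = m + 1. Each equivalence with a = c contains both existence and uniqueness of the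
scalar, and c is chosen before π', which is the independence of π'. -/
theorem proposition6p10
    {k : Type*} [Field k] [Finite k] {R : Type*} [Field R] [IsAlgClosed R]
    (hchar : ringChar R ≠ ringChar k)
    (ψ : AddChar k R) (hψ : ψ ≠ 1)
    (H : (r : ℕ) → Subgroup (GL (Fin r) k))
    (hH : FiniteGL.IsGaloisCase ψ H ∨ FiniteGL.IsLeviCase H)
    (m : ℕ) (hm : 1 ≤ m)
    {V : Type*} [AddCommGroup V] [Module R V] (π : Representation R (GL (Fin (m + 1)) k) V)
    (hcusp : FiniteGL.IsCuspidal π) (hdist : FiniteGL.IsDistinguished (H (m + 1)) π) :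
    ∃ c : R, c ≠ 0 ∧
      (∀ a : R, FiniteGL.IsFormRatio ψ (H m) π a ↔ a = c) ∧
      ∀ {V' : Type*} [AddCommGroup V'] [Module R V'] (π' : Representation R (GL (Fin m) k) V'),
        FiniteGL.IsWhittakerType ψ π' → FiniteGL.MeetsInduced ψ⁻¹ (H m) π' →
        ∀ a : R, FiniteGL.IsGammaFactor ψ π π' a ↔ a = c := by
  have hirr := hcusp.1
  have hform := hcusp.hasNoUnipotentForms
  have hadm := FiniteGL.isAdmissibleFamily_of_case hchar hψ hH hm hirr hform hdist
  obtain ⟨ξ, x₀, hK⟩ := FiniteGL.exists_isKirillovPair hchar hψ hirr hform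
  obtain ⟨c, hc0, hc⟩ := hadm.exists_ratio hchar hψ hirr hform hK hdist
  exact ⟨c, hc0, FiniteGL.isFormRatio_iff hchar hadm hK hc, fun π' hπ' hmeet =>
    FiniteGL.isGammaFactor_iff hchar hadm hK hc hπ' hmeet⟩
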